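/- Let $\mathbb T$ be the unit circle with normalized Lebesgue measure $\mathrm dm(\zeta)=\frac{\mathrm d\zeta}{2\pi \mathrm i\zeta}$, and let $\mu$ be an $N\times N$ matrix of finite complex Borel measures on $\mathbb T$ that is quasi-definite: with $\hat\mu(j)=\oint_{\mathbb T}\bar\zeta^{\,j}\,\mathrm d\mu(\zeta)$, the block Toeplitz matrices $(\hat\mu(i-j))_{0\le i,j<n}$ and $(\hat\mu(j-i))_{0\le i,j<n}$ are nonsingular for all $n\ge 1$. Let $P^L_{1,n},P^R_{1,n},P^R_{2,n}$ be the matrix Szegő polynomials: the monic $N\times N$ matrix polynomials of degree $n$ with $$\oint P^L_{1,n}(\zeta)\,\mathrm d\mu(\zeta)\,\bar\zeta^{\,j}=0,\qquad \oint\bar\zeta^{\,j}\,\mathrm d\mu(\zeta)\,P^R_{1,n}(\zeta)=0,\qquad \oint P^R_{2,n}(\zeta)^\dagger\,\mathrm d\mu(\zeta)\,\zeta^{j}=0\qquad(0\le j<n).$$ Put $\tilde P^R_{2,n}(z)=z^n\big(P^R_{2,n}(1/\bar z)\big)^\dagger$ (a polynomial in $z$), $H^R_n=\oint P^R_{2,n}(\zeta)^\dagger\,\mathrm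 d\mu(\zeta)\,P^R_{1,n}(\zeta)$, and, for $z\notin\mathbb T$, $$Q^L_{1,n}(z)=\oint\bar\zeta^{\,n}P^L_{1,n}(\zeta)\frac{\mathrm d\mu(\zeta)}{1-\bar\zeta z},\qquad Q^R_{2,n}(z)=\oint\bar\zeta^{\,n+1}\tilde P^R_{2,n}(\zeta)\frac{\mathrm d\mu(\zeta)}{1-\bar\zeta z}.$$ Define $$Y_n(z)=\begin{pmatrix}P^L_{1,n}(z)&Q^L_{1,n}(z)\\-(H^R_{n-1})^{-1}\tilde P^R_{2,n-1}(z)&-(H^R_{n-1})^{-1}Q^R_{2,n-1}(z)\end{pmatrix}\ (n\ge1),\qquad Y_0(z)=\begin{pmatrix}I_N&Q^L_{1,0}(z)\\0&I_N\end{pmatrix}.$$ For a matrix of weights $w:\mathbb T\to\mathbb C^{N\times N}$ and $n\ge 0$, a function $Z$ with values in $\mathbb C^{2N\times 2N}$ solves the Riemann–Hilbert problem (RHP) if 1. $Z$ is analytic in $\mathbb C\setminus\mathbb T$; 2. $Z_+(\zeta)=Z_-(\zeta)\begin{pmatrix}I_N&w(\zeta)\bar\zeta^{\,n}\\0&I_N\end{pmatrix}$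 on $\mathbb T$; 3. $Z(z)=(I_{2N}+O(z^{-1}))\begin{pmatrix}z^nI_N&0\\0&z^{-n}I_N\end{pmatrix}$ as $|z|\to\infty$. In the weak RHP the entries of $w$ are in $L^1(m)$, $Z_\pm(\zeta)$ are the radial limits $\lim_{r\to1^\mp}Z(r\zeta)$, and it is required that these limits exist and 2 holds for $m$-almost every $\zeta$. In the strong RHP the entries of $w$ are Hölder continuous, with exponents in $(0,1]$, $Z_+(\zeta)$ and $Z_-(\zeta)$ are the (unrestricted) limits of $Z(z)$ as $z\to\zeta$ with $|z|<1$, respectively $|z|>1$, and it is required that these limits exist and 2 holds for every $\zeta\in\mathbb T$. **Theorem.** For quasi-definite $\mu$ the polynomials $P^L_{1,n},P^R_{1,n},P^R_{2,n}$ exist and are unique, and $H^R_n$ is invertible, for every $n\ge0$. Moreover, for every $n\ge 0$: (a) if $w=\frac{\mathrm d\mu}{\mathrm dm}$ is the Radon–Nikodym derivative of the absolutely continuous part of the quasi-definite matrix of measures $\mu$ (whose singular part is arbitrary), then $Y_n$ solves the weak RHP for $w$; (b) if $w$ is Hölder and $\mathrm d\mu=w\,\mathrm dm$ is quasi-definite,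 then $Y_n$ solves the strong RHP for $w$, it is the only solution on $\mathbb C\setminus\mathbb T$, and $\det Y_n(z)=1$ for all $z\in\mathbb C\setminus\mathbb T$. -/

import Mathlib

open MeasureTheory Filter Topology Asymptotics
open scoped NNReal ENNReal Polynomial Matrix ComplexConjugate

/-- The Borel σ-algebra of the unit circle `𝕋 ⊆ ℂ`. -/
noncomputable instance circleMeasurableSpace : MeasurableSpace Circle := borel Circle

instance circleBorelSpace : BorelSpace Circle := ⟨rfl⟩

namespace SzegoRHP

noncomputable section

/-- The normalized Lebesgue measure `dm = dζ / (2πiζ) = dθ / 2π` on the unit circle. -/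
def m : Measure Circle :=
  ENNReal.ofReal (2 * Real.pi)⁻¹ •
    Measure.map Circle.exp (volume.restrict (Set.Ioc (-Real.pi) Real.pi))

/-- `N × N` complex matrices. -/
abbrev Mat (N : ℕ) : Type := Matrix (Fin N) (Fin N) ℂ

/-- `2N × 2N` complex matrices, written in `N × N` blocks. -/
abbrev BlockMat (N : ℕ) : Type := Matrix (Fin N ⊕ Fin N) (Fin N ⊕ Fin N) ℂ

/-- `N × N` matrices of (finite) complex Borel measures on the unit circle. -/
abbrev MatMeasure (N : ℕ) : Type := Matrix (Fin N) (Fin N) (ComplexMeasure Circle)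

variable {N : ℕ}

/-- The integral `∮ F(ζ) dμ(ζ) G(ζ)`, i.e. the matrix with entries
`∑ k l, ∮ F i k (ζ) G l j (ζ) dμ k l (ζ)`. -/
def matIntegral (F : Circle → Mat N) (μ : MatMeasure N) (G : Circle → Mat N) : Mat N :=
  Matrix.of fun i j => ∑ k, ∑ l,
    (μ k l).integral (fun ζ => F ζ i k * G ζ l j) (ContinuousLinearMap.mul ℝ ℂ)

/-- The matrix of measures `w dm`. -/
def densityMeasure (w : Circle → Mat N) : MatMeasure N :=
  Matrix.of fun i j => m.withDensityᵥ fun ζ => w ζ i j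

/-- `w = dμ/dm` (`m`-almost everywhere): the absolutely continuous part of `μ` is `w dm`.
In particular the entries of `w` are integrable. -/
def IsDerivativeOf (w : Circle → Mat N) (μ : MatMeasure N) : Prop :=
  ∀ i j, (fun ζ => w ζ i j) =ᵐ[m] (μ i j).rnDeriv m

/-- The moments `∮ ζ̄ʲ dμ(ζ)`, for integer `j`. -/
def moment (μ : MatMeasure N) (j : ℤ) : Mat N :=
  matIntegral (fun ζ => (conj (ζ : ℂ)) ^ j • (1 : Mat N)) μ (fun _ => 1)

/-- The left truncated moment matrix, with `(i, j)` block the moment of index `i - j`. -/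
def momentMatrixL (μ : MatMeasure N) (n : ℕ) : Matrix (Fin n × Fin N) (Fin n × Fin N) ℂ :=
  Matrix.of fun p q => moment μ ((p.1 : ℤ) - (q.1 : ℤ)) p.2 q.2

/-- The right truncated moment matrix, with `(i, j)` block the moment of index `j - i`. -/
def momentMatrixR (μ : MatMeasure N) (n : ℕ) : Matrix (Fin n × Fin N) (Fin n × Fin N) ℂ :=
  Matrix.of fun p q => moment μ ((q.1 : ℤ) - (p.1 : ℤ)) p.2 q.2

/-- A matrix of measures is quasi-definite when all its truncated moment matrices are
nonsingular. -/
def QuasiDefinite (μ : MatMeasure N) : Prop :=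
  ∀ n : ℕ, 1 ≤ n → (momentMatrixL μ n).det ≠ 0 ∧ (momentMatrixR μ n).det ≠ 0

/-- The value `∑ k, P k zᵏ` of a matrix polynomial at a complex number `z`. -/
def evalAt (P : (Mat N)[X]) (z : ℂ) : Mat N := P.eval (Matrix.scalar (Fin N) z)

/-- `P = P₀ + ⋯ + Pₙ₋₁ zⁿ⁻¹ + I zⁿ`. -/
def IsMonicOfDegree (n : ℕ) (P : (Mat N)[X]) : Prop := P.natDegree ≤ n ∧ P.coeff n = 1

/-- `P` is a left monic Szegő polynomial of the first family, of degree `n`. -/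
def IsSzego1L (μ : MatMeasure N) (n : ℕ) (P : (Mat N)[X]) : Prop :=
  IsMonicOfDegree n P ∧ ∀ j < n,
    matIntegral (fun ζ => evalAt P ζ) μ (fun ζ => (conj (ζ : ℂ)) ^ j • (1 : Mat N)) = 0

/-- `P` is a right monic Szegő polynomial of the first family, of degree `n`. -/
def IsSzego1R (μ : MatMeasure N) (n : ℕ) (P : (Mat N)[X]) : Prop :=
  IsMonicOfDegree n P ∧ ∀ j < n,
    matIntegral (fun ζ => (conj (ζ : ℂ)) ^ j • (1 : Mat N)) μ (fun ζ => evalAt P ζ) = 0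

/-- `P` is a right monic Szegő polynomial of the second family, of degree `n`. -/
def IsSzego2R (μ : MatMeasure N) (n : ℕ) (P : (Mat N)[X]) : Prop :=
  IsMonicOfDegree n P ∧ ∀ j < n,
    matIntegral (fun ζ => (evalAt P ζ)ᴴ) μ (fun ζ => (ζ : ℂ) ^ j • (1 : Mat N)) = 0

/-- The Szegő polynomial `P^L_{1,n}` (unique when `μ` is quasi-definite). -/
def szego1L (μ : MatMeasure N) (n : ℕ) : (Mat N)[X] := Classical.epsilon (IsSzego1L μ n)

/-- The Szegő polynomial `P^R_{1,n}` (unique when `μ` is quasi-definite). -/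
def szego1R (μ : MatMeasure N) (n : ℕ) : (Mat N)[X] := Classical.epsilon (IsSzego1R μ n)

/-- The Szegő polynomial `P^R_{2,n}` (unique when `μ` is quasi-definite). -/
def szego2R (μ : MatMeasure N) (n : ℕ) : (Mat N)[X] := Classical.epsilon (IsSzego2R μ n)

/-- The reciprocal `zⁿ P(1/z̄)†` of a matrix polynomial `P` of degree at most `n`: its
coefficient of `zᵏ` is `(P_{n-k})†`. -/
def reciprocal (n : ℕ) (P : (Mat N)[X]) : (Mat N)[X] :=
  ∑ k ∈ Finset.range (n + 1), Polynomial.monomial k (P.coeff (n - k))ᴴ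

/-- The quasi-tau matrix `H^R_n = ∮ P^R_{2,n}(ζ)† dμ(ζ) P^R_{1,n}(ζ)`. -/
def quasiTauR (μ : MatMeasure N) (n : ℕ) : Mat N :=
  matIntegral (fun ζ => (evalAt (szego2R μ n) ζ)ᴴ) μ (fun ζ => evalAt (szego1R μ n) ζ)

/-- The Cauchy transform `Q^L_{1,n}(z) = ∮ ζ̄ⁿ P^L_{1,n}(ζ) dμ(ζ) / (1 - ζ̄ z)`. -/
def cauchy1L (μ : MatMeasure N) (n : ℕ) (z : ℂ) : Mat N :=
  matIntegral (fun ζ => ((conj (ζ : ℂ)) ^ n / (1 - conj (ζ : ℂ) * z)) • evalAt (szego1L μ n) ζ)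
    μ (fun _ => 1)

/-- The Cauchy transform `Q^R_{2,n}(z) = ∮ ζ̄ⁿ⁺¹ P̃^R_{2,n}(ζ) dμ(ζ) / (1 - ζ̄ z)`. -/
def cauchy2R (μ : MatMeasure N) (n : ℕ) (z : ℂ) : Mat N :=
  matIntegral (fun ζ => ((conj (ζ : ℂ)) ^ (n + 1) / (1 - conj (ζ : ℂ) * z)) •
    evalAt (reciprocal n (szego2R μ n)) ζ) μ (fun _ => 1)

/-- The block matrix function `Y_n`; only its values off the unit circle are meaningful. -/
def Y (μ : MatMeasure N) : ℕ → ℂ → BlockMat N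
  | 0, z => Matrix.fromBlocks 1 (cauchy1L μ 0 z) 0 1
  | n + 1, z => Matrix.fromBlocks
      (evalAt (szego1L μ (n + 1)) z)
      (cauchy1L μ (n + 1) z)
      (-((quasiTauR μ n)⁻¹ * evalAt (reciprocal n (szego2R μ n)) z))
      (-((quasiTauR μ n)⁻¹ * cauchy2R μ n z))

/-- The jump matrix `[[I, w(ζ) ζ̄ⁿ], [0, I]]`. -/
def jumpMatrix (w : Circle → Mat N) (n : ℕ) (ζ : Circle) : BlockMat N :=
  Matrix.fromBlocks 1 ((conj (ζ : ℂ)) ^ n • w ζ) 0 1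

/-- `Z` is (entrywise) analytic in `ℂ ∖ 𝕋`. -/
def AnalyticOffCircle (Z : ℂ → BlockMat N) : Prop :=
  ∀ i j, AnalyticOnNhd ℂ (fun z => Z z i j) {z : ℂ | ‖z‖ ≠ 1}

/-- `Z(z) = (I + O(1/z)) diag(zⁿ I, z⁻ⁿ I)` as `|z| → ∞`. -/
def HasAsymptotics (n : ℕ) (Z : ℂ → BlockMat N) : Prop :=
  ∃ E : ℂ → BlockMat N,
    (∀ i j, (fun z => E z i j) =O[Bornology.cobounded ℂ] fun z => z⁻¹) ∧
    ∀ᶠ z in Bornology.cobounded ℂ,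
      Z z = (1 + E z) * Matrix.fromBlocks (z ^ n • 1) 0 0 ((z ^ n)⁻¹ • 1)

/-- `Z` solves the weak Riemann–Hilbert problem: the jump holds at `m`-almost every `ζ`, for the
radial boundary values from inside and from outside (whose existence is part of the claim). -/
structure SolvesWeakRHP (w : Circle → Mat N) (n : ℕ) (Z : ℂ → BlockMat N) : Prop where
  analytic : AnalyticOffCircle Z
  jump : ∀ᵐ (ζ : Circle) ∂m, ∃ Zp Zm : BlockMat N,
    Tendsto (fun r : ℝ => Z (r * (ζ : ℂ))) (𝓝[<] 1) (𝓝 Zp) ∧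
    Tendsto (fun r : ℝ => Z (r * (ζ : ℂ))) (𝓝[>] 1) (𝓝 Zm) ∧
    Zp = Zm * jumpMatrix w n ζ
  asymptotics : HasAsymptotics n Z

/-- `Z` solves the strong Riemann–Hilbert problem: at every `ζ` the limits of `Z` at `ζ` from
inside and from outside exist (so that `Z` extends continuously to the circle from either side),
and satisfy the jump relation. -/
structure SolvesStrongRHP (w : Circle → Mat N) (n : ℕ) (Z : ℂ → BlockMat N) : Prop where
  analytic : AnalyticOffCircle Z
  jump : ∀ ζ : Circle, ∃ Zp Zm : BlockMat N,
    Tendsto Z (𝓝[{z : ℂ | ‖z‖ < 1}] (ζ : ℂ)) (𝓝 Zp) ∧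
    Tendsto Z (𝓝[{z : ℂ | 1 < ‖z‖}] (ζ : ℂ)) (𝓝 Zm) ∧
    Zp = Zm * jumpMatrix w n ζ
  asymptotics : HasAsymptotics n Z

/-- All the entries of `w` are Hölder functions on the unit circle. -/
def IsHolderWeight (w : Circle → Mat N) : Prop :=
  ∀ i j, ∃ C α : ℝ≥0, 0 < α ∧ α ≤ 1 ∧ HolderWith C α fun ζ => w ζ i j

end

end SzegoRHP

namespace SzegoRHP

noncomputable section

/-! ### Integration against a complex measure -/

section ComplexMeasure

variable {X : Type*} [MeasurableSpace X]

/-! Algebra. In terms of coefficients, each family of orthogonality relations is a block linear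
system for the `n` lower coefficients, whose matrix is, up to transposition, a truncated moment
matrix; quasi-definiteness gives existence and uniqueness (`existsUnique_block_mul`). A row vector
annihilating `H^R_n` would, multiplied into the coefficients of `P^R_{2,n}†`, annihilate the moment
matrix of size `n + 1`, so `H^R_n` is invertible (`isUnit_quasiTauR`). The same relations govern
infinity: multiplying a Cauchy transform by a power of `z` leaves an `O(1/z)` term minus a
polynomial whose coefficients are the orthogonality integrals (`pow_smul_cauchyPoly`). Hence `zⁿ
Q^L_{1,n} = O(1/z)` and `zⁿ⁺¹ Q^R_{2,n} = -H^R_n + O(1/z)`.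

Jump. For `n ≥ 1` the first block column of `Y_n` is polynomial and the second is made of Cauchy
integrals of the first against `μ`; for `n = 0` only one block jumps. All reduces to the scalar fact
that `∮ dc(ζ)/(1 - ζ̄z)` jumps by the density of `c`, and `jump_Y` performs this reduction for any
filters approaching a point of the circle.

In the weak case `c` is split into four positive measures. For a positive `p` with Cauchy integral
`F`, the Poisson integral of `p` is `2 Re F - p(𝕋)`, so `Re F ≥ 0` and `exp(-F)` is bounded.
Herglotz's representation and Fatou's theorem yield radial limits of `exp(-F)`; Fatou's theorem for
`p` shows that they do not vanish and identifies the limit of `Re F`, and a continuous logarithm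
gives the limit of `F`. Reflection in the circle supplies the exterior limit, and the jump is the
limit of the Poisson integral, to which the singular part contributes nothing almost everywhere
(`ae_jump_integral_cauchyKernel`).

In the Hölder case the value of the density at the radial projection of `z` is subtracted. The
remaining integral has the same limit from both sides by dominated convergence, while the subtracted
constant has Cauchy integral equal to itself inside and `0` outside (`hasJump_cauchyInt_holder`).

Uniqueness. The jump matrix has determinant one, so `det Z` extends continuously across the circle
and tends to `1`; it is constant by a Liouville argument (`eq_of_matchesOnCircle`). The same
argument applied to `Z · adj W` for two solutions gives `Z = W`. -/

/-- The sum of the total variations of the real and the imaginary part. -/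
def absMeasure (c : ComplexMeasure X) : Measure X :=
  (ComplexMeasure.re c).totalVariation + (ComplexMeasure.im c).totalVariation

instance isFiniteMeasure_totalVariation (s : SignedMeasure X) :
    IsFiniteMeasure s.totalVariation := by
  unfold SignedMeasure.totalVariation; infer_instance

instance isFiniteMeasure_absMeasure (c : ComplexMeasure X) : IsFiniteMeasure (absMeasure c) := by
  unfold absMeasure; infer_instance

theorem variation_le_absMeasure (c : ComplexMeasure X) : c.variation ≤ absMeasure c := by
  refine VectorMeasure.variation_le_of_forall_enorm_le fun E _ => ?_
  have h1 := (ComplexMeasure.re c).enorm_le_totalVariation E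
  have h2 := (ComplexMeasure.im c).enorm_le_totalVariation E
  have h : ‖c E‖ₑ ≤ ‖(c E).re‖ₑ + ‖(c E).im‖ₑ := by
    simp only [enorm_eq_nnnorm]
    exact_mod_cast Complex.norm_le_abs_re_add_abs_im (c E)
  exact h.trans (add_le_add h1 h2)

instance isFiniteMeasure_variation (c : ComplexMeasure X) : IsFiniteMeasure c.variation :=
  isFiniteMeasure_of_le _ (variation_le_absMeasure c)

/-- Domination of the variation makes the passage from `L¹(M)` to `L¹` of the variation continuous,
and the vector-measure integral is continuous there. -/
theorem continuous_integral_of_variation_le (c : ComplexMeasure X) (M : Measure X) (C : ℝ≥0∞)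
    (hC : C ≠ ∞) (h : c.variation ≤ C • M) :
    Continuous fun f : X →₁[M] ℂ => c.integral f (ContinuousLinearMap.mul ℝ ℂ) := by
  have := (VectorMeasure.continuous_integral (μ := c) (B := ContinuousLinearMap.mul ℝ ℂ)).comp
    (continuous_L1_toL1 (G := ℂ) C hC h)
  refine this.congr fun f => ?_
  exact VectorMeasure.integral_congr_ae (Integrable.coeFn_toL1 _)

theorem continuous_integral_of_le (p M : Measure X) (h : p ≤ M) :
    Continuous fun f : X →₁[M] ℂ => ∫ x, f x ∂p := by
  have := (continuous_integral (μ := p) (G := ℂ)).comp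
    (continuous_L1_toL1 (G := ℂ) 1 ENNReal.one_ne_top (by simpa using h : p ≤ (1 : ℝ≥0∞) • M))
  refine this.congr fun f => ?_
  exact integral_congr_ae (Integrable.coeFn_toL1 _)

theorem integral_indicator_const (c : ComplexMeasure X) {s : Set X} (hs : MeasurableSet s)
    (a : ℂ) : c.integral (s.indicator fun _ => a) (ContinuousLinearMap.mul ℝ ℂ) = a * c s := by
  rw [VectorMeasure.integral_eq_setToFun, setToFun_indicator_const _ hs (measure_ne_top _ _)]
  rfl

/-- Two functionals which agree on indicators, are additive and continuous in `L¹` agree. -/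
theorem integral_eq_of_indicator (c : ComplexMeasure X) (M : Measure X) [IsFiniteMeasure M]
    (C : ℝ≥0∞) (hC : C ≠ ∞) (h : c.variation ≤ C • M) (Λ : (X → ℂ) → ℂ)
    (hadd : ∀ f g : X → ℂ, Integrable f M → Integrable g M → Λ (f + g) = Λ f + Λ g)
    (hcongr : ∀ f g : X → ℂ, f =ᵐ[M] g → Λ f = Λ g)
    (hcont : Continuous fun f : X →₁[M] ℂ => Λ f)
    (hind : ∀ s, MeasurableSet s → ∀ a : ℂ, Λ (s.indicator fun _ => a) = a * c s)
    {f : X → ℂ} (hf : Integrable f M) :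
    c.integral f (ContinuousLinearMap.mul ℝ ℂ) = Λ f := by
  have hc : ∀ g : X → ℂ, Integrable g M → Integrable g c.variation := fun g hg =>
    hg.of_measure_le_smul hC h
  have hac : c.variation ≪ M := Measure.absolutelyContinuous_of_le_smul h
  refine Integrable.induction (μ := M)
    (P := fun f => c.integral f (ContinuousLinearMap.mul ℝ ℂ) = Λ f) ?_ ?_ ?_ ?_ hf
  · intro a s hs _
    rw [integral_indicator_const c hs, hind s hs]
  · intro f g _ hf hg h1 h2
    rw [hadd f g hf hg, ← h1, ← h2]
    exact VectorMeasure.integral_add (hc f hf) (hc g hg)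
  · exact isClosed_eq (continuous_integral_of_variation_le c M C hC h) hcont
  · intro f g hfg _ h1
    rw [← hcongr f g hfg, ← h1]
    exact VectorMeasure.integral_congr_ae (hac.ae_le hfg.symm)

/-- The integral in terms of the Jordan decompositions of the real and the imaginary part. -/
theorem integral_eq_jordan (c : ComplexMeasure X) {f : X → ℂ} (hf : Integrable f (absMeasure c)) :
    c.integral f (ContinuousLinearMap.mul ℝ ℂ) =
      (∫ x, f x ∂(ComplexMeasure.re c).toJordanDecomposition.posPart -
        ∫ x, f x ∂(ComplexMeasure.re c).toJordanDecomposition.negPart) +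
      Complex.I * (∫ x, f x ∂(ComplexMeasure.im c).toJordanDecomposition.posPart -
        ∫ x, f x ∂(ComplexMeasure.im c).toJordanDecomposition.negPart) := by
  have l1 : (ComplexMeasure.re c).toJordanDecomposition.posPart ≤ absMeasure c :=
    (Measure.le_add_right le_rfl).trans (Measure.le_add_right le_rfl)
  have l2 : (ComplexMeasure.re c).toJordanDecomposition.negPart ≤ absMeasure c :=
    (Measure.le_add_left le_rfl).trans (Measure.le_add_right le_rfl)
  have l3 : (ComplexMeasure.im c).toJordanDecomposition.posPart ≤ absMeasure c :=
    (Measure.le_add_right le_rfl).trans (Measure.le_add_left le_rfl)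
  have l4 : (ComplexMeasure.im c).toJordanDecomposition.negPart ≤ absMeasure c :=
    (Measure.le_add_left le_rfl).trans (Measure.le_add_left le_rfl)
  refine integral_eq_of_indicator c (absMeasure c) 1 ENNReal.one_ne_top
    (by simpa using variation_le_absMeasure c)
    (fun f => (∫ x, f x ∂(ComplexMeasure.re c).toJordanDecomposition.posPart -
        ∫ x, f x ∂(ComplexMeasure.re c).toJordanDecomposition.negPart) +
      Complex.I * (∫ x, f x ∂(ComplexMeasure.im c).toJordanDecomposition.posPart -
        ∫ x, f x ∂(ComplexMeasure.im c).toJordanDecomposition.negPart)) ?_ ?_ ?_ ?_ hf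
  · intro f g hf hg
    simp only [Pi.add_apply]
    rw [integral_add (hf.mono_measure l1) (hg.mono_measure l1),
      integral_add (hf.mono_measure l2) (hg.mono_measure l2),
      integral_add (hf.mono_measure l3) (hg.mono_measure l3),
      integral_add (hf.mono_measure l4) (hg.mono_measure l4)]
    ring
  · intro f g h
    rw [integral_congr_ae (ae_mono l1 h), integral_congr_ae (ae_mono l2 h),
      integral_congr_ae (ae_mono l3 h), integral_congr_ae (ae_mono l4 h)]
  · exact ((continuous_integral_of_le _ _ l1).sub (continuous_integral_of_le _ _ l2)).add
      (continuous_const.mul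
        ((continuous_integral_of_le _ _ l3).sub (continuous_integral_of_le _ _ l4)))
  · intro s hs a
    have hr := (ComplexMeasure.re c).apply_eq_posPart_real_sub_negPart_real hs
    have hi := (ComplexMeasure.im c).apply_eq_posPart_real_sub_negPart_real hs
    have hre : (ComplexMeasure.re c) s = (c s).re := rfl
    have him : (ComplexMeasure.im c) s = (c s).im := rfl
    simp only [MeasureTheory.integral_indicator_const _ hs]
    rw [hre] at hr
    rw [him] at hi
    conv_rhs => rw [← Complex.re_add_im (c s), hr, hi]
    simp only [Complex.real_smul, Complex.ofReal_sub]
    ring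

/-- Integration against the measure with a bounded density. -/
theorem integral_withDensity_of_bounded (p : Measure X) [IsFiniteMeasure p] {w : X → ℂ}
    (hw : Integrable w p) {C : ℝ≥0} (hC : ∀ x, ‖w x‖ ≤ C) {f : X → ℂ} (hf : Integrable f p) :
    (p.withDensityᵥ w).integral f (ContinuousLinearMap.mul ℝ ℂ) = ∫ x, f x * w x ∂p := by
  have hmul : ∀ f : X → ℂ, Integrable f p → Integrable (fun x => f x * w x) p := fun f hf =>
    hf.mul_bdd hw.aestronglyMeasurable (Eventually.of_forall hC)
  refine integral_eq_of_indicator (p.withDensityᵥ w) p C ENNReal.coe_ne_top ?_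
    (fun f => ∫ x, f x * w x ∂p) ?_ ?_ ?_ ?_ hf
  -- The variation of `w dp` is `|w| dp`; boundedness of `w` is what dominates it by a multiple of
  -- `p`.
  · rw [Measure.variation_withDensityᵥ hw, ← withDensity_const]
    refine withDensity_mono (Eventually.of_forall fun x => ?_)
    simp only [enorm_eq_nnnorm]
    exact_mod_cast hC x
  · intro f g hf hg
    simp only [Pi.add_apply, add_mul]
    exact integral_add (hmul f hf) (hmul g hg)
  · intro f g h
    exact integral_congr_ae (h.mono fun x hx => by simp only [hx])
  · refine LipschitzWith.continuous (K := C) (LipschitzWith.of_dist_le_mul fun f g => ?_)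
    rw [dist_eq_norm, ← integral_sub (hmul f (L1.integrable_coeFn f))
      (hmul g (L1.integrable_coeFn g)), dist_eq_norm, L1.norm_eq_integral_norm,
      ← integral_const_mul]
    refine (norm_integral_le_integral_norm _).trans ?_
    refine integral_mono_ae ?_ ((L1.integrable_coeFn (f - g)).norm.const_mul _) ?_
    · exact ((hmul f (L1.integrable_coeFn f)).sub (hmul g (L1.integrable_coeFn g))).norm
    · filter_upwards [Lp.coeFn_sub f g] with x hx
      rw [hx, Pi.sub_apply, ← sub_mul, norm_mul, mul_comm]
      exact mul_le_mul_of_nonneg_right (hC x) (norm_nonneg _)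
  · intro s hs a
    rw [withDensityᵥ_apply hw hs, ← integral_const_mul, ← integral_indicator hs]
    congr 1
    ext x
    by_cases hx : x ∈ s <;> simp [hx]

end ComplexMeasure

variable {N : ℕ}

/-! ### Scalar integrals against a matrix of measures -/

theorem integrable_of_continuous (p : Measure Circle) [IsFiniteMeasure p] {f : Circle → ℂ}
    (hf : Continuous f) : Integrable f p :=
  hf.integrable_of_hasCompactSupport (HasCompactSupport.of_compactSpace f)

/-- The pairing is only real bilinear, so homogeneity in complex scalars is read off from the
formula with four positive measures. -/
theorem integral_const_mul_of_continuous (c : ComplexMeasure Circle) (a : ℂ) {f : Circle → ℂ}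
    (hf : Continuous f) :
    c.integral (fun ζ => a * f ζ) (ContinuousLinearMap.mul ℝ ℂ) =
      a * c.integral f (ContinuousLinearMap.mul ℝ ℂ) := by
  rw [integral_eq_jordan c (integrable_of_continuous _ hf),
    integral_eq_jordan c (f := fun ζ => a * f ζ)
      (integrable_of_continuous _ (continuous_const.mul hf))]
  simp only [MeasureTheory.integral_const_mul]
  ring

theorem integral_sum_mul_of_continuous (c : ComplexMeasure Circle) {ι : Type*} (s : Finset ι)
    (a : ι → ℂ) (f : ι → Circle → ℂ) (hf : ∀ x ∈ s, Continuous (f x)) :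
    c.integral (fun ζ => ∑ x ∈ s, a x * f x ζ) (ContinuousLinearMap.mul ℝ ℂ) =
      ∑ x ∈ s, a x * c.integral (f x) (ContinuousLinearMap.mul ℝ ℂ) := by
  have := VectorMeasure.integral_finsetSum (μ := c) (B := ContinuousLinearMap.mul ℝ ℂ) s
    (f := fun x ζ => a x * f x ζ)
    (fun x hx => integrable_of_continuous _ (continuous_const.mul (hf x hx)))
  refine this.trans ?_
  exact Finset.sum_congr rfl fun x hx => integral_const_mul_of_continuous c _ (hf x hx)

/-- The matrix of the integrals of a scalar function. -/
def scalarIntegral (μ : MatMeasure N) (f : Circle → ℂ) : Mat N :=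
  Matrix.of fun i j => (μ i j).integral f (ContinuousLinearMap.mul ℝ ℂ)

/-- The common source of every formula for a matrix integral below: scalar functions are integrated,
and the matrix coefficients stay on their own side of the measure. -/
theorem matIntegral_sum_smul (μ : MatMeasure N) {ι κ : Type*} (s : Finset ι) (t : Finset κ)
    (f : ι → Circle → ℂ) (g : κ → Circle → ℂ) (A : ι → Mat N) (B : κ → Mat N)
    (hf : ∀ a ∈ s, Continuous (f a)) (hg : ∀ b ∈ t, Continuous (g b)) :
    matIntegral (fun ζ => ∑ a ∈ s, f a ζ • A a) μ (fun ζ => ∑ b ∈ t, g b ζ • B b) =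
      ∑ a ∈ s, ∑ b ∈ t, A a * scalarIntegral μ (fun ζ => f a ζ * g b ζ) * B b := by
  ext i j
  have key : ∀ k l, (μ k l).integral (fun ζ => (∑ a ∈ s, f a ζ • A a) i k *
      (∑ b ∈ t, g b ζ • B b) l j) (ContinuousLinearMap.mul ℝ ℂ) =
      ∑ a ∈ s, ∑ b ∈ t, A a i k * scalarIntegral μ (fun ζ => f a ζ * g b ζ) k l * B b l j := by
    intro k l
    have h1 : (fun ζ : Circle => (∑ a ∈ s, f a ζ • A a) i k * (∑ b ∈ t, g b ζ • B b) l j) =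
        fun ζ => ∑ x ∈ s ×ˢ t, (A x.1 i k * B x.2 l j) * (f x.1 ζ * g x.2 ζ) := by
      ext ζ
      rw [Matrix.sum_apply, Matrix.sum_apply, Finset.sum_mul_sum, Finset.sum_product]
      refine Finset.sum_congr rfl fun a _ => Finset.sum_congr rfl fun b _ => ?_
      simp only [Matrix.smul_apply, smul_eq_mul]
      ring
    rw [h1, integral_sum_mul_of_continuous (μ k l) (s ×ˢ t) (fun x => A x.1 i k * B x.2 l j)
      (fun x ζ => f x.1 ζ * g x.2 ζ) (fun x hx => (hf _ (Finset.mem_product.1 hx).1).mul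
        (hg _ (Finset.mem_product.1 hx).2)), Finset.sum_product]
    refine Finset.sum_congr rfl fun a _ => Finset.sum_congr rfl fun b _ => ?_
    simp only [scalarIntegral, Matrix.of_apply]
    ring
  have h2 : matIntegral (fun ζ => ∑ a ∈ s, f a ζ • A a) μ (fun ζ => ∑ b ∈ t, g b ζ • B b) i j =
      ∑ k, ∑ l, ∑ a ∈ s, ∑ b ∈ t,
        A a i k * scalarIntegral μ (fun ζ => f a ζ * g b ζ) k l * B b l j := by
    rw [matIntegral, Matrix.of_apply]
    exact Finset.sum_congr rfl fun k _ => Finset.sum_congr rfl fun l _ => key k l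
  rw [h2, Finset.sum_comm]
  simp only [Matrix.sum_apply, Matrix.mul_apply, Finset.sum_mul]
  calc _ = ∑ l, ∑ a ∈ s, ∑ k, ∑ b ∈ t,
        A a i k * scalarIntegral μ (fun ζ => f a ζ * g b ζ) k l * B b l j :=
        Finset.sum_congr rfl fun l _ => Finset.sum_comm
    _ = ∑ a ∈ s, ∑ l, ∑ k, ∑ b ∈ t,
        A a i k * scalarIntegral μ (fun ζ => f a ζ * g b ζ) k l * B b l j := Finset.sum_comm
    _ = ∑ a ∈ s, ∑ l, ∑ b ∈ t, ∑ k,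
        A a i k * scalarIntegral μ (fun ζ => f a ζ * g b ζ) k l * B b l j :=
        Finset.sum_congr rfl fun a _ => Finset.sum_congr rfl fun l _ => Finset.sum_comm
    _ = _ := Finset.sum_congr rfl fun a _ => Finset.sum_comm

/-- The monomial `ζʲ` on the circle, for integer `j`. -/
def circleMonomial (j : ℤ) (ζ : Circle) : ℂ := ((ζ ^ j : Circle) : ℂ)

theorem continuous_circleMonomial (j : ℤ) : Continuous (circleMonomial j) :=
  continuous_subtype_val.comp (continuous_zpow j)

theorem circleMonomial_mul (i j : ℤ) (ζ : Circle) :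
    circleMonomial i ζ * circleMonomial j ζ = circleMonomial (i + j) ζ := by
  simp [circleMonomial, zpow_add]

theorem circleMonomial_natCast (n : ℕ) (ζ : Circle) : circleMonomial n ζ = (ζ : ℂ) ^ n := by
  simp [circleMonomial]

theorem circleMonomial_neg (j : ℤ) (ζ : Circle) :
    circleMonomial (-j) ζ = (conj (ζ : ℂ)) ^ j := by
  simp only [circleMonomial, ← Circle.coe_inv_eq_conj, zpow_neg, ← inv_zpow, Circle.coe_zpow]

theorem circleMonomial_neg_natCast (j : ℕ) (ζ : Circle) :
    circleMonomial (-(j : ℤ)) ζ = (conj (ζ : ℂ)) ^ j := by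
  rw [circleMonomial_neg, zpow_natCast]

theorem circleMonomial_zero (ζ : Circle) : circleMonomial 0 ζ = 1 := by simp [circleMonomial]

theorem norm_circleMonomial (j : ℤ) (ζ : Circle) : ‖circleMonomial j ζ‖ = 1 :=
  Circle.norm_coe _

theorem conj_circleMonomial (j : ℤ) (ζ : Circle) :
    conj (circleMonomial j ζ) = circleMonomial (-j) ζ := by
  rw [circleMonomial, ← Circle.coe_inv_eq_conj, circleMonomial, zpow_neg]

theorem moment_eq (μ : MatMeasure N) (j : ℤ) :
    moment μ j = scalarIntegral μ (circleMonomial (-j)) := by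
  have := matIntegral_sum_smul μ {()} {()} (fun _ => circleMonomial (-j)) (fun _ _ => 1)
    (fun _ => 1) (fun _ => 1) (fun _ _ => continuous_circleMonomial _)
    (fun _ _ => continuous_const)
  simp only [Finset.sum_singleton, one_smul, mul_one, one_mul] at this
  rw [← this]
  simp only [moment, circleMonomial_neg]

theorem evalAt_eq_sum {n : ℕ} {P : (Mat N)[X]} (hP : P.natDegree ≤ n) (z : ℂ) :
    evalAt P z = ∑ k ∈ Finset.range (n + 1), z ^ k • P.coeff k := by
  rw [evalAt, Polynomial.eval_eq_sum_range' (Nat.lt_succ_of_le hP)]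
  refine Finset.sum_congr rfl fun k _ => ?_
  rw [← map_pow, ← (Matrix.scalar_commute (z ^ k) (fun r' => mul_comm _ _) (P.coeff k)).eq,
    Matrix.scalar_apply, ← Matrix.smul_eq_diagonal_mul]

theorem evalAt_circle {n : ℕ} {P : (Mat N)[X]} (hP : P.natDegree ≤ n) (ζ : Circle) :
    evalAt P ζ = ∑ k ∈ Finset.range (n + 1), circleMonomial k ζ • P.coeff k := by
  simp only [evalAt_eq_sum hP, circleMonomial_natCast]

theorem evalAt_circle_conjTranspose {n : ℕ} {P : (Mat N)[X]} (hP : P.natDegree ≤ n) (ζ : Circle) :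
    (evalAt P ζ)ᴴ = ∑ k ∈ Finset.range (n + 1), circleMonomial (-(k : ℤ)) ζ • (P.coeff k)ᴴ := by
  rw [evalAt_circle hP, Matrix.conjTranspose_sum]
  refine Finset.sum_congr rfl fun k _ => ?_
  rw [Matrix.conjTranspose_smul, ← conj_circleMonomial]
  rfl

/-! ### The Szegő conditions in terms of moments -/

/-- Orthogonality against monomials is a linear system for the coefficients, with moments as data;
the next two lemmas do the same for the other families. -/
theorem isSzego1L_iff (μ : MatMeasure N) (n : ℕ) (P : (Mat N)[X]) :
    IsSzego1L μ n P ↔ IsMonicOfDegree n P ∧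
      ∀ j < n, ∑ k ∈ Finset.range (n + 1), P.coeff k * moment μ ((j : ℤ) - k) = 0 := by
  refine and_congr_right fun hP => forall_congr' fun j => imp_congr_right fun _ => ?_
  have := matIntegral_sum_smul μ (Finset.range (n + 1)) {()} (fun k : ℕ => circleMonomial k)
    (fun _ => circleMonomial (-(j : ℤ))) P.coeff (fun _ => 1)
    (fun _ _ => continuous_circleMonomial _) (fun _ _ => continuous_circleMonomial _)
  simp only [Finset.sum_singleton, mul_one, circleMonomial_mul] at this
  simp only [← evalAt_circle hP.1, circleMonomial_neg_natCast] at this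
  rw [this]
  simp only [moment_eq, neg_sub, ← sub_eq_add_neg]

theorem isSzego1R_iff (μ : MatMeasure N) (n : ℕ) (P : (Mat N)[X]) :
    IsSzego1R μ n P ↔ IsMonicOfDegree n P ∧
      ∀ j < n, ∑ k ∈ Finset.range (n + 1), moment μ ((j : ℤ) - k) * P.coeff k = 0 := by
  refine and_congr_right fun hP => forall_congr' fun j => imp_congr_right fun _ => ?_
  have := matIntegral_sum_smul μ {()} (Finset.range (n + 1)) (fun _ => circleMonomial (-(j : ℤ)))
    (fun k : ℕ => circleMonomial k) (fun _ => 1) P.coeff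
    (fun _ _ => continuous_circleMonomial _) (fun _ _ => continuous_circleMonomial _)
  simp only [Finset.sum_singleton, one_mul, circleMonomial_mul, neg_add_eq_sub] at this
  simp only [← evalAt_circle hP.1, circleMonomial_neg_natCast] at this
  rw [this]
  simp only [moment_eq, neg_sub]

theorem isSzego2R_iff (μ : MatMeasure N) (n : ℕ) (P : (Mat N)[X]) :
    IsSzego2R μ n P ↔ IsMonicOfDegree n P ∧
      ∀ j < n, ∑ k ∈ Finset.range (n + 1), (P.coeff k)ᴴ * moment μ ((k : ℤ) - j) = 0 := by
  refine and_congr_right fun hP => forall_congr' fun j => imp_congr_right fun _ => ?_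
  have := matIntegral_sum_smul μ (Finset.range (n + 1)) {()}
    (fun k : ℕ => circleMonomial (-(k : ℤ)))
    (fun _ => circleMonomial (j : ℤ)) (fun k => (P.coeff k)ᴴ) (fun _ => 1)
    (fun _ _ => continuous_circleMonomial _) (fun _ _ => continuous_circleMonomial _)
  simp only [Finset.sum_singleton, mul_one, circleMonomial_mul, neg_add_eq_sub] at this
  simp only [← evalAt_circle_conjTranspose hP.1, circleMonomial_natCast] at this
  rw [this]
  simp only [moment_eq, neg_sub]

/-! ### Existence and uniqueness -/

/-- A block linear system with nonsingular matrix has exactly one solution. -/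
theorem existsUnique_block_mul {n : ℕ} (B : Fin n → Fin n → Mat N)
    (hB : (Matrix.of fun p q : Fin n × Fin N => B p.1 q.1 p.2 q.2).det ≠ 0)
    (R : Fin n → Mat N) : ∃! A : Fin n → Mat N, ∀ j, ∑ k, A k * B k j = R j := by
  set T : Matrix (Fin n × Fin N) (Fin n × Fin N) ℂ :=
    Matrix.of fun p q => B p.1 q.1 p.2 q.2 with hT
  have hu : IsUnit T.det := isUnit_iff_ne_zero.2 hB
  -- The unknown blocks are laid side by side in one wide matrix, so that the system becomes right
  -- multiplication by the square matrix `T`.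
  let flat : (Fin n → Mat N) → Matrix (Fin N) (Fin n × Fin N) ℂ :=
    fun A => Matrix.of fun i p => A p.1 i p.2
  let unflat : Matrix (Fin N) (Fin n × Fin N) ℂ → (Fin n → Mat N) :=
    fun M k => Matrix.of fun i j => M i (k, j)
  have hiff : ∀ A : Fin n → Mat N, (∀ j, ∑ k, A k * B k j = R j) ↔ flat A * T = flat R := by
    intro A
    have hent : ∀ i j b, (flat A * T) i (j, b) = (∑ k, A k * B k j) i b := by
      intro i j b
      simp only [Matrix.mul_apply, Fintype.sum_prod_type, Matrix.sum_apply]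
      rfl
    constructor
    · intro h
      ext i ⟨j, b⟩
      rw [hent, h j]
      rfl
    · intro h j
      ext i b
      rw [← hent, h]
      rfl
  refine ⟨unflat (flat R * T⁻¹), ?_, ?_⟩
  · refine (hiff _).2 ?_
    change (flat R * T⁻¹) * T = flat R
    rw [Matrix.mul_assoc, Matrix.nonsing_inv_mul T hu, Matrix.mul_one]
  · intro A hA
    have h := (hiff A).1 hA
    have : flat A = flat R * T⁻¹ := by
      rw [← h, Matrix.mul_assoc, Matrix.mul_nonsing_inv T hu, Matrix.mul_one]
    rw [← this]
    rfl

/-- A monic polynomial of degree `n` is the same thing as its `n` lower coefficients, so a condition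
on it may be solved in `Fin n → Mat N`. -/
theorem existsUnique_monic {n : ℕ} (Φ : (ℕ → Mat N) → Prop)
    (h : ∃! A : Fin n → Mat N,
      Φ fun k => if hk : k < n then A ⟨k, hk⟩ else if k = n then 1 else 0) :
    ∃! P : (Mat N)[X], IsMonicOfDegree n P ∧ Φ P.coeff := by
  have hco : ∀ P : (Mat N)[X], IsMonicOfDegree n P → P.coeff = fun k =>
      if hk : k < n then (fun i : Fin n => P.coeff i) ⟨k, hk⟩ else if k = n then 1 else 0 := by
    intro P hP
    ext1 k
    split_ifs with h1 h2
    · rfl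
    · rw [h2, hP.2]
    · exact Polynomial.coeff_eq_zero_of_natDegree_lt (hP.1.trans_lt (by omega))
  obtain ⟨A, hA, huniq⟩ := h
  let P : (Mat N)[X] := ∑ k ∈ Finset.range (n + 1), Polynomial.monomial k
    (if hk : k < n then A ⟨k, hk⟩ else if k = n then 1 else 0)
  have hcoeff : P.coeff = fun k => if hk : k < n then A ⟨k, hk⟩ else if k = n then 1 else 0 := by
    ext1 k
    simp only [P, Polynomial.finsetSum_coeff, Polynomial.coeff_monomial, Finset.sum_ite_eq',
      Finset.mem_range]
    split_ifs <;> first | rfl | omega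
  refine ⟨P, ⟨⟨?_, ?_⟩, ?_⟩, ?_⟩
  · refine Polynomial.natDegree_le_iff_coeff_eq_zero.2 fun k hk => ?_
    rw [hcoeff]
    simp only
    rw [dif_neg (by omega), if_neg (by omega)]
  · rw [hcoeff]; simp
  · rw [hcoeff]; exact hA
  · rintro Q ⟨hQ, hΦ⟩
    have := huniq (fun i : Fin n => Q.coeff i) (by beta_reduce; rw [hco Q hQ] at hΦ; exact hΦ)
    refine Polynomial.ext fun k => ?_
    rw [hco Q hQ, hcoeff, this]

theorem det_momentMatrix_ne_zero {μ : MatMeasure N} (h : QuasiDefinite μ) (n : ℕ) :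
    (momentMatrixL μ n).det ≠ 0 ∧ (momentMatrixR μ n).det ≠ 0 := by
  rcases Nat.eq_zero_or_pos n with rfl | hn
  · simp
  · exact h n hn

theorem sum_extend {n : ℕ} (A : Fin n → Mat N) (F : ℕ → Mat N → Mat N)  :
    ∑ k ∈ Finset.range (n + 1),
      F k (if hk : k < n then A ⟨k, hk⟩ else if k = n then 1 else 0) =
      ∑ k : Fin n, F k (A k) + F n 1 := by
  rw [Finset.sum_range_succ, ← Fin.sum_univ_eq_sum_range
    (fun k => F k (if hk : k < n then A ⟨k, hk⟩ else if k = n then 1 else 0))]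
  simp

/-- The unknowns stand to the left of moments of index `j - k`: the matrix of the system is
`momentMatrixR`, and the leading term moves to the right-hand side. -/
theorem existsUnique_szego1L {μ : MatMeasure N} (h : QuasiDefinite μ) (n : ℕ) :
    ∃! P, IsSzego1L μ n P := by
  simp only [isSzego1L_iff]
  refine existsUnique_monic (fun c => ∀ j < n, ∑ k ∈ Finset.range (n + 1),
    c k * moment μ ((j : ℤ) - k) = 0) ?_
  have := existsUnique_block_mul (fun k j : Fin n => moment μ ((j : ℤ) - k))
    (det_momentMatrix_ne_zero h n).2 (fun j => - moment μ ((j : ℤ) - n))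
  refine (existsUnique_congr fun A => ?_).1 this
  rw [Fin.forall_iff]
  refine forall_congr' fun j => forall_congr' fun hj => ?_
  rw [sum_extend A (fun k a => a * moment μ ((j : ℤ) - k)), one_mul, eq_neg_iff_add_eq_zero]

/-- Here the unknowns stand on the right; transposing the equations brings them to the left, and the
system matrix becomes the transpose of `momentMatrixL`. -/
theorem existsUnique_szego1R {μ : MatMeasure N} (h : QuasiDefinite μ) (n : ℕ) :
    ∃! P, IsSzego1R μ n P := by
  simp only [isSzego1R_iff]
  refine existsUnique_monic (fun c => ∀ j < n, ∑ k ∈ Finset.range (n + 1),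
    moment μ ((j : ℤ) - k) * c k = 0) ?_
  have hd : (Matrix.of fun p q : Fin n × Fin N =>
      (moment μ ((q.1 : ℤ) - p.1))ᵀ p.2 q.2).det ≠ 0 := by
    rw [← Matrix.det_transpose]
    exact (det_momentMatrix_ne_zero h n).1
  obtain ⟨A, hA, hu⟩ := existsUnique_block_mul (fun k j : Fin n => (moment μ ((j : ℤ) - k))ᵀ)
    hd (fun j => (- moment μ ((j : ℤ) - n))ᵀ)
  have hiff : ∀ A : Fin n → Mat N, (∀ j : ℕ, j < n → ∑ k ∈ Finset.range (n + 1),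
      moment μ ((j : ℤ) - k) * (if hk : k < n then A ⟨k, hk⟩ else if k = n then 1 else 0) = 0) ↔
      ∀ j : Fin n, ∑ k, (A k)ᵀ * (moment μ ((j : ℤ) - k))ᵀ = (- moment μ ((j : ℤ) - n))ᵀ := by
    intro A
    rw [Fin.forall_iff]
    refine forall_congr' fun j => forall_congr' fun hj => ?_
    rw [sum_extend A (fun k a => moment μ ((j : ℤ) - k) * a), mul_one, ← eq_neg_iff_add_eq_zero,
      ← Matrix.transpose_inj, Matrix.transpose_sum]
    simp only [Matrix.transpose_mul]
  refine (existsUnique_congr hiff).2 ⟨fun k => (A k)ᵀ, by simpa using hA, fun A' hA' => ?_⟩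
  have := hu (fun k => (A' k)ᵀ) hA'
  ext1 k
  rw [← this, Matrix.transpose_transpose]

/-- The system is linear in the conjugate transposes of the coefficients, which are taken as the
unknowns. -/
theorem existsUnique_szego2R {μ : MatMeasure N} (h : QuasiDefinite μ) (n : ℕ) :
    ∃! P, IsSzego2R μ n P := by
  simp only [isSzego2R_iff]
  refine existsUnique_monic (fun c => ∀ j < n, ∑ k ∈ Finset.range (n + 1),
    (c k)ᴴ * moment μ ((k : ℤ) - j) = 0) ?_
  obtain ⟨A, hA, hu⟩ := existsUnique_block_mul (fun k j : Fin n => moment μ ((k : ℤ) - j))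
    (det_momentMatrix_ne_zero h n).1 (fun j => - moment μ ((n : ℤ) - j))
  have hiff : ∀ A : Fin n → Mat N, (∀ j : ℕ, j < n → ∑ k ∈ Finset.range (n + 1),
      (if hk : k < n then A ⟨k, hk⟩ else if k = n then 1 else 0)ᴴ * moment μ ((k : ℤ) - j) = 0) ↔
      ∀ j : Fin n, ∑ k, (A k)ᴴ * moment μ ((k : ℤ) - j) = - moment μ ((n : ℤ) - j) := by
    intro A
    rw [Fin.forall_iff]
    refine forall_congr' fun j => forall_congr' fun hj => ?_
    rw [sum_extend A (fun k a => aᴴ * moment μ ((k : ℤ) - j)), Matrix.conjTranspose_one, one_mul,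
      ← eq_neg_iff_add_eq_zero]
  refine (existsUnique_congr hiff).2 ⟨fun k => (A k)ᴴ, by simpa using hA, fun A' hA' => ?_⟩
  have := hu (fun k => (A' k)ᴴ) hA'
  ext1 k
  rw [← this, Matrix.conjTranspose_conjTranspose]

theorem isSzego1L_szego1L {μ : MatMeasure N} (h : QuasiDefinite μ) (n : ℕ) :
    IsSzego1L μ n (szego1L μ n) := Classical.epsilon_spec (existsUnique_szego1L h n).exists

theorem isSzego1R_szego1R {μ : MatMeasure N} (h : QuasiDefinite μ) (n : ℕ) :
    IsSzego1R μ n (szego1R μ n) := Classical.epsilon_spec (existsUnique_szego1R h n).exists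

theorem isSzego2R_szego2R {μ : MatMeasure N} (h : QuasiDefinite μ) (n : ℕ) :
    IsSzego2R μ n (szego2R μ n) := Classical.epsilon_spec (existsUnique_szego2R h n).exists

/-- Since `P^R_{2,n}` is orthogonal to the powers below `n`, only the leading term of `P^R_{1,n}`
contributes. -/
theorem quasiTauR_eq {μ : MatMeasure N} (h : QuasiDefinite μ) (n : ℕ) :
    quasiTauR μ n = ∑ k ∈ Finset.range (n + 1),
      ((szego2R μ n).coeff k)ᴴ * moment μ ((k : ℤ) - n) := by
  obtain ⟨h2, o2⟩ := (isSzego2R_iff μ n _).1 (isSzego2R_szego2R h n)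
  obtain ⟨h1, -⟩ := isSzego1R_szego1R h n
  have := matIntegral_sum_smul μ (Finset.range (n + 1)) (Finset.range (n + 1))
    (fun k : ℕ => circleMonomial (-(k : ℤ)))
    (fun k : ℕ => circleMonomial k) (fun k => ((szego2R μ n).coeff k)ᴴ) (szego1R μ n).coeff
    (fun _ _ => continuous_circleMonomial _) (fun _ _ => continuous_circleMonomial _)
  simp only [← evalAt_circle_conjTranspose h2.1, ← evalAt_circle h1.1, circleMonomial_mul,
    neg_add_eq_sub] at this
  rw [quasiTauR, this, Finset.sum_comm, Finset.sum_range_succ, Finset.sum_eq_zero, zero_add, h1.2]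
  · simp only [moment_eq, neg_sub, mul_one]
  · intro l hl
    rw [← Finset.sum_mul]
    have := o2 l (Finset.mem_range.1 hl)
    simp only [moment_eq, neg_sub] at this
    rw [show (∑ i ∈ Finset.range (n + 1), ((szego2R μ n).coeff i)ᴴ *
      scalarIntegral μ fun ζ => circleMonomial ((l : ℤ) - i) ζ) = 0 from this, zero_mul]

/-- If `v H = 0`, the block row vector with entries `v (P_k)†`, where `P_k` are the coefficients of
`P^R_{2,n}`, annihilates `momentMatrixL μ (n + 1)`: the first `n` block columns vanish by
orthogonality, the last because it gives `v H`. Its last block is `v`, so it is nonzero. -/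
theorem isUnit_quasiTauR {μ : MatMeasure N} (h : QuasiDefinite μ) (n : ℕ) :
    IsUnit (quasiTauR μ n) := by
  rw [Matrix.isUnit_iff_isUnit_det, isUnit_iff_ne_zero]
  intro hdet
  obtain ⟨v, hv, hvH⟩ := Matrix.exists_vecMul_eq_zero_iff.2 hdet
  obtain ⟨h2, o2⟩ := (isSzego2R_iff μ n _).1 (isSzego2R_szego2R h n)
  refine (h (n + 1) (by omega)).1 (Matrix.exists_vecMul_eq_zero_iff.1
    ⟨fun p => (v ᵥ* ((szego2R μ n).coeff p.1)ᴴ) p.2, ?_, ?_⟩)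
  · intro h0
    refine hv (funext fun a => ?_)
    have := congrFun h0 (Fin.last n, a)
    simpa [h2.2] using this
  · ext ⟨j, b⟩
    have key : ∀ j ≤ n, v ᵥ* (∑ k ∈ Finset.range (n + 1),
        ((szego2R μ n).coeff k)ᴴ * moment μ ((k : ℤ) - j)) = 0 := by
      intro j hj
      rcases hj.lt_or_eq with hj | rfl
      · rw [o2 j hj, Matrix.vecMul_zero]
      · rw [← quasiTauR_eq h, hvH]
    have := congrFun (key j (Nat.lt_succ_iff.1 j.2)) b
    rw [Pi.zero_apply] at this
    rw [Pi.zero_apply, ← this, ← Fin.sum_univ_eq_sum_range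
      (fun k => ((szego2R μ n).coeff k)ᴴ * moment μ ((k : ℤ) - j)), Matrix.vecMul_sum]
    simp only [Finset.sum_apply, ← Matrix.vecMul_vecMul]
    simp only [Matrix.vecMul, dotProduct, Fintype.sum_prod_type]
    rfl

/-! ### The normalized Lebesgue measure on the circle -/

theorem circle_dist_eq (ζ η : Circle) : dist ζ η = ‖(ζ : ℂ) - η‖ := dist_eq_norm (ζ : ℂ) η

instance fact_two_pi_pos : Fact (0 < 2 * Real.pi) := ⟨Real.two_pi_pos⟩

/-- Translation invariance on `AddCircle` thereby becomes rotation invariance of `m`. -/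
theorem m_eq_map_toCircle :
    m = ENNReal.ofReal (2 * Real.pi)⁻¹ •
      Measure.map (AddCircle.toCircle (T := 2 * Real.pi)) volume := by
  rw [m, ← (AddCircle.measurePreserving_mk (2 * Real.pi) (-Real.pi)).map_eq,
    Measure.map_map AddCircle.continuous_toCircle.measurable AddCircle.measurable_mk']
  congr 2
  · ext1 t
    simp [AddCircle.toCircle_apply_mk]
  · congr 2
    ring

theorem map_mul_left_m (a : Circle) : Measure.map (fun ζ => a * ζ) m = m := by
  have hmeas : Measurable fun ζ : Circle => a * ζ := (continuous_const_mul a).measurable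
  obtain ⟨t, rfl⟩ : ∃ t : AddCircle (2 * Real.pi), AddCircle.toCircle t = a :=
    ⟨(((a : ℂ).arg : ℝ) : AddCircle (2 * Real.pi)), by
      simp [AddCircle.toCircle_apply_mk, Circle.exp_arg]⟩
  rw [m_eq_map_toCircle, Measure.map_smul, Measure.map_map hmeas
    AddCircle.continuous_toCircle.measurable]
  congr 1
  have h : (fun ζ => AddCircle.toCircle t * ζ) ∘ (AddCircle.toCircle (T := 2 * Real.pi)) =
      AddCircle.toCircle ∘ fun s => t + s := by
    ext1 s
    simp [AddCircle.toCircle_add]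
  rw [h, ← Measure.map_map AddCircle.continuous_toCircle.measurable
    (continuous_const_add t).measurable, map_add_left_eq_self]

theorem measurePreserving_mul_left (a : Circle) : MeasurePreserving (fun ζ => a * ζ) m m :=
  ⟨(continuous_const_mul a).measurable, map_mul_left_m a⟩

theorem m_apply {s : Set Circle} (hs : MeasurableSet s) :
    m s = ENNReal.ofReal (2 * Real.pi)⁻¹ *
      volume (Circle.exp ⁻¹' s ∩ Set.Ioc (-Real.pi) Real.pi) := by
  rw [m, Measure.smul_apply, Measure.map_apply Circle.exp.continuous.measurable hs,
    Measure.restrict_apply (Circle.exp.continuous.measurable hs), smul_eq_mul]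

instance isProbabilityMeasure_m : IsProbabilityMeasure m := by
  refine ⟨?_⟩
  rw [m_apply MeasurableSet.univ, Set.preimage_univ, Set.univ_inter, Real.volume_Ioc,
    ← ENNReal.ofReal_mul (by positivity), sub_neg_eq_add, ← two_mul,
    inv_mul_cancel₀ Real.two_pi_pos.ne', ENNReal.ofReal_one]

theorem integral_m {E : Type*} [NormedAddCommGroup E] [NormedSpace ℝ E] (f : Circle → E)
    (hf : AEStronglyMeasurable f m) :
    ∫ ζ, f ζ ∂m = (2 * Real.pi)⁻¹ • ∫ t in (-Real.pi)..Real.pi, f (Circle.exp t) := by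
  have hf' : AEStronglyMeasurable f
      (Measure.map Circle.exp (volume.restrict (Set.Ioc (-Real.pi) Real.pi))) := by
    refine hf.mono_ac ?_
    rw [m]
    exact Measure.absolutelyContinuous_smul (by simp [Real.pi_pos])
  rw [m, integral_smul_measure, integral_map Circle.exp.continuous.measurable.aemeasurable hf',
    intervalIntegral.integral_of_le (by linarith [Real.pi_pos]),
    ENNReal.toReal_ofReal (by positivity)]

theorem integral_m_eq_circleAverage {E : Type*} [NormedAddCommGroup E] [NormedSpace ℝ E]
    (f : ℂ → E) (hf : AEStronglyMeasurable (fun ζ : Circle => f ζ) m) :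
    ∫ ζ : Circle, f ζ ∂m = Real.circleAverage f 0 1 := by
  rw [integral_m _ hf, Real.circleAverage_def]
  congr 1
  have hper : Function.Periodic (fun t => f (circleMap 0 1 t)) (2 * Real.pi) := fun t => by
    simp only [(periodic_circleMap 0 1) t]
  have := hper.intervalIntegral_add_eq (-Real.pi) 0
  rw [zero_add, show -Real.pi + 2 * Real.pi = Real.pi by ring] at this
  rw [← this]
  simp [circleMap, Circle.coe_exp]

theorem dist_exp_one_le (t : ℝ) : dist (Circle.exp t) 1 ≤ |t| := by
  rw [circle_dist_eq, Circle.coe_exp, Circle.coe_one, mul_comm]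
  exact Real.norm_exp_I_mul_ofReal_sub_one_le

/-- The chord has length `2 |sin (t / 2)|`, and Jordan's inequality bounds the sine from below. -/
theorem le_dist_exp_one {t : ℝ} (ht : |t| ≤ Real.pi) :
    2 / Real.pi * |t| ≤ dist (Circle.exp t) 1 := by
  rw [circle_dist_eq, Circle.coe_exp, Circle.coe_one, mul_comm (t : ℂ),
    Complex.norm_exp_I_mul_ofReal_sub_one]
  have h := Real.mul_le_sin (x := |t| / 2) (by positivity) (by linarith)
  have h2 : |Real.sin (t / 2)| = |Real.sin (|t| / 2)| := by
    rcases abs_cases t with ⟨h, _⟩ | ⟨h, _⟩ <;> rw [h]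
    rw [neg_div, Real.sin_neg, abs_neg]
  rw [Real.norm_eq_abs, abs_mul, abs_two, h2]
  calc 2 / Real.pi * |t| = 2 * (2 / Real.pi * (|t| / 2)) := by ring
    _ ≤ _ := mul_le_mul_of_nonneg_left (h.trans (le_abs_self _)) zero_le_two

theorem m_closedBall_eq (ζ : Circle) (h : ℝ) :
    m (Metric.closedBall ζ h) = m (Metric.closedBall 1 h) := by
  rw [← (measurePreserving_mul_left ζ).measure_preimage
    Metric.isClosed_closedBall.measurableSet.nullMeasurableSet]
  congr 1
  ext η
  simp only [Set.mem_preimage, Metric.mem_closedBall, circle_dist_eq,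
    Circle.coe_mul, Circle.coe_one]
  rw [← mul_one (ζ : ℂ), mul_assoc, one_mul, ← mul_sub, norm_mul, Circle.norm_coe, one_mul]

theorem m_closedBall_le (ζ : Circle) (h : ℝ) :
    m (Metric.closedBall ζ h) ≤ ENNReal.ofReal (h / 2) := by
  rw [m_closedBall_eq, m_apply Metric.isClosed_closedBall.measurableSet]
  have hsub : Circle.exp ⁻¹' Metric.closedBall 1 h ∩ Set.Ioc (-Real.pi) Real.pi ⊆
      Set.Icc (-(Real.pi / 2 * h)) (Real.pi / 2 * h) := by
    rintro t ⟨ht, ht'⟩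
    have h1 : |t| ≤ Real.pi := abs_le.2 ⟨ht'.1.le, ht'.2⟩
    have h2 := (le_dist_exp_one h1).trans ht
    refine abs_le.1 ?_
    have := Real.pi_pos
    rw [div_mul_eq_mul_div, div_le_iff₀ this] at h2
    linarith
  refine (mul_le_mul_right (measure_mono hsub) _).trans ?_
  rw [Real.volume_Icc, ← ENNReal.ofReal_mul (by positivity)]
  refine ENNReal.ofReal_le_ofReal (le_of_eq ?_)
  have := Real.pi_ne_zero
  field_simp
  ring

theorem le_m_closedBall (ζ : Circle) {h : ℝ} (hpi : h < Real.pi) :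
    ENNReal.ofReal (h / Real.pi) ≤ m (Metric.closedBall ζ h) := by
  rw [m_closedBall_eq, m_apply Metric.isClosed_closedBall.measurableSet]
  have hsub : Set.Icc (-h) h ⊆
      Circle.exp ⁻¹' Metric.closedBall 1 h ∩ Set.Ioc (-Real.pi) Real.pi := fun t ht =>
    ⟨(dist_exp_one_le t).trans (abs_le.2 ht), by linarith [ht.1], by linarith [ht.2]⟩
  refine le_trans ?_ (mul_le_mul_right (measure_mono hsub) _)
  rw [Real.volume_Icc, ← ENNReal.ofReal_mul (by positivity)]
  refine ENNReal.ofReal_le_ofReal (le_of_eq ?_)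
  have := Real.pi_ne_zero
  field_simp
  ring

/-- The ball bounds `h / π` and `h / 2` give the constant 4 because `π ≤ 4`. Doubling gives access
to the Lebesgue differentiation theorems through a Vitali family. -/
instance isUnifLocDoublingMeasure_m : IsUnifLocDoublingMeasure m := by
  refine ⟨⟨4, ?_⟩⟩
  filter_upwards [Ioo_mem_nhdsGT Real.pi_pos] with h hh ζ
  calc m (Metric.closedBall ζ (2 * h)) ≤ ENNReal.ofReal (2 * h / 2) :=
        m_closedBall_le ζ _
    _ ≤ ENNReal.ofReal (4 * (h / Real.pi)) := by
        refine ENNReal.ofReal_le_ofReal ?_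
        have := Real.pi_le_four
        rw [← mul_div_assoc, le_div_iff₀ Real.pi_pos]
        nlinarith [hh.1]
    _ = (4 : ℝ≥0) * ENNReal.ofReal (h / Real.pi) := by
        rw [ENNReal.ofReal_mul (by norm_num)]
        norm_num
    _ ≤ _ := by gcongr; exact le_m_closedBall ζ hh.2

/-! ### The Poisson kernel -/

/-- The Poisson kernel of the unit disk. -/
def poisson (z : ℂ) (ζ : Circle) : ℝ := (1 - ‖z‖ ^ 2) / ‖(ζ : ℂ) - z‖ ^ 2

theorem coe_sub_ne_zero {z : ℂ} (hz : ‖z‖ ≠ 1) (ζ : Circle) : (ζ : ℂ) - z ≠ 0 := by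
  intro h
  rw [sub_eq_zero] at h
  exact hz (by rw [← h, Circle.norm_coe])

theorem continuous_poisson {z : ℂ} (hz : ‖z‖ ≠ 1) : Continuous (poisson z) := by
  refine continuous_const.div ((continuous_subtype_val.sub continuous_const).norm.pow 2) fun ζ => ?_
  exact pow_ne_zero _ (norm_ne_zero_iff.2 (coe_sub_ne_zero hz ζ))

theorem poisson_nonneg {z : ℂ} (hz : ‖z‖ < 1) (ζ : Circle) : 0 ≤ poisson z ζ := by
  refine div_nonneg ?_ (by positivity)
  nlinarith [norm_nonneg z]

theorem integral_poisson_smul {f : ℂ → ℂ} (hf : DiffContOnCl ℂ f (Metric.ball 0 1)) {z : ℂ}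
    (hz : ‖z‖ < 1) : ∫ ζ : Circle, (poisson z ζ : ℂ) * f ζ ∂m = f z := by
  have h := hf.circleAverage_poissonKernel_smul' (w := z) (by simpa using hz)
  have hfc : Continuous fun ζ : Circle => f ζ := by
    refine hf.continuousOn.comp_continuous continuous_subtype_val fun ζ => ?_
    rw [closure_ball _ one_ne_zero]
    simpa using (Circle.norm_coe ζ).le
  rw [← h, ← integral_m_eq_circleAverage]
  · refine integral_congr_ae (Eventually.of_forall fun ζ => ?_)
    simp [poisson, Circle.norm_coe ζ]
  · have := (Complex.continuous_ofReal.comp (continuous_poisson hz.ne)).mul hfc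
    refine (this.congr fun ζ => ?_).aestronglyMeasurable
    simp [poisson, Circle.norm_coe ζ]

theorem integrable_real_of_continuous (p : Measure Circle) [IsFiniteMeasure p] {f : Circle → ℝ}
    (hf : Continuous f) : Integrable f p :=
  hf.integrable_of_hasCompactSupport (HasCompactSupport.of_compactSpace f)

theorem integral_poisson {z : ℂ} (hz : ‖z‖ < 1) : ∫ ζ, poisson z ζ ∂m = 1 := by
  have := integral_poisson_smul (f := fun _ => 1) diffContOnCl_const hz
  simp only [mul_one] at this
  rw [integral_complex_ofReal] at this
  exact_mod_cast this

/-! ### Fatou's theorem -/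

theorem norm_coe_smul_sub (r : ℝ) (ζ₀ : Circle) (hr : r ≤ 1) :
    ‖(ζ₀ : ℂ) - r * ζ₀‖ = 1 - r := by
  rw [← one_sub_mul, norm_mul, Circle.norm_coe, mul_one, ← Complex.ofReal_one,
    ← Complex.ofReal_sub, Complex.norm_real, Real.norm_of_nonneg (by linarith)]

theorem norm_ofReal_mul_coe (r : ℝ) (ζ₀ : Circle) : ‖(r : ℂ) * ζ₀‖ = |r| := by
  rw [norm_mul, Circle.norm_coe, mul_one, Complex.norm_real, Real.norm_eq_abs]

/-- The Poisson kernel is dominated by a dyadic sum of indicators of balls. -/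
theorem exists_poisson_le {r : ℝ} (h0 : 0 ≤ r) (h1 : r < 1) (ζ₀ ζ : Circle) :
    ∃ j : ℕ, ζ ∈ Metric.closedBall ζ₀ (2 ^ j * (1 - r)) ∧
      poisson (r * ζ₀) ζ ≤ 32 / (4 ^ j * (1 - r)) := by
  have hs : 0 < 1 - r := by linarith
  have hd : ∃ j : ℕ, dist ζ ζ₀ ≤ 2 ^ j * (1 - r) := by
    obtain ⟨j, hj⟩ := pow_unbounded_of_one_lt (dist ζ ζ₀ / (1 - r)) one_lt_two
    exact ⟨j, ((div_lt_iff₀ hs).1 hj).le⟩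
  classical
  -- The least `j` is taken: for a successor index, minimality bounds the distance to `ζ₀` from
  -- below, hence the kernel from above.
  refine ⟨Nat.find hd, Nat.find_spec hd, ?_⟩
  have hz : ‖(r : ℂ) * ζ₀‖ = r := by rw [norm_ofReal_mul_coe, abs_of_nonneg h0]
  have hlow1 : 1 - r ≤ ‖(ζ : ℂ) - r * ζ₀‖ := by
    have := norm_sub_norm_le (ζ : ℂ) (r * ζ₀)
    rwa [Circle.norm_coe, hz] at this
  have hlow2 : dist ζ ζ₀ ≤ 2 * ‖(ζ : ℂ) - r * ζ₀‖ := by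
    have := norm_sub_le_norm_sub_add_norm_sub (ζ : ℂ) (r * ζ₀) ζ₀
    rw [norm_sub_rev ((r : ℂ) * ζ₀), norm_coe_smul_sub r ζ₀ h1.le] at this
    rw [circle_dist_eq]
    linarith
  have hnum : 1 - ‖(r : ℂ) * ζ₀‖ ^ 2 ≤ 2 * (1 - r) := by rw [hz]; nlinarith
  have hpos : 0 < ‖(ζ : ℂ) - r * ζ₀‖ := hs.trans_le hlow1
  rw [poisson, div_le_div_iff₀ (by positivity) (by positivity)]
  rcases hj : Nat.find hd with _ | j
  · have h2 : (1 - r) * (1 - r) ≤ ‖(ζ : ℂ) - r * ζ₀‖ ^ 2 := by nlinarith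
    have : (1 - ‖(r : ℂ) * ζ₀‖ ^ 2) * (1 - r) ≤ 2 * (1 - r) * (1 - r) :=
      mul_le_mul_of_nonneg_right hnum hs.le
    simp only [pow_zero, one_mul]
    nlinarith
  · have hlt : 2 ^ j * (1 - r) < dist ζ ζ₀ := by
      have := Nat.find_min hd (m := j) (by omega)
      exact not_le.1 this
    have h2 : 2 ^ j * (1 - r) ≤ 2 * ‖(ζ : ℂ) - r * ζ₀‖ := hlt.le.trans hlow2
    have h3 : (2 ^ j * (1 - r)) ^ 2 ≤ (2 * ‖(ζ : ℂ) - r * ζ₀‖) ^ 2 :=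
      pow_le_pow_left₀ (by positivity) h2 2
    have h4 : ((2 : ℝ) ^ j) ^ 2 = 4 ^ j := by rw [← pow_mul, mul_comm, pow_mul]; norm_num
    rw [mul_pow, mul_pow, h4] at h3
    -- The constant 32: a factor 2 from `1 - r² ≤ 2(1 - r)`, a factor 4 from `dist ζ ζ₀ ≤ 2 |ζ -
    -- rζ₀|`, and a factor 4 from the shift `j + 1`.
    calc (1 - ‖(r : ℂ) * ζ₀‖ ^ 2) * (4 ^ (j + 1) * (1 - r))
        ≤ 2 * (1 - r) * (4 ^ (j + 1) * (1 - r)) :=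
          mul_le_mul_of_nonneg_right hnum (by positivity)
      _ = 8 * (4 ^ j * (1 - r) ^ 2) := by ring
      _ ≤ 8 * (2 ^ 2 * ‖(ζ : ℂ) - r * ζ₀‖ ^ 2) := by linarith
      _ = _ := by ring

theorem integral_poisson_le_tsum (p : Measure Circle) [IsFiniteMeasure p] {r : ℝ} (h0 : 0 ≤ r)
    (h1 : r < 1) (ζ₀ : Circle)
    (hs : Summable fun j : ℕ => 32 / (4 ^ j * (1 - r)) *
      p.real (Metric.closedBall ζ₀ (2 ^ j * (1 - r)))) :
    ∫ ζ, poisson (r * ζ₀) ζ ∂p ≤ ∑' j : ℕ, 32 / (4 ^ j * (1 - r)) *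
      p.real (Metric.closedBall ζ₀ (2 ^ j * (1 - r))) := by
  have hr : 0 < 1 - r := by linarith
  have hz : ‖(r : ℂ) * ζ₀‖ < 1 := by rw [norm_ofReal_mul_coe, abs_of_nonneg h0]; exact h1
  have hnn : ∀ j : ℕ, 0 ≤ 32 / (4 ^ j * (1 - r)) *
      p.real (Metric.closedBall ζ₀ (2 ^ j * (1 - r))) := fun j => by positivity
  rw [integral_eq_lintegral_of_nonneg_ae (Eventually.of_forall fun ζ => poisson_nonneg hz ζ)
    (continuous_poisson hz.ne).aestronglyMeasurable]
  refine ENNReal.toReal_le_of_le_ofReal (tsum_nonneg hnn) ?_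
  rw [ENNReal.ofReal_tsum_of_nonneg hnn hs]
  calc ∫⁻ ζ, ENNReal.ofReal (poisson (r * ζ₀) ζ) ∂p
      ≤ ∫⁻ ζ, ∑' j : ℕ, (Metric.closedBall ζ₀ (2 ^ j * (1 - r))).indicator
          (fun _ => ENNReal.ofReal (32 / (4 ^ j * (1 - r)))) ζ ∂p := by
        refine lintegral_mono fun ζ => ?_
        obtain ⟨j, hj, hle⟩ := exists_poisson_le h0 h1 ζ₀ ζ
        refine le_trans ?_ (ENNReal.le_tsum j)
        rw [Set.indicator_of_mem hj]
        exact ENNReal.ofReal_le_ofReal hle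
    _ = ∑' j : ℕ, ∫⁻ ζ, (Metric.closedBall ζ₀ (2 ^ j * (1 - r))).indicator
          (fun _ => ENNReal.ofReal (32 / (4 ^ j * (1 - r)))) ζ ∂p :=
        lintegral_tsum fun j => (measurable_const.indicator
          Metric.isClosed_closedBall.measurableSet).aemeasurable
    _ = ∑' j : ℕ, ENNReal.ofReal (32 / (4 ^ j * (1 - r)) *
          p.real (Metric.closedBall ζ₀ (2 ^ j * (1 - r)))) := by
        refine tsum_congr fun j => ?_
        rw [lintegral_indicator_const Metric.isClosed_closedBall.measurableSet,
          ENNReal.ofReal_mul (by positivity), ofReal_measureReal]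

/-- With `η h = p(B(ζ₀, h)) / h`, the dyadic bound is the sum of `32 · 2⁻ʲ η(2ʲ(1 - r))`. As `η` is
bounded and tends to `0` at `0`, dominated convergence for series applies. -/
theorem tendsto_integral_poisson_zero (p : Measure Circle) [IsFiniteMeasure p] (ζ₀ : Circle)
    (h : Tendsto (fun h : ℝ => p.real (Metric.closedBall ζ₀ h) / h) (𝓝[>] 0) (𝓝 0)) :
    Tendsto (fun r : ℝ => ∫ ζ, poisson (r * ζ₀) ζ ∂p) (𝓝[<] 1) (𝓝 0) := by
  set η : ℝ → ℝ := fun h => p.real (Metric.closedBall ζ₀ h) / h with hη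
  obtain ⟨K, hK0, hK⟩ : ∃ K, 0 ≤ K ∧ ∀ h, 0 < h → η h ≤ K := by
    obtain ⟨δ, hδ, hδ'⟩ := mem_nhdsGT_iff_exists_Ioo_subset.1
      (h.eventually (gt_mem_nhds (zero_lt_one' ℝ)))
    have hδ0 : (0 : ℝ) < δ := hδ
    -- Small radii are controlled by the limit hypothesis, the others by the total mass.
    refine ⟨max 1 (p.real Set.univ / δ), le_max_of_le_left zero_le_one, fun h hh => ?_⟩
    rcases lt_or_ge h δ with hlt | hge
    · exact le_max_of_le_left (le_of_lt (hδ' ⟨hh, hlt⟩))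
    · refine le_max_of_le_right ?_
      exact div_le_div₀ measureReal_nonneg (measureReal_mono (Set.subset_univ _)) hδ0 hge
  have hη0 : ∀ h, 0 < h → 0 ≤ η h := fun h hh => div_nonneg measureReal_nonneg hh.le
  have hterm : ∀ r < (1 : ℝ), ∀ j : ℕ, 32 / (4 ^ j * (1 - r)) *
      p.real (Metric.closedBall ζ₀ (2 ^ j * (1 - r))) =
      32 * (1 / 2) ^ j * η (2 ^ j * (1 - r)) := by
    intro r hr j
    have : (1 - r) ≠ 0 := by linarith
    have h4 : (4 : ℝ) ^ j = 2 ^ j * 2 ^ j := by rw [← mul_pow]; norm_num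
    simp only [hη, h4, one_div, inv_pow]
    field_simp
  have hbound : ∀ r < (1 : ℝ), ∀ j : ℕ, ‖32 * (1 / 2) ^ j * η (2 ^ j * (1 - r))‖ ≤
      32 * (1 / 2) ^ j * K := by
    intro r hr j
    have hpos : 0 < 2 ^ j * (1 - r) := mul_pos (by positivity) (by linarith)
    rw [Real.norm_of_nonneg (mul_nonneg (by positivity) (hη0 _ hpos))]
    exact mul_le_mul_of_nonneg_left (hK _ hpos) (by positivity)
  have hsum : Summable fun j : ℕ => 32 * (1 / 2 : ℝ) ^ j * K :=
    (summable_geometric_two.mul_left 32).mul_right K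
  have hlim : Tendsto (fun r : ℝ => ∑' j : ℕ, 32 * (1 / 2) ^ j * η (2 ^ j * (1 - r)))
      (𝓝[<] 1) (𝓝 (∑' _ : ℕ, 0)) := by
    refine tendsto_tsum_of_dominated_convergence hsum (fun j => ?_) ?_
    · have h1 : Tendsto (fun r : ℝ => 2 ^ j * (1 - r)) (𝓝[<] 1) (𝓝[>] 0) := by
        refine tendsto_nhdsWithin_iff.2 ⟨?_, ?_⟩
        · have : Tendsto (fun r : ℝ => 2 ^ j * (1 - r)) (𝓝 1) (𝓝 (2 ^ j * (1 - 1))) :=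
            Continuous.tendsto (by fun_prop) 1
          simpa using this.mono_left nhdsWithin_le_nhds
        · filter_upwards [self_mem_nhdsWithin] with r hr
          have hr' : r < 1 := hr
          exact Set.mem_Ioi.2 (mul_pos (by positivity) (by linarith))
      simpa using (h.comp h1).const_mul (32 * (1 / 2 : ℝ) ^ j)
    · filter_upwards [self_mem_nhdsWithin] with r hr
      exact hbound r hr
  rw [tsum_zero] at hlim
  have hIoo : Set.Ioo (0 : ℝ) 1 ∈ 𝓝[<] (1 : ℝ) := Ioo_mem_nhdsLT zero_lt_one
  refine squeeze_zero' ?_ ?_ hlim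
  · filter_upwards [hIoo] with r hr
    refine integral_nonneg fun ζ => poisson_nonneg ?_ ζ
    rw [norm_ofReal_mul_coe, abs_of_pos hr.1]
    exact hr.2
  · filter_upwards [hIoo] with r hr
    have hs : Summable fun j : ℕ => 32 * (1 / 2) ^ j * η (2 ^ j * (1 - r)) :=
      Summable.of_norm_bounded hsum (hbound r hr.2)
    simp only [← hterm r hr.2] at hs ⊢
    exact integral_poisson_le_tsum p hr.1.le hr.2 ζ₀ hs

theorem tendsto_closedBall_filterAt_m (ζ₀ : Circle) :
    Tendsto (fun h : ℝ => Metric.closedBall ζ₀ h) (𝓝[>] 0)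
      ((IsUnifLocDoublingMeasure.vitaliFamily m 1).filterAt ζ₀) := by
  refine IsUnifLocDoublingMeasure.tendsto_closedBall_filterAt m (fun _ => ζ₀) (fun h => h)
    tendsto_id ?_
  filter_upwards [self_mem_nhdsWithin] with h hh
  exact Metric.mem_closedBall_self (by linarith [Set.mem_Ioi.1 hh])

/-- The differentiation theorem speaks of `p(B) / m(B)`; since `m(B) ≤ h / 2`, dividing by `h` gives
something smaller. -/
theorem ae_tendsto_singular {p : Measure Circle} [IsFiniteMeasure p] (hp : p ⟂ₘ m) :
    ∀ᵐ ζ₀ ∂m, Tendsto (fun h : ℝ => p.real (Metric.closedBall ζ₀ h) / h) (𝓝[>] 0) (𝓝 0) := by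
  filter_upwards [(IsUnifLocDoublingMeasure.vitaliFamily m 1).ae_eventually_measure_zero_of_singular
    hp] with ζ₀ hζ
  have h1 := (ENNReal.tendsto_toReal ENNReal.zero_ne_top).comp
    (hζ.comp (tendsto_closedBall_filterAt_m ζ₀))
  rw [ENNReal.toReal_zero] at h1
  refine squeeze_zero' ?_ ?_ h1
  · filter_upwards [self_mem_nhdsWithin] with h hh
    exact div_nonneg measureReal_nonneg (le_of_lt hh)
  · filter_upwards [Ioo_mem_nhdsGT Real.pi_pos] with h hh
    simp only [Function.comp_apply, ENNReal.toReal_div]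
    refine div_le_div_of_nonneg_left measureReal_nonneg ?_ ?_
    · refine lt_of_lt_of_le (div_pos hh.1 Real.pi_pos) ?_
      exact (ENNReal.ofReal_le_iff_le_toReal (measure_ne_top _ _)).1 (le_m_closedBall ζ₀ hh.2)
    · refine (ENNReal.toReal_mono ENNReal.ofReal_ne_top (m_closedBall_le ζ₀ _)).trans ?_
      rw [ENNReal.toReal_ofReal (by linarith [hh.1])]
      linarith [hh.1]

theorem ae_tendsto_lebesgue {f : Circle → ℝ} (hf : Integrable f m) :
    ∀ᵐ ζ₀ ∂m, Tendsto (fun h : ℝ => (∫ ζ in Metric.closedBall ζ₀ h, ‖f ζ - f ζ₀‖ ∂m) / h)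
      (𝓝[>] 0) (𝓝 0) := by
  filter_upwards [(IsUnifLocDoublingMeasure.vitaliFamily m 1).ae_tendsto_average_norm_sub
    hf.locallyIntegrable] with ζ₀ hζ
  have h1 := hζ.comp (tendsto_closedBall_filterAt_m ζ₀)
  refine squeeze_zero' ?_ ?_ h1
  · filter_upwards [self_mem_nhdsWithin] with h hh
    exact div_nonneg (integral_nonneg fun _ => norm_nonneg _) (le_of_lt hh)
  · filter_upwards [Ioo_mem_nhdsGT Real.pi_pos] with h hh
    simp only [Function.comp_apply, setAverage_eq, smul_eq_mul]
    rw [div_eq_inv_mul]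
    refine mul_le_mul_of_nonneg_right ?_ (integral_nonneg fun _ => norm_nonneg _)
    refine inv_anti₀ ?_ ?_
    · refine lt_of_lt_of_le (div_pos hh.1 Real.pi_pos) ?_
      exact (ENNReal.ofReal_le_iff_le_toReal (measure_ne_top _ _)).1 (le_m_closedBall ζ₀ hh.2)
    · refine (ENNReal.toReal_mono ENNReal.ofReal_ne_top (m_closedBall_le ζ₀ _)).trans ?_
      rw [ENNReal.toReal_ofReal (by linarith [hh.1])]
      linarith [hh.1]

theorem integral_withDensity_ofReal {g : Circle → ℝ} (hg : Integrable g m) (h0 : 0 ≤ g)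
    (f : Circle → ℝ) :
    ∫ ζ, f ζ ∂(m.withDensity fun ζ => ENNReal.ofReal (g ζ)) = ∫ ζ, g ζ * f ζ ∂m := by
  rw [integral_withDensity_eq_integral_toReal_smul₀
    hg.aestronglyMeasurable.aemeasurable.ennreal_ofReal
    (Eventually.of_forall fun _ => ENNReal.ofReal_lt_top)]
  refine integral_congr_ae (Eventually.of_forall fun ζ => ?_)
  simp only [smul_eq_mul, ENNReal.toReal_ofReal (h0 ζ)]

/-- **Fatou's theorem**: the Poisson integral of a finite measure tends radially to the density of
its absolutely continuous part, almost everywhere. -/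
theorem ae_tendsto_integral_poisson (p : Measure Circle) [IsFiniteMeasure p] :
    ∀ᵐ (ζ₀ : Circle) ∂m, Tendsto (fun r : ℝ => ∫ ζ, poisson (r * ζ₀) ζ ∂p) (𝓝[<] 1)
      (𝓝 (p.rnDeriv m ζ₀).toReal) := by
  set f : Circle → ℝ := fun ζ => (p.rnDeriv m ζ).toReal with hf
  have hfint : Integrable f m := Measure.integrable_toReal_rnDeriv
  filter_upwards [ae_tendsto_singular (Measure.mutuallySingular_singularPart p m),
    ae_tendsto_lebesgue hfint] with ζ₀ h1 h2
  -- At a Lebesgue point the measure `|f - f ζ₀| dm` has mass `o(h)` on balls, so the criterion used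
  -- for the singular part applies to it as well.
  set g : Circle → ℝ := fun ζ => ‖f ζ - f ζ₀‖ with hg
  have hgint : Integrable g m := (hfint.sub (integrable_const _)).norm
  have hg0 : 0 ≤ g := fun ζ => norm_nonneg _
  have : IsFiniteMeasure (m.withDensity fun ζ => ENNReal.ofReal (g ζ)) :=
    isFiniteMeasure_withDensity_ofReal hgint.2
  have h3 := tendsto_integral_poisson_zero (m.withDensity fun ζ => ENNReal.ofReal (g ζ)) ζ₀ (by
    refine h2.congr fun h => ?_
    have hB : MeasurableSet (Metric.closedBall ζ₀ h) := Metric.isClosed_closedBall.measurableSet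
    rw [measureReal_def, withDensity_apply _ hB, ← ofReal_integral_eq_lintegral_ofReal
      hgint.integrableOn (Eventually.of_forall hg0), ENNReal.toReal_ofReal
      (integral_nonneg hg0)])
  have h4 := tendsto_integral_poisson_zero _ ζ₀ h1
  have h5 := h4.add h3
  rw [add_zero] at h5
  rw [tendsto_iff_norm_sub_tendsto_zero]
  refine squeeze_zero' (Eventually.of_forall fun _ => norm_nonneg _) ?_ h5
  filter_upwards [Ioo_mem_nhdsLT (zero_lt_one' ℝ)] with r hr
  have hz : ‖(r : ℂ) * ζ₀‖ < 1 := by rw [norm_ofReal_mul_coe, abs_of_pos hr.1]; exact hr.2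
  have hc := continuous_poisson hz.ne
  have hbd : ∃ C, ∀ ζ, ‖poisson (r * ζ₀) ζ‖ ≤ C := by
    obtain ⟨C, hC⟩ := isCompact_univ.exists_bound_of_continuousOn hc.continuousOn
    exact ⟨C, fun ζ => hC ζ (Set.mem_univ ζ)⟩
  obtain ⟨C, hC⟩ := hbd
  have hmul : ∀ u : Circle → ℝ, Integrable u m → Integrable (fun ζ => u ζ * poisson (r * ζ₀) ζ) m :=
    fun u hu => hu.mul_bdd hc.aestronglyMeasurable (Eventually.of_forall hC)
  have hdec : ∫ ζ, poisson (r * ζ₀) ζ ∂p = ∫ ζ, poisson (r * ζ₀) ζ ∂(p.singularPart m) +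
      ∫ ζ, f ζ * poisson (r * ζ₀) ζ ∂m := by
    conv_lhs => rw [Measure.haveLebesgueDecomposition_add p m]
    rw [integral_add_measure (integrable_real_of_continuous _ hc)
      (integrable_real_of_continuous _ hc)]
    congr 1
    rw [integral_withDensity_eq_integral_toReal_smul (Measure.measurable_rnDeriv p m)
      (Measure.rnDeriv_lt_top p m)]
    rfl
  have hconst : (p.rnDeriv m ζ₀).toReal = ∫ ζ, f ζ₀ * poisson (r * ζ₀) ζ ∂m := by
    rw [integral_const_mul, integral_poisson hz, mul_one]
  rw [hdec, integral_withDensity_ofReal hgint hg0, add_sub_assoc]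
  conv_lhs => rw [hconst]
  rw [← integral_sub (hmul _ hfint) (hmul _ (integrable_const _))]
  refine (norm_add_le _ _).trans (add_le_add ?_ ?_)
  · rw [Real.norm_of_nonneg (integral_nonneg fun ζ => poisson_nonneg hz ζ)]
  · refine norm_integral_le_of_norm_le (hmul _ hgint) (Eventually.of_forall fun ζ => ?_)
    rw [← sub_mul, norm_mul, Real.norm_of_nonneg (poisson_nonneg hz ζ)]

/-! ### The Herglotz representation -/

theorem integral_poisson_mul_re {H : ℂ → ℂ} (hH : DiffContOnCl ℂ H (Metric.ball 0 1)) {z : ℂ}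
    (hz : ‖z‖ < 1) : ∫ ζ : Circle, (H ζ).re * poisson z ζ ∂m = (H z).re := by
  have hHc : Continuous fun ζ : Circle => H ζ := by
    refine hH.continuousOn.comp_continuous continuous_subtype_val fun ζ => ?_
    rw [closure_ball _ one_ne_zero]
    simpa using (Circle.norm_coe ζ).le
  have hc := (Complex.continuous_ofReal.comp (continuous_poisson hz.ne)).mul hHc
  rw [← integral_poisson_smul hH hz]
  have := integral_re (𝕜 := ℂ) (integrable_of_continuous m hc)
  simp only [RCLike.re_eq_complex_re] at this
  refine Eq.trans ?_ this
  refine integral_congr_ae (Eventually.of_forall fun ζ => ?_)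
  simp [mul_comm]

/-- The dilates of `H` are continuous up to the circle and satisfy Poisson's formula. Their real
parts, divided by `Re H(0)`, are densities of probability measures, and a weak limit of these
represents `H`. -/
theorem exists_herglotz_measure {H : ℂ → ℂ} (hH : DifferentiableOn ℂ H (Metric.ball 0 1))
    (hre : ∀ z, ‖z‖ < 1 → 0 ≤ (H z).re) (h0 : 0 < (H 0).re) :
    ∃ p : Measure Circle, IsFiniteMeasure p ∧
      ∀ z, ‖z‖ < 1 → (H z).re = ∫ ζ, poisson z ζ ∂p := by
  set c := (H 0).re with hc
  -- The shift by 2 keeps the radii strictly between 0 and 1 already at `n = 0`.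
  set ρ : ℕ → ℝ := fun n => 1 - 1 / ((n : ℝ) + 2) with hρ
  have hρ0 : ∀ n, 0 < ρ n := fun n => by
    have : 1 / ((n : ℝ) + 2) < 1 := by
      rw [div_lt_one (by positivity)]
      linarith [(Nat.cast_nonneg n : (0 : ℝ) ≤ n)]
    simp only [hρ]; linarith
  have hρ1 : ∀ n, ρ n < 1 := fun n => by
    have : 0 < 1 / ((n : ℝ) + 2) := by positivity
    simp only [hρ]; linarith
  have hρlim : Tendsto ρ atTop (𝓝 1) := by
    have h1 : Tendsto (fun n : ℕ => 1 / ((n : ℝ) + 2)) atTop (𝓝 0) :=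
      tendsto_const_nhds.div_atTop (tendsto_natCast_atTop_atTop.atTop_add tendsto_const_nhds)
    simpa only [sub_zero] using h1.const_sub 1
  have hmem : ∀ n, ∀ z : ℂ, ‖z‖ ≤ 1 → ‖(ρ n : ℂ) * z‖ < 1 := fun n z hz => by
    rw [norm_mul, Complex.norm_real, Real.norm_of_nonneg (hρ0 n).le]
    nlinarith [hρ0 n, hρ1 n, norm_nonneg z]
  have hdc : ∀ n, DiffContOnCl ℂ (fun z => H (ρ n * z)) (Metric.ball 0 1) := fun n => by
    refine DifferentiableOn.diffContOnCl ?_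
    rw [closure_ball _ one_ne_zero]
    refine hH.comp (by fun_prop) fun z hz => ?_
    rw [mem_ball_zero_iff]
    exact hmem n z (by simpa using hz)
  set g : ℕ → Circle → ℝ := fun n ζ => (H (ρ n * ζ)).re / c with hg
  have hgc : ∀ n, Continuous (g n) := fun n => by
    refine (Complex.continuous_re.comp ?_).div_const c
    refine hH.continuousOn.comp_continuous (by fun_prop) fun ζ => ?_
    rw [mem_ball_zero_iff]
    exact hmem n ζ (Circle.norm_coe ζ).le
  have hg0 : ∀ n, 0 ≤ g n := fun n ζ => div_nonneg (hre _ (hmem n ζ (Circle.norm_coe ζ).le)) h0.le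
  have hgi : ∀ n, Integrable (g n) m := fun n => integrable_real_of_continuous m (hgc n)
  have hint : ∀ n, ∀ z, ‖z‖ < 1 → ∫ ζ, g n ζ * poisson z ζ ∂m = (H (ρ n * z)).re / c := by
    intro n z hz
    rw [← integral_poisson_mul_re (hdc n) hz, ← integral_div]
    refine integral_congr_ae (Eventually.of_forall fun ζ => ?_)
    simp only [hg]
    ring
  have hprob : ∀ n, IsProbabilityMeasure (m.withDensity fun ζ => ENNReal.ofReal (g n ζ)) := by
    intro n
    refine ⟨?_⟩
    rw [withDensity_apply _ MeasurableSet.univ, Measure.restrict_univ,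
      ← ofReal_integral_eq_lintegral_ofReal (hgi n) (Eventually.of_forall (hg0 n))]
    -- At the origin the Poisson kernel is `1`, so this integral is the total mass.
    have := hint n 0 (by simp)
    have h1 : ∀ ζ : Circle, poisson 0 ζ = 1 := fun ζ => by simp [poisson, Circle.norm_coe ζ]
    simp only [h1, mul_one, mul_zero] at this
    rw [this, ← hc, div_self h0.ne', ENNReal.ofReal_one]
  let q : ℕ → ProbabilityMeasure Circle := fun n => ⟨_, hprob n⟩
  -- The space of probability measures on the circle is compact, so an ultrafilter limit takes the
  -- place of a convergent subsequence.
  let U : Ultrafilter (ProbabilityMeasure Circle) := (hyperfilter ℕ).map q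
  have hlim : Tendsto q (hyperfilter ℕ) (𝓝 U.lim) := U.le_nhds_lim
  rw [ProbabilityMeasure.tendsto_iff_forall_integral_tendsto] at hlim
  refine ⟨ENNReal.ofReal c • (U.lim : Measure Circle),
    Measure.smul_finite _ ENNReal.ofReal_ne_top, fun z hz => ?_⟩
  have h1 := hlim (BoundedContinuousFunction.mkOfCompact ⟨poisson z, continuous_poisson hz.ne⟩)
  simp only [BoundedContinuousFunction.mkOfCompact_apply, ContinuousMap.coe_mk] at h1
  have h2 : ∀ n, ∫ ζ, poisson z ζ ∂(q n : Measure Circle) = (H (ρ n * z)).re / c := fun n =>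
    (integral_withDensity_ofReal (hgi n) (hg0 n) _).trans (hint n z hz)
  simp only [h2] at h1
  have h3 : Tendsto (fun n => (H (ρ n * z)).re / c) atTop (𝓝 ((H z).re / c)) := by
    refine Tendsto.div_const ((Complex.continuous_re.tendsto _).comp ?_) c
    have h4 : ContinuousAt H z :=
      (hH.differentiableAt (Metric.isOpen_ball.mem_nhds (by simpa using hz))).continuousAt
    refine h4.tendsto.comp ?_
    have : Tendsto (fun n => (ρ n : ℂ) * z) atTop (𝓝 ((1 : ℝ) * z)) :=
      ((Complex.continuous_ofReal.tendsto 1).comp hρlim).mul_const z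
    simpa using this
  have h5 := tendsto_nhds_unique h1 (h3.mono_left Nat.hyperfilter_le_atTop)
  rw [integral_smul_measure, h5, ENNReal.toReal_ofReal h0.le, smul_eq_mul, mul_div_cancel₀ _ h0.ne']

/-! ### Radial limits of Cauchy integrals -/

theorem exists_tendsto_radial_re {H : ℂ → ℂ} (hH : DifferentiableOn ℂ H (Metric.ball 0 1))
    (hre : ∀ z, ‖z‖ < 1 → 0 < (H z).re) :
    ∀ᵐ ζ₀ : Circle ∂m, ∃ a : ℝ, Tendsto (fun r : ℝ => (H (r * ζ₀)).re) (𝓝[<] 1) (𝓝 a) := by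
  obtain ⟨p, hp, hrep⟩ := exists_herglotz_measure hH (fun z hz => (hre z hz).le)
    (hre 0 (by simp))
  filter_upwards [ae_tendsto_integral_poisson p] with ζ₀ hζ
  refine ⟨_, hζ.congr' ?_⟩
  filter_upwards [Ioo_mem_nhdsLT (zero_lt_one' ℝ)] with r hr
  rw [hrep _ (by rw [norm_ofReal_mul_coe, abs_of_pos hr.1]; exact hr.2)]

/-- Bounded analytic functions on the disk have radial limits almost everywhere. -/
theorem exists_tendsto_radial {G : ℂ → ℂ} (hG : DifferentiableOn ℂ G (Metric.ball 0 1))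
    (hbd : ∀ z, ‖z‖ < 1 → ‖G z‖ ≤ 1) :
    ∀ᵐ ζ₀ : Circle ∂m, ∃ a : ℂ, Tendsto (fun r : ℝ => G (r * ζ₀)) (𝓝[<] 1) (𝓝 a) := by
  -- Adding 2 makes the real part positive; the factor `-I` turns the imaginary part of `G` into a
  -- real part.
  have h1 := exists_tendsto_radial_re (H := fun z => 2 + G z) (by fun_prop) (fun z hz => by
    have := (abs_le.1 ((Complex.abs_re_le_norm (G z)).trans (hbd z hz))).1
    simp only [Complex.add_re, Complex.re_ofNat]
    linarith)
  have h2 := exists_tendsto_radial_re (H := fun z => 2 - Complex.I * G z) (by fun_prop)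
    (fun z hz => by
      have := (abs_le.1 ((Complex.abs_im_le_norm (G z)).trans (hbd z hz))).1
      simp only [Complex.sub_re, Complex.re_ofNat, Complex.mul_re, Complex.I_re, Complex.I_im]
      linarith)
  filter_upwards [h1, h2] with ζ₀ ⟨a, ha⟩ ⟨b, hb⟩
  refine ⟨((a - 2 : ℝ) : ℂ) + ((b - 2 : ℝ) : ℂ) * Complex.I, ?_⟩
  have h3 := ((Complex.continuous_ofReal.tendsto _).comp (ha.sub_const 2)).add
    (((Complex.continuous_ofReal.tendsto _).comp (hb.sub_const 2)).mul_const Complex.I)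
  refine h3.congr fun r => ?_
  apply Complex.ext <;> simp

theorem isDiscrete_range_intCast_real : IsDiscrete (Set.range ((↑) : ℤ → ℝ)) :=
  ⟨Int.isClosedEmbedding_coe_real.isEmbedding.toHomeomorph.symm.isEmbedding.discreteTopology⟩

/-- If `exp ∘ F` has a nonzero limit along a continuous path, so does `F` have a limit. -/
theorem exists_tendsto_of_tendsto_exp {F : ℝ → ℂ} {g : ℂ} (hF : ContinuousOn F (Set.Ioo 0 1))
    (hg : g ≠ 0) (h : Tendsto (fun r => Complex.exp (F r)) (𝓝[<] 1) (𝓝 g)) :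
    ∃ a, Tendsto F (𝓝[<] 1) (𝓝 a) := by
  have h1 : Tendsto (fun r => Complex.exp (F r) / g) (𝓝[<] 1) (𝓝 1) := by
    simpa [div_self hg] using h.div_const g
  have h2 : ∀ᶠ r in 𝓝[<] (1 : ℝ), Complex.exp (F r) / g ∈ Complex.slitPlane :=
    h1.eventually (Complex.isOpen_slitPlane.mem_nhds Complex.one_mem_slitPlane)
  obtain ⟨δ, hδ, hsub⟩ := mem_nhdsLT_iff_exists_Ioo_subset.1
    (h2.and (Ioo_mem_nhdsLT (zero_lt_one' ℝ)))
  have hδ1 : δ < 1 := hδ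
  set k : ℝ → ℂ := fun r => Complex.log (Complex.exp (F r) / g) with hk
  have hkc : ContinuousOn k (Set.Ioo δ 1) := by
    refine ContinuousOn.clog ?_ fun r hr => (hsub hr).1
    exact (Complex.continuous_exp.comp_continuousOn
      (hF.mono fun r hr => (hsub hr).2)).div_const g
  have hklim : Tendsto k (𝓝[<] 1) (𝓝 0) := by
    simpa using h1.clog Complex.one_mem_slitPlane
  have hint : ∀ r ∈ Set.Ioo δ 1, ∃ n : ℤ,
      F r - k r - Complex.log g = n * (2 * Real.pi * Complex.I) := by
    intro r hr
    refine Complex.exp_eq_one_iff.1 ?_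
    rw [Complex.exp_sub, Complex.exp_sub, Complex.exp_log hg, Complex.exp_log
      (div_ne_zero (Complex.exp_ne_zero _) hg)]
    field_simp [Complex.exp_ne_zero]
  have hFc : ContinuousOn F (Set.Ioo δ 1) := hF.mono fun r hr => (hsub hr).2
  -- `F` differs from the continuous logarithm by an integer multiple of `2πi`; this integer `v` is
  -- continuous on an interval, hence constant.
  set v : ℝ → ℝ := fun r => (F r - k r - Complex.log g).im / (2 * Real.pi) with hv
  have hvc : ContinuousOn v (Set.Ioo δ 1) :=
    (Complex.continuous_im.comp_continuousOn ((hFc.sub hkc).sub continuousOn_const)).div_const _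
  have hval : ∀ r ∈ Set.Ioo δ 1, F r - k r - Complex.log g = (v r : ℂ) * (2 * Real.pi * Complex.I) ∧
      v r ∈ Set.range ((↑) : ℤ → ℝ) := by
    intro r hr
    obtain ⟨n, hn⟩ := hint r hr
    have : v r = n := by
      simp only [hv, hn]
      have := Real.pi_ne_zero
      simp
    exact ⟨by rw [this, hn]; simp, n, this.symm⟩
  set r₀ := (δ + 1) / 2 with hr₀
  have hr₀m : r₀ ∈ Set.Ioo δ 1 := ⟨by linarith, by linarith⟩
  have hconst : ∀ r ∈ Set.Ioo δ 1,
      F r = k r + (Complex.log g + (v r₀ : ℂ) * (2 * Real.pi * Complex.I)) := by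
    intro r hr
    have := isPreconnected_Ioo.constant_of_mapsTo isDiscrete_range_intCast_real hvc
      (fun r hr => (hval r hr).2) hr hr₀m
    rw [← this, ← (hval r hr).1]
    ring
  refine ⟨_, (hklim.add_const (Complex.log g + (v r₀ : ℂ) * (2 * Real.pi * Complex.I))).congr' ?_⟩
  filter_upwards [Ioo_mem_nhdsLT hδ1] with r hr
  exact (hconst r hr).symm

/-- The Cauchy kernel of the unit circle. -/
def cauchyKernel (z : ℂ) (ζ : Circle) : ℂ := (1 - conj (ζ : ℂ) * z)⁻¹

theorem one_sub_conj_mul (z : ℂ) (ζ : Circle) :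
    1 - conj (ζ : ℂ) * z = conj (ζ : ℂ) * (ζ - z) := by
  have : conj (ζ : ℂ) * ζ = 1 := by
    rw [← Complex.normSq_eq_conj_mul_self, Circle.normSq_coe, Complex.ofReal_one]
  rw [mul_sub, this]

theorem norm_one_sub_conj_mul (z : ℂ) (ζ : Circle) :
    ‖1 - conj (ζ : ℂ) * z‖ = ‖(ζ : ℂ) - z‖ := by
  rw [one_sub_conj_mul, norm_mul, Complex.norm_conj, Circle.norm_coe, one_mul]

theorem one_sub_conj_mul_ne_zero {z : ℂ} (hz : ‖z‖ ≠ 1) (ζ : Circle) :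
    1 - conj (ζ : ℂ) * z ≠ 0 := by
  rw [← norm_ne_zero_iff, norm_one_sub_conj_mul]
  exact norm_ne_zero_iff.2 (coe_sub_ne_zero hz ζ)

theorem abs_one_sub_norm_le (z : ℂ) (ζ : Circle) :
    |1 - ‖z‖| ≤ ‖1 - conj (ζ : ℂ) * z‖ := by
  have := abs_norm_sub_norm_le (ζ : ℂ) z
  rwa [Circle.norm_coe, ← norm_one_sub_conj_mul] at this

theorem continuous_conj_coe : Continuous fun ζ : Circle => conj (ζ : ℂ) :=
  Complex.continuous_conj.comp continuous_subtype_val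

theorem continuous_cauchyKernel {z : ℂ} (hz : ‖z‖ ≠ 1) : Continuous (cauchyKernel z) :=
  (continuous_const.sub (continuous_conj_coe.mul continuous_const)).inv₀
    (one_sub_conj_mul_ne_zero hz)

/-- This ties the real part of a Cauchy integral to the Poisson integral, for which Fatou's theorem
is available. -/
theorem poisson_eq_re (z : ℂ) (ζ : Circle) (hz : ‖z‖ ≠ 1) :
    poisson z ζ = 2 * (cauchyKernel z ζ).re - 1 := by
  have h1 : ‖1 - conj (ζ : ℂ) * z‖ ^ 2 ≠ 0 :=
    pow_ne_zero _ (norm_ne_zero_iff.2 (one_sub_conj_mul_ne_zero hz ζ))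
  have h2 : ‖z‖ ^ 2 = ‖conj (ζ : ℂ) * z‖ ^ 2 := by
    rw [norm_mul, Complex.norm_conj, Circle.norm_coe, one_mul]
  rw [poisson, ← norm_one_sub_conj_mul, cauchyKernel, Complex.inv_re, Complex.normSq_eq_norm_sq,
    h2, eq_sub_iff_add_eq, ← mul_div_assoc, div_add_one h1]
  congr 1
  rw [← Complex.normSq_eq_norm_sq, ← Complex.normSq_eq_norm_sq, Complex.normSq_apply,
    Complex.normSq_apply]
  simp only [Complex.sub_re, Complex.one_re, Complex.sub_im, Complex.one_im]
  ring

/-- The reflection `z ↦ 1/z̄` in the circle lets exterior boundary values be deduced from interior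
ones. -/
theorem cauchyKernel_outer {z : ℂ} (h0 : z ≠ 0) (hz : ‖z‖ ≠ 1) (ζ : Circle) :
    cauchyKernel (conj z)⁻¹ ζ = 1 - conj (cauchyKernel z ζ) := by
  have h1 := one_sub_conj_mul_ne_zero hz ζ
  have h2 : 1 - (ζ : ℂ) * conj z ≠ 0 := by
    have := (map_ne_zero (starRingEnd ℂ)).2 h1
    simpa using this
  have h3 : conj z ≠ 0 := (map_ne_zero _).2 h0
  have h4 : (ζ : ℂ) ≠ 0 := Circle.coe_ne_zero ζ
  have h5 : conj (ζ : ℂ) = (ζ : ℂ)⁻¹ := by rw [← Circle.coe_inv_eq_conj, Circle.coe_inv]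
  have h6 : (ζ : ℂ) * conj z - 1 ≠ 0 := by
    intro h; exact h2 (by linear_combination -h)
  simp only [cauchyKernel, map_inv₀, map_sub, map_one, map_mul, Complex.conj_conj]
  rw [h5]
  have h7 : 1 - (ζ : ℂ)⁻¹ * (conj z)⁻¹ = ((ζ : ℂ) * conj z - 1) / (ζ * conj z) := by
    field_simp
  rw [h7, inv_div, ← sub_eq_zero]
  field_simp
  ring

theorem hasDerivAt_cauchyKernel {z : ℂ} (hz : ‖z‖ ≠ 1) (ζ : Circle) :
    HasDerivAt (fun z => cauchyKernel z ζ) (conj (ζ : ℂ) / (1 - conj (ζ : ℂ) * z) ^ 2) z := by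
  have h : HasDerivAt (fun z => 1 - conj (ζ : ℂ) * z) (-(conj (ζ : ℂ))) z := by
    simpa using ((hasDerivAt_id z).const_mul (conj (ζ : ℂ))).const_sub 1
  have h2 := h.inv (one_sub_conj_mul_ne_zero hz ζ)
  rw [neg_neg] at h2
  exact h2

theorem isOpen_norm_ne_one : IsOpen {z : ℂ | ‖z‖ ≠ 1} :=
  isOpen_ne_fun continuous_norm continuous_const

theorem differentiableAt_integral_cauchyKernel (p : Measure Circle) [IsFiniteMeasure p]
    {f : Circle → ℂ} (hf : Continuous f) {z₀ : ℂ} (hz₀ : ‖z₀‖ ≠ 1) :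
    DifferentiableAt ℂ (fun z => ∫ ζ, f ζ * cauchyKernel z ζ ∂p) z₀ := by
  -- Half the distance from `z₀` to the circle: on this ball the kernel and its derivative stay
  -- bounded uniformly in `ζ`.
  set ε := |1 - ‖z₀‖| / 2 with hε
  have hpos : 0 < |1 - ‖z₀‖| := abs_pos.2 (sub_ne_zero.2 (Ne.symm hz₀))
  have hε0 : 0 < ε := by positivity
  have hball : ∀ z ∈ Metric.ball z₀ ε, ε ≤ |1 - ‖z‖| := by
    intro z hz
    have h1 : |‖z‖ - ‖z₀‖| ≤ ε := (abs_norm_sub_norm_le z z₀).trans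
      (by rw [← dist_eq_norm]; exact (Metric.mem_ball.1 hz).le)
    have h2 : |1 - ‖z₀‖| ≤ |1 - ‖z‖| + |‖z‖ - ‖z₀‖| := by
      have := abs_add_le (1 - ‖z‖) (‖z‖ - ‖z₀‖)
      rwa [sub_add_sub_cancel] at this
    have : |1 - ‖z₀‖| = 2 * ε := by rw [hε]; ring
    linarith
  have hne : ∀ z ∈ Metric.ball z₀ ε, ‖z‖ ≠ 1 := by
    intro z hz h
    have := hball z hz
    rw [h, sub_self, abs_zero] at this
    linarith
  obtain ⟨C, hC⟩ := isCompact_univ.exists_bound_of_continuousOn hf.continuousOn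
  have hmem : Metric.ball z₀ ε ∈ 𝓝 z₀ := Metric.ball_mem_nhds _ hε0
  refine (hasDerivAt_integral_of_dominated_loc_of_deriv_le (𝕜 := ℂ) (μ := p)
    (F := fun z ζ => f ζ * cauchyKernel z ζ) (x₀ := z₀) (bound := fun _ => C * (1 / ε ^ 2))
    (F' := fun z ζ => f ζ * (conj (ζ : ℂ) / (1 - conj (ζ : ℂ) * z) ^ 2)) hmem ?_ ?_ ?_ ?_
    (integrable_const _) ?_).2.differentiableAt
  · filter_upwards [hmem] with z hz
    exact (hf.mul (continuous_cauchyKernel (hne z hz))).aestronglyMeasurable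
  · exact integrable_of_continuous p (hf.mul (continuous_cauchyKernel hz₀))
  · refine (hf.mul (continuous_conj_coe.div ?_ fun ζ => ?_)).aestronglyMeasurable
    · exact (continuous_const.sub (continuous_conj_coe.mul continuous_const)).pow 2
    · exact pow_ne_zero _ (one_sub_conj_mul_ne_zero hz₀ ζ)
  · refine Eventually.of_forall fun ζ z hz => ?_
    rw [norm_mul, norm_div, norm_pow, Complex.norm_conj, Circle.norm_coe]
    refine mul_le_mul (hC ζ (Set.mem_univ _)) ?_ (by positivity)
      ((norm_nonneg _).trans (hC ζ (Set.mem_univ _)))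
    refine one_div_le_one_div_of_le (by positivity) ?_
    exact pow_le_pow_left₀ hε0.le ((hball z hz).trans (abs_one_sub_norm_le z ζ)) 2
  · exact Eventually.of_forall fun ζ z hz => (hasDerivAt_cauchyKernel (hne z hz) ζ).const_mul _

/-- The Cauchy integral of a finite measure has radial limits almost everywhere from both sides,
and its jump is the density of the absolutely continuous part. -/
theorem ae_jump_integral_cauchyKernel (p : Measure Circle) [IsFiniteMeasure p] :
    ∀ᵐ ζ₀ : Circle ∂m, ∃ a b : ℂ,
      Tendsto (fun r : ℝ => ∫ ζ, cauchyKernel (r * ζ₀) ζ ∂p) (𝓝[<] 1) (𝓝 a) ∧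
      Tendsto (fun r : ℝ => ∫ ζ, cauchyKernel (r * ζ₀) ζ ∂p) (𝓝[>] 1) (𝓝 b) ∧
      a = b + ((p.rnDeriv m ζ₀).toReal : ℂ) := by
  set F : ℂ → ℂ := fun z => ∫ ζ, cauchyKernel z ζ ∂p with hF
  have hdiff : ∀ z, ‖z‖ ≠ 1 → DifferentiableAt ℂ F z := fun z hz => by
    simpa using differentiableAt_integral_cauchyKernel p (f := fun _ => 1) continuous_const hz
  have hint : ∀ z, ‖z‖ ≠ 1 → Integrable (cauchyKernel z) p := fun z hz =>
    integrable_of_continuous p (continuous_cauchyKernel hz)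
  have hpois : ∀ z, ‖z‖ < 1 → ∫ ζ, poisson z ζ ∂p = 2 * (F z).re - p.real Set.univ := by
    intro z hz
    have h1 : ∫ ζ, (cauchyKernel z ζ).re ∂p = (F z).re := by
      have := integral_re (𝕜 := ℂ) (hint z hz.ne)
      simpa only [RCLike.re_eq_complex_re] using this
    have h2 : Integrable (fun ζ => (cauchyKernel z ζ).re) p := (hint z hz.ne).re
    simp only [poisson_eq_re z _ hz.ne]
    rw [integral_sub (h2.const_mul 2) (integrable_const _), integral_const_mul, h1]
    simp
  have hre : ∀ z, ‖z‖ < 1 → 0 ≤ (F z).re := by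
    intro z hz
    have h1 : 0 ≤ ∫ ζ, poisson z ζ ∂p := integral_nonneg fun ζ => poisson_nonneg hz ζ
    rw [hpois z hz] at h1
    linarith [measureReal_nonneg (μ := p) (s := Set.univ)]
  -- `F` need not be bounded, but `exp(-F)` is, because `Re F ≥ 0`.
  have hG := exists_tendsto_radial (G := fun z => Complex.exp (-F z))
    (fun z hz => ((hdiff z (mem_ball_zero_iff.1 hz).ne).neg.cexp).differentiableWithinAt)
    (fun z hz => by
      rw [Complex.norm_exp, Complex.neg_re]
      exact Real.exp_le_one_iff.2 (by linarith [hre z hz]))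
  have hout : ∀ z, z ≠ 0 → ‖z‖ ≠ 1 → F (conj z)⁻¹ = p.real Set.univ - conj (F z) := by
    intro z h0 hz
    simp only [hF, cauchyKernel_outer h0 hz]
    rw [integral_sub (integrable_const _) ?_, ← integral_conj]
    · simp
    · exact integrable_of_continuous p (Complex.continuous_conj.comp (continuous_cauchyKernel hz))
  have hIoo : Set.Ioo (0 : ℝ) 1 ∈ 𝓝[<] (1 : ℝ) := Ioo_mem_nhdsLT zero_lt_one
  filter_upwards [hG, ae_tendsto_integral_poisson p] with ζ₀ ⟨g, hg⟩ hw
  have hz : ∀ r ∈ Set.Ioo (0 : ℝ) 1, ‖(r : ℂ) * ζ₀‖ < 1 := fun r hr => by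
    rw [norm_ofReal_mul_coe, abs_of_pos hr.1]; exact hr.2
  have hrelim : Tendsto (fun r : ℝ => (F (r * ζ₀)).re) (𝓝[<] 1)
      (𝓝 (((p.rnDeriv m ζ₀).toReal + p.real Set.univ) / 2)) := by
    refine ((hw.add_const (p.real Set.univ)).div_const 2).congr' ?_
    filter_upwards [hIoo] with r hr
    rw [hpois _ (hz r hr)]
    ring
  -- By Fatou's theorem `Re F` has a finite radial limit, so `|exp(-F)|` stays away from zero.
  have hg0 : g ≠ 0 := by
    have h1 : Tendsto (fun r : ℝ => ‖Complex.exp (-F (r * ζ₀))‖) (𝓝[<] 1)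
        (𝓝 (Real.exp (-(((p.rnDeriv m ζ₀).toReal + p.real Set.univ) / 2)))) := by
      simp only [Complex.norm_exp, Complex.neg_re]
      exact (Real.continuous_exp.tendsto _).comp hrelim.neg
    have h2 := tendsto_nhds_unique hg.norm h1
    rw [← norm_ne_zero_iff, h2]
    exact (Real.exp_pos _).ne'
  have hcont : ContinuousOn (fun r : ℝ => -F (r * ζ₀)) (Set.Ioo 0 1) := by
    intro r hr
    have h1 : ContinuousAt F (r * ζ₀) := (hdiff _ (hz r hr).ne).continuousAt
    have h2 : ContinuousAt (fun r : ℝ => (r : ℂ) * ζ₀) r := by fun_prop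
    exact (ContinuousAt.comp (f := fun r : ℝ => (r : ℂ) * ζ₀) h1 h2).neg.continuousWithinAt
  obtain ⟨a', ha'⟩ := exists_tendsto_of_tendsto_exp hcont hg0 hg
  have ha : Tendsto (fun r : ℝ => F (r * ζ₀)) (𝓝[<] 1) (𝓝 (-a')) := by
    simpa using ha'.neg
  -- The exterior limit comes from reflection; the jump is then twice the real part of the interior
  -- limit minus the total mass, which is the density.
  refine ⟨-a', p.real Set.univ - conj (-a'), ha, ?_, ?_⟩
  · have hinv : Tendsto (fun r : ℝ => r⁻¹) (𝓝[>] 1) (𝓝[<] 1) := by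
      refine tendsto_nhdsWithin_iff.2 ⟨?_, ?_⟩
      · have := (tendsto_inv₀ (one_ne_zero (α := ℝ))).mono_left
          (nhdsWithin_le_nhds (s := Set.Ioi 1))
        simpa using this
      · filter_upwards [self_mem_nhdsWithin] with r hr
        exact Set.mem_Iio.2 (inv_lt_one_of_one_lt₀ hr)
    have h1 := ((Complex.continuous_conj.tendsto _).comp (ha.comp hinv)).const_sub
      (p.real Set.univ : ℂ)
    refine h1.congr' ?_
    filter_upwards [self_mem_nhdsWithin] with r hr
    have hr1 : (1 : ℝ) < r := hr
    have hr0 : (r : ℂ) ≠ 0 := by exact_mod_cast (by linarith : r ≠ 0)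
    have hmem : r⁻¹ ∈ Set.Ioo (0 : ℝ) 1 := ⟨by positivity, inv_lt_one_of_one_lt₀ hr1⟩
    have h2 := hout ((r⁻¹ : ℝ) * ζ₀) (mul_ne_zero (by simpa using hr0) (Circle.coe_ne_zero ζ₀))
      (hz _ hmem).ne
    have h3 : (conj (((r⁻¹ : ℝ) : ℂ) * ζ₀))⁻¹ = r * ζ₀ := by
      rw [map_mul, Complex.conj_ofReal, ← Circle.coe_inv_eq_conj, Circle.coe_inv, mul_inv, inv_inv,
        Complex.ofReal_inv, inv_inv]
    rw [h3] at h2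
    exact h2.symm
  · have h1 := tendsto_nhds_unique ((Complex.continuous_re.tendsto _).comp ha) hrelim
    apply Complex.ext
    · simp at h1 ⊢
      linarith
    · simp
/-! ### Cauchy integrals of complex measures -/

/-- The Cauchy integral `∮ ζʲ dc(ζ) / (1 - ζ̄ z)`. -/
def cauchyInt (c : ComplexMeasure Circle) (j : ℤ) (z : ℂ) : ℂ :=
  c.integral (fun ζ => circleMonomial j ζ * cauchyKernel z ζ) (ContinuousLinearMap.mul ℝ ℂ)

theorem continuous_circleMonomial_mul_cauchyKernel (j : ℤ) {z : ℂ} (hz : ‖z‖ ≠ 1) :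
    Continuous fun ζ => circleMonomial j ζ * cauchyKernel z ζ :=
  (continuous_circleMonomial j).mul (continuous_cauchyKernel hz)

theorem cauchyInt_eq_jordan (c : ComplexMeasure Circle) (j : ℤ) {z : ℂ} (hz : ‖z‖ ≠ 1) :
    cauchyInt c j z =
      (∫ ζ, circleMonomial j ζ * cauchyKernel z ζ
          ∂(ComplexMeasure.re c).toJordanDecomposition.posPart -
        ∫ ζ, circleMonomial j ζ * cauchyKernel z ζ
          ∂(ComplexMeasure.re c).toJordanDecomposition.negPart) +
      Complex.I * (∫ ζ, circleMonomial j ζ * cauchyKernel z ζ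
          ∂(ComplexMeasure.im c).toJordanDecomposition.posPart -
        ∫ ζ, circleMonomial j ζ * cauchyKernel z ζ
          ∂(ComplexMeasure.im c).toJordanDecomposition.negPart) :=
  integral_eq_jordan c
    (integrable_of_continuous _ (continuous_circleMonomial_mul_cauchyKernel j hz))

theorem analyticOnNhd_cauchyInt (c : ComplexMeasure Circle) (j : ℤ) :
    AnalyticOnNhd ℂ (cauchyInt c j) {z | ‖z‖ ≠ 1} := by
  refine DifferentiableOn.analyticOnNhd (fun z hz => ?_) isOpen_norm_ne_one
  have h := fun (p : Measure Circle) (_ : IsFiniteMeasure p) =>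
    differentiableAt_integral_cauchyKernel p (continuous_circleMonomial j) hz
  have hre := (h (ComplexMeasure.re c).toJordanDecomposition.posPart inferInstance).sub
    (h (ComplexMeasure.re c).toJordanDecomposition.negPart inferInstance)
  have him := (h (ComplexMeasure.im c).toJordanDecomposition.posPart inferInstance).sub
    (h (ComplexMeasure.im c).toJordanDecomposition.negPart inferInstance)
  refine ((hre.add (him.const_mul Complex.I)).congr_of_eventuallyEq ?_).differentiableWithinAt
  filter_upwards [isOpen_norm_ne_one.mem_nhds hz] with z hz
  exact cauchyInt_eq_jordan c j hz

theorem circleMonomial_succ_mul_cauchyKernel (j : ℤ) {z : ℂ} (hz : ‖z‖ ≠ 1) (ζ : Circle) :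
    circleMonomial (j + 1) ζ * cauchyKernel z ζ =
      z * (circleMonomial j ζ * cauchyKernel z ζ) + 1 * circleMonomial (j + 1) ζ := by
  have h1 := one_sub_conj_mul_ne_zero hz ζ
  have h2 : (ζ : ℂ) * conj (ζ : ℂ) = 1 := by
    rw [Complex.mul_conj, Circle.normSq_coe, Complex.ofReal_one]
  have h3 : circleMonomial 1 ζ = ζ := by simp [circleMonomial]
  rw [← circleMonomial_mul, h3, cauchyKernel]
  field_simp
  linear_combination (circleMonomial j ζ * z) * h2

/-- Shifting the exponent multiplies by `z` up to a constant. Both the jump for general exponents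
and the expansion at infinity rest on this recursion. -/
theorem cauchyInt_succ (c : ComplexMeasure Circle) (j : ℤ) {z : ℂ} (hz : ‖z‖ ≠ 1) :
    cauchyInt c (j + 1) z = z * cauchyInt c j z +
      c.integral (circleMonomial (j + 1)) (ContinuousLinearMap.mul ℝ ℂ) := by
  have h := integral_sum_mul_of_continuous c Finset.univ ![z, 1]
    ![fun ζ => circleMonomial j ζ * cauchyKernel z ζ, circleMonomial (j + 1)] (fun x _ => by
      fin_cases x
      · exact continuous_circleMonomial_mul_cauchyKernel j hz
      · exact continuous_circleMonomial _)
  simp only [Fin.sum_univ_two, Matrix.cons_val_zero, Matrix.cons_val_one] at h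
  rw [cauchyInt]
  simp only [circleMonomial_succ_mul_cauchyKernel j hz]
  rw [h, one_mul]
  rfl

theorem pow_mul_cauchyInt (c : ComplexMeasure Circle) (j : ℤ) {z : ℂ} (hz : ‖z‖ ≠ 1) (e : ℕ) :
    z ^ e * cauchyInt c (j - e) z = cauchyInt c j z - ∑ i ∈ Finset.range e,
      z ^ i * c.integral (circleMonomial (j - i)) (ContinuousLinearMap.mul ℝ ℂ) := by
  induction e with
  | zero => simp
  | succ e ih =>
    have h := cauchyInt_succ c (j - (e + 1 : ℕ)) hz
    rw [show j - ((e + 1 : ℕ) : ℤ) + 1 = j - e by push_cast; ring] at h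
    rw [Finset.sum_range_succ, ← sub_sub, ← ih, h]
    ring

theorem isBigO_cauchyInt (c : ComplexMeasure Circle) (j : ℤ) :
    cauchyInt c j =O[Bornology.cobounded ℂ] fun z => z⁻¹ := by
  -- The factor 2: for `|z| ≥ 2` one has `|1 - ζ̄z| ≥ |z| - 1 ≥ |z| / 2`.
  refine IsBigO.of_bound (‖ContinuousLinearMap.mul ℝ ℂ‖ * 2 * c.variation.real Set.univ) ?_
  have h2 : ∀ᶠ z : ℂ in Bornology.cobounded ℂ, 2 ≤ ‖z‖ :=
    tendsto_norm_cobounded_atTop.eventually_ge_atTop 2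
  filter_upwards [h2] with z hz
  have hb : ∀ ζ : Circle, ‖circleMonomial j ζ * cauchyKernel z ζ‖ ≤ 2 * ‖z‖⁻¹ := by
    intro ζ
    rw [norm_mul, norm_circleMonomial, one_mul, cauchyKernel, norm_inv,
      ← div_eq_mul_inv, ← one_div]
    have h1 := (neg_le_abs (1 - ‖z‖)).trans (abs_one_sub_norm_le z ζ)
    rw [div_le_div_iff₀ (by linarith) (by linarith)]
    linarith
  have := VectorMeasure.norm_integral_le_of_norm_le_const (μ := c)
    (B := ContinuousLinearMap.mul ℝ ℂ) (Eventually.of_forall hb)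
  refine this.trans (le_of_eq ?_)
  rw [norm_inv]
  ring

/-- Existence of limits `a` along `lin`, `b` along `lout`, and the jump relation `a = b + v`. -/
def HasJump {E : Type*} [TopologicalSpace E] [Add E] (f : ℂ → E) (lin lout : Filter ℂ) (v : E) :
    Prop :=
  ∃ a b, Tendsto f lin (𝓝 a) ∧ Tendsto f lout (𝓝 b) ∧ a = b + v

theorem HasJump.congr {E : Type*} [TopologicalSpace E] [Add E] {f g : ℂ → E} {lin lout : Filter ℂ}
    {v : E} (h : HasJump f lin lout v) (hin : ∀ᶠ z in lin, f z = g z)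
    (hout : ∀ᶠ z in lout, f z = g z) :
    HasJump g lin lout v := by
  obtain ⟨a, b, ha, hb, hab⟩ := h
  exact ⟨a, b, ha.congr' hin, hb.congr' hout, hab⟩

/-- A filter which tends to a point of the circle while avoiding the circle. -/
structure ApproachesCircle (l : Filter ℂ) (ζ₀ : Circle) : Prop where
  le_nhds : l ≤ 𝓝 (ζ₀ : ℂ)
  eventually_ne : ∀ᶠ z in l, ‖z‖ ≠ 1

theorem ApproachesCircle.eventually_ne_zero {l : Filter ℂ} {ζ₀ : Circle}
    (h : ApproachesCircle l ζ₀) : ∀ᶠ z in l, z ≠ 0 :=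
  h.le_nhds (isOpen_ne.mem_nhds (Circle.coe_ne_zero ζ₀))

theorem ApproachesCircle.eventually_cauchyInt_succ {l : Filter ℂ} {ζ₀ : Circle}
    (h : ApproachesCircle l ζ₀) (c : ComplexMeasure Circle) (j : ℤ) :
    ∀ᶠ z in l, cauchyInt c (j + 1) z = z * cauchyInt c j z +
      c.integral (circleMonomial (j + 1)) (ContinuousLinearMap.mul ℝ ℂ) :=
  h.eventually_ne.mono fun _ hz => cauchyInt_succ c j hz

/-- The constants in the recursion do not jump, so induction on `j` in both directions carries the
jump from exponent `0`; going down requires dividing by `z`, which stays away from `0`. -/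
theorem hasJump_cauchyInt {c : ComplexMeasure Circle} {ζ₀ : Circle} {lin lout : Filter ℂ}
    (hp : ApproachesCircle lin ζ₀) (hm : ApproachesCircle lout ζ₀) {w : ℂ}
    (h : HasJump (cauchyInt c 0) lin lout w) (j : ℤ) :
    HasJump (cauchyInt c j) lin lout (circleMonomial j ζ₀ * w) := by
  have hone : circleMonomial 1 ζ₀ = ζ₀ := by simp [circleMonomial]
  have idp : Tendsto (fun z : ℂ => z) lin (𝓝 ζ₀) := hp.le_nhds
  have idm : Tendsto (fun z : ℂ => z) lout (𝓝 ζ₀) := hm.le_nhds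
  induction j using Int.induction_on with
  | zero => simpa [circleMonomial_zero] using h
  | succ j ih =>
    obtain ⟨a, b, ha, hb, hab⟩ := ih
    refine HasJump.congr (f := fun z => z * cauchyInt c j z +
      c.integral (circleMonomial (j + 1)) (ContinuousLinearMap.mul ℝ ℂ))
      ⟨_, _, (idp.mul ha).add_const _, (idm.mul hb).add_const _, ?_⟩
      ((hp.eventually_cauchyInt_succ c j).mono fun _ h => h.symm)
      ((hm.eventually_cauchyInt_succ c j).mono fun _ h => h.symm)
    rw [hab, ← circleMonomial_mul, hone]
    ring
  | pred j ih =>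
    obtain ⟨a, b, ha, hb, hab⟩ := ih
    have hsub : -(j : ℤ) - 1 + 1 = -j := by ring
    have hev : ∀ {l : Filter ℂ}, ApproachesCircle l ζ₀ → ∀ᶠ z in l,
        z⁻¹ * (cauchyInt c (-(j : ℤ)) z -
          c.integral (circleMonomial (-(j : ℤ))) (ContinuousLinearMap.mul ℝ ℂ)) =
        cauchyInt c (-(j : ℤ) - 1) z := by
      intro l hl
      have h1 := hl.eventually_cauchyInt_succ c (-(j : ℤ) - 1)
      rw [hsub] at h1
      filter_upwards [h1, hl.eventually_ne_zero] with z hz h0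
      rw [hz, add_sub_cancel_right, inv_mul_cancel_left₀ h0]
    refine HasJump.congr ⟨_, _, (idp.inv₀ (Circle.coe_ne_zero ζ₀)).mul (ha.sub_const _),
      (idm.inv₀ (Circle.coe_ne_zero ζ₀)).mul (hb.sub_const _), ?_⟩ (hev hp) (hev hm)
    have h2 : circleMonomial (-(j : ℤ) - 1) ζ₀ = (ζ₀ : ℂ)⁻¹ * circleMonomial (-(j : ℤ)) ζ₀ := by
      have := circleMonomial_mul 1 (-(j : ℤ) - 1) ζ₀
      rw [hone, add_sub_cancel] at this
      rw [← this, inv_mul_cancel_left₀ (Circle.coe_ne_zero ζ₀)]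
    rw [hab, h2]
    ring

/-! ### Matrix Cauchy integrals -/

/-- The matrix Cauchy integral `∮ ζʲ dμ(ζ) / (1 - ζ̄ z)`. -/
def cauchyMat (μ : MatMeasure N) (j : ℤ) (z : ℂ) : Mat N :=
  Matrix.of fun a b => cauchyInt (μ a b) j z

/-- The function `∮ ζ⁻ᵉ A(ζ) dμ(ζ) / (1 - ζ̄ z)`, for the polynomial `A` with the given
coefficients. -/
def cauchyPoly (μ : MatMeasure N) (A : ℕ → Mat N) (n e : ℕ) (z : ℂ) : Mat N :=
  ∑ k ∈ Finset.range (n + 1), A k * cauchyMat μ ((k : ℤ) - e) z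

theorem matIntegral_eq_cauchyPoly (μ : MatMeasure N) {P : (Mat N)[X]} {n : ℕ}
    (hP : P.natDegree ≤ n) (e : ℕ) {z : ℂ} (hz : ‖z‖ ≠ 1) :
    matIntegral (fun ζ => ((conj (ζ : ℂ)) ^ e / (1 - conj (ζ : ℂ) * z)) • evalAt P ζ)
      μ (fun _ => 1) = cauchyPoly μ P.coeff n e z := by
  have := matIntegral_sum_smul μ (Finset.range (n + 1)) {()}
    (fun (k : ℕ) ζ => circleMonomial ((k : ℤ) - e) ζ * cauchyKernel z ζ) (fun _ _ => 1) P.coeff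
    (fun _ => 1) (fun _ _ => continuous_circleMonomial_mul_cauchyKernel _ hz)
    (fun _ _ => continuous_const)
  simp only [Finset.sum_singleton, mul_one, one_smul] at this
  refine Eq.trans ?_ this
  congr 1
  ext1 ζ
  rw [evalAt_circle hP, Finset.smul_sum]
  refine Finset.sum_congr rfl fun k _ => ?_
  rw [smul_smul, ← circleMonomial_neg_natCast, div_mul_eq_mul_div, circleMonomial_mul,
    neg_add_eq_sub]
  rfl

theorem cauchy1L_eq {μ : MatMeasure N} (h : QuasiDefinite μ) (n : ℕ) {z : ℂ} (hz : ‖z‖ ≠ 1) :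
    cauchy1L μ n z = cauchyPoly μ (szego1L μ n).coeff n n z :=
  matIntegral_eq_cauchyPoly μ (isSzego1L_szego1L h n).1.1 n hz

theorem coeff_reciprocal (n : ℕ) (P : (Mat N)[X]) (k : ℕ) :
    (reciprocal n P).coeff k = if k < n + 1 then (P.coeff (n - k))ᴴ else 0 := by
  simp [reciprocal, Polynomial.finsetSum_coeff, Polynomial.coeff_monomial]

theorem natDegree_reciprocal_le (n : ℕ) (P : (Mat N)[X]) : (reciprocal n P).natDegree ≤ n := by
  refine Polynomial.natDegree_le_iff_coeff_eq_zero.2 fun k hk => ?_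
  rw [coeff_reciprocal, if_neg (by omega)]

theorem cauchy2R_eq (μ : MatMeasure N) (n : ℕ) {z : ℂ} (hz : ‖z‖ ≠ 1) :
    cauchy2R μ n z = cauchyPoly μ (reciprocal n (szego2R μ n)).coeff n (n + 1) z :=
  matIntegral_eq_cauchyPoly μ (natDegree_reciprocal_le n _) (n + 1) hz

theorem analyticOnNhd_cauchyPoly (μ : MatMeasure N) (A : ℕ → Mat N) (n e : ℕ) (i j : Fin N) :
    AnalyticOnNhd ℂ (fun z => cauchyPoly μ A n e z i j) {z | ‖z‖ ≠ 1} := by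
  have h : (fun z => cauchyPoly μ A n e z i j) = fun z => ∑ k ∈ Finset.range (n + 1),
      ∑ l, A k i l * cauchyInt (μ l j) ((k : ℤ) - e) z := by
    ext z
    simp [cauchyPoly, Matrix.sum_apply, Matrix.mul_apply, cauchyMat]
  rw [h]
  refine Finset.analyticOnNhd_fun_sum _ fun k _ => Finset.analyticOnNhd_fun_sum _ fun l _ => ?_
  exact analyticOnNhd_const.mul (analyticOnNhd_cauchyInt _ _)

theorem hasJump_cauchyPoly {μ : MatMeasure N} {ζ₀ : Circle} {lin lout : Filter ℂ}
    (hp : ApproachesCircle lin ζ₀) (hm : ApproachesCircle lout ζ₀) {w : Mat N}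
    (h : ∀ i j, HasJump (cauchyInt (μ i j) 0) lin lout (w i j)) {P : (Mat N)[X]} {n : ℕ}
    (hP : P.natDegree ≤ n) (e : ℕ) :
    HasJump (cauchyPoly μ P.coeff n e) lin lout (evalAt P ζ₀ * ((conj (ζ₀ : ℂ)) ^ e • w)) := by
  have h1 : ∀ k : ℤ, HasJump (cauchyMat μ k) lin lout (circleMonomial k ζ₀ • w) := by
    intro k
    choose a b ha hb hab using fun i j => hasJump_cauchyInt hp hm (h i j) k
    refine ⟨Matrix.of a, Matrix.of b, ?_, ?_, ?_⟩
    · exact tendsto_pi_nhds.2 fun i => tendsto_pi_nhds.2 fun j => ha i j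
    · exact tendsto_pi_nhds.2 fun i => tendsto_pi_nhds.2 fun j => hb i j
    · ext i j
      exact hab i j
  choose a b ha hb hab using h1
  refine ⟨_, _, tendsto_finsetSum _ fun k _ => (ha ((k : ℤ) - e)).const_mul (P.coeff k),
    tendsto_finsetSum _ fun k _ => (hb ((k : ℤ) - e)).const_mul (P.coeff k), ?_⟩
  rw [evalAt_circle hP, Finset.sum_mul, ← Finset.sum_add_distrib]
  refine Finset.sum_congr rfl fun k _ => ?_
  rw [hab, mul_add, ← circleMonomial_neg_natCast, Matrix.smul_mul, Matrix.mul_smul,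
    Matrix.mul_smul, smul_smul, circleMonomial_mul, ← sub_eq_add_neg]

/-- The subtracted coefficients are the sums in the Szegő conditions, so orthogonality turns into
decay at infinity. -/
theorem pow_smul_cauchyPoly (μ : MatMeasure N) (A : ℕ → Mat N) (n e : ℕ) {z : ℂ} (hz : ‖z‖ ≠ 1) :
    z ^ e • cauchyPoly μ A n e z = cauchyPoly μ A n 0 z - ∑ i ∈ Finset.range e, z ^ i •
      ∑ k ∈ Finset.range (n + 1), A k * moment μ ((i : ℤ) - k) := by
  have h1 : ∀ k : ℤ, z ^ e • cauchyMat μ (k - e) z = cauchyMat μ k z -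
      ∑ i ∈ Finset.range e, z ^ i • moment μ ((i : ℤ) - k) := by
    intro k
    ext a b
    simp only [moment_eq, neg_sub, Matrix.smul_apply, Matrix.sub_apply, Matrix.sum_apply,
      smul_eq_mul]
    exact pow_mul_cauchyInt (μ a b) k hz e
  simp only [cauchyPoly, Finset.smul_sum, ← Matrix.mul_smul, h1, Nat.cast_zero, sub_zero,
    mul_sub, Finset.sum_sub_distrib, Finset.mul_sum]
  rw [Finset.sum_comm]

/-! ### Behaviour at infinity. -/

/-- The entries of a matrix function are `O(1/z)` at infinity. -/
def EntriesIsBigO {ι κ : Type*} (F : ℂ → Matrix ι κ ℂ) : Prop :=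
  ∀ i j, (fun z => F z i j) =O[Bornology.cobounded ℂ] fun z => z⁻¹

theorem EntriesIsBigO.sum {ι κ α : Type*} {s : Finset α} {F : α → ℂ → Matrix ι κ ℂ}
    (h : ∀ a ∈ s, EntriesIsBigO (F a)) : EntriesIsBigO fun z => ∑ a ∈ s, F a z := by
  intro i j
  simp only [Matrix.sum_apply]
  exact IsBigO.fun_sum fun a ha => h a ha i j

theorem EntriesIsBigO.const_mul {ι κ α : Type*} [Fintype κ] {F : ℂ → Matrix κ α ℂ}
    (A : Matrix ι κ ℂ) (h : EntriesIsBigO F) : EntriesIsBigO fun z => A * F z := by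
  intro i j
  simp only [Matrix.mul_apply]
  exact IsBigO.fun_sum fun k _ => (h k j).const_mul_left _

theorem EntriesIsBigO.congr {ι κ : Type*} {F G : ℂ → Matrix ι κ ℂ} (h : EntriesIsBigO F)
    (hFG : ∀ᶠ z in Bornology.cobounded ℂ, F z = G z) : EntriesIsBigO G := fun i j =>
  (h i j).congr' (hFG.mono fun z hz => by simp only [hz]) EventuallyEq.rfl

theorem entriesIsBigO_cauchyPoly (μ : MatMeasure N) (A : ℕ → Mat N) (n : ℕ) :
    EntriesIsBigO (cauchyPoly μ A n 0) :=
  EntriesIsBigO.sum fun _ _ => EntriesIsBigO.const_mul _ fun _ _ => isBigO_cauchyInt _ _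

theorem eventually_one_lt_norm : ∀ᶠ z : ℂ in Bornology.cobounded ℂ, 1 < ‖z‖ :=
  tendsto_norm_cobounded_atTop.eventually_gt_atTop 1

theorem entriesIsBigO_pow_smul {k n : ℕ} (hk : k < n) (A : Mat N) :
    EntriesIsBigO fun z : ℂ => (z ^ n)⁻¹ • z ^ k • A := by
  intro i j
  refine IsBigO.of_bound ‖A i j‖ ?_
  filter_upwards [eventually_one_lt_norm] with z hz
  simp only [Matrix.smul_apply, smul_eq_mul, norm_mul, norm_inv, norm_pow]
  rw [← mul_assoc, mul_comm]
  refine mul_le_mul_of_nonneg_left ?_ (norm_nonneg _)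
  have hpos : 0 < ‖z‖ := by linarith
  rw [inv_mul_eq_div, div_le_iff₀ (by positivity), inv_mul_eq_div, le_div_iff₀ hpos, ← pow_succ]
  exact pow_le_pow_right₀ hz.le hk

theorem entriesIsBigO_evalAt_of_lt {P : (Mat N)[X]} {d n : ℕ} (hP : P.natDegree ≤ d)
    (hd : d < n) : EntriesIsBigO fun z : ℂ => (z ^ n)⁻¹ • evalAt P z := by
  simp only [evalAt_eq_sum hP, Finset.smul_sum]
  exact EntriesIsBigO.sum fun k hk =>
    entriesIsBigO_pow_smul ((Nat.lt_succ_iff.1 (Finset.mem_range.1 hk)).trans_lt hd) _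

theorem entriesIsBigO_evalAt_monic {P : (Mat N)[X]} {n : ℕ} (hP : IsMonicOfDegree n P) :
    EntriesIsBigO fun z : ℂ => (z ^ n)⁻¹ • evalAt P z - 1 := by
  have h : EntriesIsBigO fun z : ℂ => ∑ k ∈ Finset.range n, (z ^ n)⁻¹ • z ^ k • P.coeff k :=
    EntriesIsBigO.sum fun k hk => entriesIsBigO_pow_smul (Finset.mem_range.1 hk) _
  refine h.congr ?_
  filter_upwards [eventually_one_lt_norm] with z hz
  have h0 : z ^ n ≠ 0 := pow_ne_zero _ (norm_pos_iff.1 (by linarith))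
  rw [evalAt_eq_sum hP.1, Finset.sum_range_succ, smul_add, hP.2, smul_smul, inv_mul_cancel₀ h0,
    one_smul, add_sub_cancel_right, Finset.smul_sum]

theorem hasAsymptotics_of_blocks (n : ℕ) {A B C D : ℂ → Mat N}
    (hA : EntriesIsBigO fun z => (z ^ n)⁻¹ • A z - 1) (hB : EntriesIsBigO fun z => z ^ n • B z)
    (hC : EntriesIsBigO fun z => (z ^ n)⁻¹ • C z) (hD : EntriesIsBigO fun z => z ^ n • D z - 1) :
    HasAsymptotics n fun z => Matrix.fromBlocks (A z) (B z) (C z) (D z) := by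
  refine ⟨fun z => Matrix.fromBlocks ((z ^ n)⁻¹ • A z - 1) (z ^ n • B z) ((z ^ n)⁻¹ • C z)
    (z ^ n • D z - 1), ?_, ?_⟩
  · rintro (i | i) (j | j)
    · exact hA i j
    · exact hB i j
    · exact hC i j
    · exact hD i j
  · filter_upwards [eventually_one_lt_norm] with z hz
    have h0 : z ^ n ≠ 0 := pow_ne_zero _ (norm_pos_iff.1 (by linarith))
    rw [← Matrix.fromBlocks_one, Matrix.fromBlocks_add, Matrix.fromBlocks_multiply]
    simp only [zero_add, add_zero, mul_zero, Matrix.mul_smul, mul_one, add_sub_cancel, smul_smul,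
      mul_inv_cancel₀ h0, inv_mul_cancel₀ h0, one_smul]

/-! ### The function `Y` -/

theorem analyticOnNhd_evalAt (P : (Mat N)[X]) (i j : Fin N) (s : Set ℂ) :
    AnalyticOnNhd ℂ (fun z => evalAt P z i j) s := by
  simp only [evalAt_eq_sum le_rfl, Matrix.sum_apply, Matrix.smul_apply, smul_eq_mul]
  exact Finset.analyticOnNhd_fun_sum _ fun k _ =>
    (analyticOnNhd_id.fun_pow k).mul analyticOnNhd_const

theorem continuous_evalAt (P : (Mat N)[X]) : Continuous (evalAt P) := by
  have : evalAt P = fun z => ∑ k ∈ Finset.range (P.natDegree + 1), z ^ k • P.coeff k :=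
    funext fun z => evalAt_eq_sum le_rfl z
  rw [this]
  exact continuous_finsetSum _ fun k _ => (continuous_pow k).smul continuous_const

theorem analyticOnNhd_mul_entries {F : ℂ → Mat N} {s : Set ℂ} (A : Mat N)
    (h : ∀ i j, AnalyticOnNhd ℂ (fun z => F z i j) s) (i j : Fin N) :
    AnalyticOnNhd ℂ (fun z => (-(A * F z)) i j) s := by
  simp only [Matrix.neg_apply, Matrix.mul_apply]
  exact (Finset.analyticOnNhd_fun_sum _ fun k _ => analyticOnNhd_const.mul (h k j)).neg

theorem analyticOnNhd_cauchy1L {μ : MatMeasure N} (h : QuasiDefinite μ) (n : ℕ) (i j : Fin N) :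
    AnalyticOnNhd ℂ (fun z => cauchy1L μ n z i j) {z | ‖z‖ ≠ 1} :=
  (analyticOnNhd_cauchyPoly μ (szego1L μ n).coeff n n i j).congr isOpen_norm_ne_one
    fun z hz => by simp only [cauchy1L_eq h n hz]

theorem analyticOnNhd_cauchy2R (μ : MatMeasure N) (n : ℕ) (i j : Fin N) :
    AnalyticOnNhd ℂ (fun z => cauchy2R μ n z i j) {z | ‖z‖ ≠ 1} :=
  (analyticOnNhd_cauchyPoly μ (reciprocal n (szego2R μ n)).coeff n (n + 1) i j).congr
    isOpen_norm_ne_one fun z hz => by simp only [cauchy2R_eq μ n hz]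

theorem analyticOffCircle_Y {μ : MatMeasure N} (h : QuasiDefinite μ) (n : ℕ) :
    AnalyticOffCircle (Y μ n) := by
  cases n with
  | zero =>
    rintro (i | i) (j | j)
    · exact analyticOnNhd_const
    · exact analyticOnNhd_cauchy1L h 0 i j
    · exact analyticOnNhd_const
    · exact analyticOnNhd_const
  | succ n =>
    rintro (i | i) (j | j)
    · exact analyticOnNhd_evalAt _ i j _
    · exact analyticOnNhd_cauchy1L h (n + 1) i j
    · exact analyticOnNhd_mul_entries _ (fun i j => analyticOnNhd_evalAt _ i j _) i j
    · exact analyticOnNhd_mul_entries _ (analyticOnNhd_cauchy2R μ n) i j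

theorem entriesIsBigO_cauchy1L {μ : MatMeasure N} (h : QuasiDefinite μ) (n : ℕ) :
    EntriesIsBigO fun z => z ^ n • cauchy1L μ n z := by
  refine (entriesIsBigO_cauchyPoly μ (szego1L μ n).coeff n).congr ?_
  filter_upwards [eventually_one_lt_norm] with z hz
  obtain ⟨-, ho⟩ := (isSzego1L_iff μ n _).1 (isSzego1L_szego1L h n)
  rw [cauchy1L_eq h n hz.ne', pow_smul_cauchyPoly μ _ n n hz.ne', Finset.sum_eq_zero, sub_zero]
  intro i hi
  rw [ho i (Finset.mem_range.1 hi), smul_zero]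

theorem sum_reciprocal_mul_moment (μ : MatMeasure N) (n i : ℕ) :
    ∑ k ∈ Finset.range (n + 1), (reciprocal n (szego2R μ n)).coeff k * moment μ ((i : ℤ) - k) =
      ∑ k ∈ Finset.range (n + 1), ((szego2R μ n).coeff k)ᴴ * moment μ ((k : ℤ) - (n - i)) := by
  rw [← Finset.sum_range_reflect]
  refine Finset.sum_congr rfl fun k hk => ?_
  have hk' : k ≤ n := Nat.lt_succ_iff.1 (Finset.mem_range.1 hk)
  rw [coeff_reciprocal, if_pos (by omega), show n - (n + 1 - 1 - k) = k by omega,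
    show n + 1 - 1 - k = n - k by omega, Nat.cast_sub hk']
  congr 2
  ring

/-- Of the `n + 1` correction terms, those with `i ≥ 1` vanish by orthogonality to the power `n - i
< n`, and `i = 0` gives `H^R_n`. This explains the factor `-(H^R_n)⁻¹` in `Y`. -/
theorem entriesIsBigO_cauchy2R {μ : MatMeasure N} (h : QuasiDefinite μ) (n : ℕ) :
    EntriesIsBigO fun z => z ^ (n + 1) • -((quasiTauR μ n)⁻¹ * cauchy2R μ n z) - 1 := by
  refine ((entriesIsBigO_cauchyPoly μ (reciprocal n (szego2R μ n)).coeff n).const_mul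
    (-(quasiTauR μ n)⁻¹)).congr ?_
  filter_upwards [eventually_one_lt_norm] with z hz
  obtain ⟨-, ho⟩ := (isSzego2R_iff μ n _).1 (isSzego2R_szego2R h n)
  have hu : (quasiTauR μ n)⁻¹ * quasiTauR μ n = 1 :=
    Matrix.nonsing_inv_mul _ ((Matrix.isUnit_iff_isUnit_det _).1 (isUnit_quasiTauR h n))
  have hsum : ∑ i ∈ Finset.range (n + 1), z ^ i • ∑ k ∈ Finset.range (n + 1),
      (reciprocal n (szego2R μ n)).coeff k * moment μ ((i : ℤ) - k) = quasiTauR μ n := by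
    rw [Finset.sum_range_succ', Finset.sum_eq_zero, zero_add, pow_zero, one_smul,
      sum_reciprocal_mul_moment, quasiTauR_eq h]
    · simp
    · intro i hi
      have hi' := Finset.mem_range.1 hi
      have := ho (n - (i + 1)) (by omega)
      rw [Nat.cast_sub (by omega)] at this
      rw [sum_reciprocal_mul_moment, this, smul_zero]
  rw [smul_neg, ← Matrix.mul_smul, cauchy2R_eq μ n hz.ne', pow_smul_cauchyPoly μ _ n (n + 1) hz.ne',
    hsum, mul_sub, hu, neg_sub, sub_sub_cancel_left, Matrix.neg_mul]

theorem hasAsymptotics_Y {μ : MatMeasure N} (h : QuasiDefinite μ) (n : ℕ) :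
    HasAsymptotics n (Y μ n) := by
  cases n with
  | zero =>
    refine hasAsymptotics_of_blocks 0 (A := fun _ => 1) (B := cauchy1L μ 0) (C := fun _ => 0)
      (D := fun _ => 1) ?_ (entriesIsBigO_cauchy1L h 0) ?_ ?_ <;>
    · intro i j
      simp [isBigO_zero]
  | succ n =>
    refine hasAsymptotics_of_blocks (n + 1)
      (entriesIsBigO_evalAt_monic (isSzego1L_szego1L h (n + 1)).1)
      (entriesIsBigO_cauchy1L h (n + 1)) ?_ (entriesIsBigO_cauchy2R h n)
    have := (entriesIsBigO_evalAt_of_lt (natDegree_reciprocal_le n (szego2R μ n))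
      (Nat.lt_succ_self n)).const_mul (-(quasiTauR μ n)⁻¹)
    refine this.congr (Eventually.of_forall fun z => ?_)
    rw [Matrix.neg_mul, Matrix.mul_smul, smul_neg]

theorem tendsto_fromBlocks {l : Filter ℂ} {A B C D : ℂ → Mat N} {a b c d : Mat N}
    (hA : Tendsto A l (𝓝 a)) (hB : Tendsto B l (𝓝 b)) (hC : Tendsto C l (𝓝 c))
    (hD : Tendsto D l (𝓝 d)) :
    Tendsto (fun z => Matrix.fromBlocks (A z) (B z) (C z) (D z)) l
      (𝓝 (Matrix.fromBlocks a b c d)) := by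
  have hc : Continuous fun x : (Mat N × Mat N) × Mat N × Mat N =>
      Matrix.fromBlocks x.1.1 x.1.2 x.2.1 x.2.2 := by fun_prop
  exact (hc.tendsto ((a, b), c, d)).comp ((hA.prodMk_nhds hB).prodMk_nhds (hC.prodMk_nhds hD))

/-- Right multiplication by the jump matrix keeps the first block column and adds its multiple by
`ζ̄ⁿ w` to the second. -/
theorem jump_fromBlocks {w : Circle → Mat N} {n : ℕ} {ζ₀ : Circle} {lin lout : Filter ℂ}
    {A B C D : ℂ → Mat N} {a c : Mat N}
    (hAp : Tendsto A lin (𝓝 a)) (hAm : Tendsto A lout (𝓝 a))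
    (hCp : Tendsto C lin (𝓝 c)) (hCm : Tendsto C lout (𝓝 c))
    (hB : HasJump B lin lout (a * ((conj (ζ₀ : ℂ)) ^ n • w ζ₀)))
    (hD : HasJump D lin lout (c * ((conj (ζ₀ : ℂ)) ^ n • w ζ₀))) :
    ∃ Zp Zm : BlockMat N,
      Tendsto (fun z => Matrix.fromBlocks (A z) (B z) (C z) (D z)) lin (𝓝 Zp) ∧
      Tendsto (fun z => Matrix.fromBlocks (A z) (B z) (C z) (D z)) lout (𝓝 Zm) ∧
      Zp = Zm * jumpMatrix w n ζ₀ := by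
  obtain ⟨b, b', hb, hb', hbb⟩ := hB
  obtain ⟨d, d', hd, hd', hdd⟩ := hD
  refine ⟨_, _, tendsto_fromBlocks hAp hb hCp hd, tendsto_fromBlocks hAm hb' hCm hd', ?_⟩
  rw [jumpMatrix, Matrix.fromBlocks_multiply, hbb, hdd]
  simp only [mul_one, mul_zero, add_zero]
  rw [add_comm b', add_comm d']

theorem HasJump.neg_const_mul {F : ℂ → Mat N} {lin lout : Filter ℂ} {v : Mat N} (A : Mat N)
    (h : HasJump F lin lout v) : HasJump (fun z => -(A * F z)) lin lout (-(A * v)) := by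
  obtain ⟨a, b, ha, hb, hab⟩ := h
  refine ⟨_, _, (ha.const_mul A).neg, (hb.const_mul A).neg, ?_⟩
  rw [hab, mul_add, neg_add]

/-- The filters are arbitrary, so the same reduction serves radial limits in the weak problem and
unrestricted limits in the strong one. -/
theorem jump_Y {μ : MatMeasure N} (h : QuasiDefinite μ) {w : Circle → Mat N} {ζ₀ : Circle}
    {lin lout : Filter ℂ} (hp : ApproachesCircle lin ζ₀) (hm : ApproachesCircle lout ζ₀)
    (hw : ∀ i j, HasJump (cauchyInt (μ i j) 0) lin lout (w ζ₀ i j)) (n : ℕ) :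
    ∃ Zp Zm : BlockMat N, Tendsto (Y μ n) lin (𝓝 Zp) ∧ Tendsto (Y μ n) lout (𝓝 Zm) ∧
      Zp = Zm * jumpMatrix w n ζ₀ := by
  have h1L : ∀ n, HasJump (cauchy1L μ n) lin lout
      (evalAt (szego1L μ n) ζ₀ * ((conj (ζ₀ : ℂ)) ^ n • w ζ₀)) := fun n =>
    (hasJump_cauchyPoly hp hm hw (isSzego1L_szego1L h n).1.1 n).congr
      (hp.eventually_ne.mono fun z hz => (cauchy1L_eq h n hz).symm)
      (hm.eventually_ne.mono fun z hz => (cauchy1L_eq h n hz).symm)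
  have h2R : ∀ n, HasJump (cauchy2R μ n) lin lout
      (evalAt (reciprocal n (szego2R μ n)) ζ₀ * ((conj (ζ₀ : ℂ)) ^ (n + 1) • w ζ₀)) := fun n =>
    (hasJump_cauchyPoly hp hm hw (natDegree_reciprocal_le n _) (n + 1)).congr
      (hp.eventually_ne.mono fun z hz => (cauchy2R_eq μ n hz).symm)
      (hm.eventually_ne.mono fun z hz => (cauchy2R_eq μ n hz).symm)
  have hev : ∀ {l : Filter ℂ}, ApproachesCircle l ζ₀ → ∀ P : (Mat N)[X],
      Tendsto (evalAt P) l (𝓝 (evalAt P ζ₀)) := fun hl P =>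
    ((continuous_evalAt P).tendsto _).mono_left hl.le_nhds
  cases n with
  | zero =>
    have h0 := isSzego1L_szego1L h 0
    have hone : evalAt (szego1L μ 0) (ζ₀ : ℂ) = 1 := by
      rw [evalAt_eq_sum h0.1.1]
      simp [h0.1.2]
    have hB := h1L 0
    rw [hone] at hB
    refine jump_fromBlocks (A := fun _ => 1) (B := cauchy1L μ 0) (C := fun _ => 0)
      (D := fun _ => 1) tendsto_const_nhds tendsto_const_nhds tendsto_const_nhds
      tendsto_const_nhds hB ⟨1, 1, tendsto_const_nhds, tendsto_const_nhds, ?_⟩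
    rw [zero_mul, add_zero]
  | succ n =>
    refine jump_fromBlocks (hev hp _) (hev hm _)
      ((hev hp (reciprocal n (szego2R μ n))).const_mul (quasiTauR μ n)⁻¹).neg
      ((hev hm (reciprocal n (szego2R μ n))).const_mul (quasiTauR μ n)⁻¹).neg
      (h1L (n + 1)) ?_
    have := (h2R n).neg_const_mul (quasiTauR μ n)⁻¹
    rw [← mul_assoc, ← neg_mul] at this
    exact this

/-! ### The weak Riemann–Hilbert problem -/

theorem approachesCircle_radial_left (ζ₀ : Circle) :
    ApproachesCircle (map (fun r : ℝ => (r : ℂ) * ζ₀) (𝓝[<] 1)) ζ₀ := by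
  refine ⟨?_, ?_⟩
  · have : Tendsto (fun r : ℝ => (r : ℂ) * ζ₀) (𝓝 1) (𝓝 ((1 : ℝ) * ζ₀)) :=
      Continuous.tendsto (by fun_prop) 1
    rw [Complex.ofReal_one, one_mul] at this
    exact this.mono_left nhdsWithin_le_nhds
  · rw [eventually_map]
    filter_upwards [Ioo_mem_nhdsLT (zero_lt_one' ℝ)] with r hr
    rw [norm_ofReal_mul_coe, abs_of_pos hr.1]
    exact hr.2.ne

theorem approachesCircle_radial_right (ζ₀ : Circle) :
    ApproachesCircle (map (fun r : ℝ => (r : ℂ) * ζ₀) (𝓝[>] 1)) ζ₀ := by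
  refine ⟨?_, ?_⟩
  · have : Tendsto (fun r : ℝ => (r : ℂ) * ζ₀) (𝓝 1) (𝓝 ((1 : ℝ) * ζ₀)) :=
      Continuous.tendsto (by fun_prop) 1
    rw [Complex.ofReal_one, one_mul] at this
    exact this.mono_left nhdsWithin_le_nhds
  · rw [eventually_map]
    filter_upwards [self_mem_nhdsWithin] with r hr
    have hr1 : (1 : ℝ) < r := hr
    rw [norm_ofReal_mul_coe, abs_of_pos (by linarith)]
    exact hr1.ne'

theorem ae_hasJump_cauchyInt (c : ComplexMeasure Circle) :
    ∀ᵐ ζ₀ : Circle ∂m, HasJump (cauchyInt c 0) (map (fun r : ℝ => (r : ℂ) * ζ₀) (𝓝[<] 1))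
      (map (fun r : ℝ => (r : ℂ) * ζ₀) (𝓝[>] 1)) (c.rnDeriv m ζ₀) := by
  filter_upwards [ae_jump_integral_cauchyKernel (ComplexMeasure.re c).toJordanDecomposition.posPart,
    ae_jump_integral_cauchyKernel (ComplexMeasure.re c).toJordanDecomposition.negPart,
    ae_jump_integral_cauchyKernel (ComplexMeasure.im c).toJordanDecomposition.posPart,
    ae_jump_integral_cauchyKernel (ComplexMeasure.im c).toJordanDecomposition.negPart]
    with ζ₀ ⟨a1, b1, ha1, hb1, h1⟩ ⟨a2, b2, ha2, hb2, h2⟩ ⟨a3, b3, ha3, hb3, h3⟩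
      ⟨a4, b4, ha4, hb4, h4⟩
  let F : ℂ → ℂ := fun z =>
    (∫ ζ, cauchyKernel z ζ ∂(ComplexMeasure.re c).toJordanDecomposition.posPart -
      ∫ ζ, cauchyKernel z ζ ∂(ComplexMeasure.re c).toJordanDecomposition.negPart) +
    Complex.I * (∫ ζ, cauchyKernel z ζ ∂(ComplexMeasure.im c).toJordanDecomposition.posPart -
      ∫ ζ, cauchyKernel z ζ ∂(ComplexMeasure.im c).toJordanDecomposition.negPart)
  have hev : ∀ {l : Filter ℂ}, ApproachesCircle l ζ₀ → ∀ᶠ z in l, F z =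
      cauchyInt c 0 z := fun hl => hl.eventually_ne.mono fun z hz => by
    rw [cauchyInt_eq_jordan c 0 hz]
    simp only [circleMonomial_zero, one_mul, F]
  refine HasJump.congr (f := F) ⟨_, _,
    tendsto_map'_iff.2 ((ha1.sub ha2).add ((ha3.sub ha4).const_mul
    Complex.I)), tendsto_map'_iff.2 ((hb1.sub hb2).add ((hb3.sub hb4).const_mul Complex.I)), ?_⟩
    (hev (approachesCircle_radial_left ζ₀)) (hev (approachesCircle_radial_right ζ₀))
  have hrn : c.rnDeriv m ζ₀ =
      ((((ComplexMeasure.re c).toJordanDecomposition.posPart.rnDeriv m ζ₀).toReal -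
        ((ComplexMeasure.re c).toJordanDecomposition.negPart.rnDeriv m ζ₀).toReal : ℝ) : ℂ) +
      Complex.I * ((((ComplexMeasure.im c).toJordanDecomposition.posPart.rnDeriv m ζ₀).toReal -
        ((ComplexMeasure.im c).toJordanDecomposition.negPart.rnDeriv m ζ₀).toReal : ℝ) : ℂ) := by
    rw [ComplexMeasure.rnDeriv, SignedMeasure.rnDeriv_def, SignedMeasure.rnDeriv_def]
    apply Complex.ext <;> simp
  rw [hrn, h1, h2, h3, h4]
  push_cast
  ring

theorem solvesWeakRHP_Y {μ : MatMeasure N} {w : Circle → Mat N} (h : QuasiDefinite μ)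
    (hw : IsDerivativeOf w μ) (n : ℕ) : SolvesWeakRHP w n (Y μ n) := by
  refine ⟨analyticOffCircle_Y h n, ?_, hasAsymptotics_Y h n⟩
  have h1 : ∀ᵐ ζ₀ : Circle ∂m, ∀ i j, w ζ₀ i j = (μ i j).rnDeriv m ζ₀ :=
    ae_all_iff.2 fun i => ae_all_iff.2 fun j => hw i j
  have h2 := ae_all_iff.2 fun i => ae_all_iff.2 fun j => ae_hasJump_cauchyInt (μ i j)
  filter_upwards [h1, h2] with ζ₀ h1 h2
  obtain ⟨Zp, Zm, hZp, hZm, hZ⟩ := jump_Y h (w := w) (approachesCircle_radial_left ζ₀)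
    (approachesCircle_radial_right ζ₀) (fun i j => by rw [h1 i j]; exact h2 i j) n
  exact ⟨Zp, Zm, tendsto_map'_iff.1 hZp, tendsto_map'_iff.1 hZm, hZ⟩

/-! ### Cauchy integrals of Hölder densities -/

theorem integral_m_of_diffContOnCl {f : ℂ → ℂ} (hf : DiffContOnCl ℂ f (Metric.ball 0 1)) :
    ∫ ζ : Circle, f ζ ∂m = f 0 := by
  rw [← integral_poisson_smul hf (z := 0) (by simp)]
  refine integral_congr_ae (Eventually.of_forall fun ζ => ?_)
  simp only [poisson, sub_zero, norm_zero, Circle.norm_coe]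
  norm_num

/-- On the circle the kernel is the conjugate of `1 / (1 - x z̄)`, analytic on the closed disk with
value `1` at the origin. -/
theorem integral_cauchyKernel_inner {z : ℂ} (hz : ‖z‖ < 1) : ∫ ζ, cauchyKernel z ζ ∂m = 1 := by
  have hne : ∀ x ∈ Metric.closedBall (0 : ℂ) 1, 1 - x * conj z ≠ 0 := by
    intro x hx h
    have h1 : ‖x * conj z‖ = 1 := by rw [← sub_eq_zero.1 h, norm_one]
    rw [norm_mul, Complex.norm_conj] at h1
    have := mul_le_of_le_one_left (norm_nonneg z) (mem_closedBall_zero_iff.1 hx)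
    linarith
  have hd : DifferentiableOn ℂ (fun x : ℂ => (1 - x * conj z)⁻¹) (Metric.closedBall 0 1) :=
    DifferentiableOn.fun_inv (by fun_prop) hne
  have h := integral_m_of_diffContOnCl (f := fun x => (1 - x * conj z)⁻¹)
    (DifferentiableOn.diffContOnCl (by rwa [closure_ball (0 : ℂ) one_ne_zero]))
  rw [zero_mul, sub_zero, inv_one] at h
  have h2 : ∀ ζ : Circle, cauchyKernel z ζ = conj ((1 - (ζ : ℂ) * conj z)⁻¹) := fun ζ => by
    simp [cauchyKernel]
  simp only [h2]
  rw [integral_conj, h, map_one]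

/-- On the circle the kernel equals `x / (x - z)`, analytic on the closed disk and zero at the
origin. -/
theorem integral_cauchyKernel_outer {z : ℂ} (hz : 1 < ‖z‖) : ∫ ζ, cauchyKernel z ζ ∂m = 0 := by
  have hne : ∀ x ∈ Metric.closedBall (0 : ℂ) 1, x - z ≠ 0 := by
    intro x hx h
    rw [sub_eq_zero.1 h, mem_closedBall_zero_iff] at hx
    exact hx.not_gt hz
  have hd : DifferentiableOn ℂ (fun x : ℂ => x * (x - z)⁻¹) (Metric.closedBall 0 1) :=
    differentiableOn_id.mul (DifferentiableOn.fun_inv (by fun_prop) hne)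
  have h := integral_m_of_diffContOnCl (f := fun x => x * (x - z)⁻¹)
    (DifferentiableOn.diffContOnCl (by rwa [closure_ball (0 : ℂ) one_ne_zero]))
  rw [zero_mul] at h
  rw [← h]
  refine integral_congr_ae (Eventually.of_forall fun ζ => ?_)
  simp only [cauchyKernel]
  rw [one_sub_conj_mul, mul_inv, ← Circle.coe_inv_eq_conj, Circle.coe_inv, inv_inv]

theorem integrable_dist_rpow {s : ℝ} (hs : -1 < s) (hs0 : s ≤ 0) :
    Integrable (fun η : Circle => dist η 1 ^ s) m := by
  have hmeas : Measurable fun η : Circle => dist η 1 ^ s :=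
    (measurable_id.dist measurable_const).pow_const s
  refine Integrable.smul_measure ?_ ENNReal.ofReal_ne_top
  rw [integrable_map_measure hmeas.aestronglyMeasurable
    Circle.exp.continuous.measurable.aemeasurable]
  have h0 : IntervalIntegrable (fun t : ℝ => |t| ^ s) volume 0 Real.pi :=
    (intervalIntegral.intervalIntegrable_rpow' hs).congr fun t ht => by
      rw [Set.uIoc_of_le Real.pi_pos.le] at ht
      simp only [abs_of_pos ht.1]
  have h1 : IntervalIntegrable (fun t : ℝ => |t| ^ s) volume (-Real.pi) 0 := by
    rw [IntervalIntegrable.iff_comp_neg]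
    simpa using h0.symm
  have h2 : IntegrableOn (fun t : ℝ => (2 / Real.pi) ^ s * |t| ^ s)
      (Set.Ioc (-Real.pi) Real.pi) volume :=
    ((intervalIntegrable_iff_integrableOn_Ioc_of_le (by linarith [Real.pi_pos])).1
      (h1.trans h0)).const_mul _
  refine Integrable.mono h2 (hmeas.comp Circle.exp.continuous.measurable).aestronglyMeasurable ?_
  filter_upwards [ae_restrict_mem measurableSet_Ioc] with t ht
  have hpos : 0 < 2 / Real.pi := div_pos two_pos Real.pi_pos
  rw [Function.comp_apply, Real.norm_of_nonneg (by positivity), Real.norm_of_nonneg (by positivity),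
    ← Real.mul_rpow hpos.le (abs_nonneg t)]
  rcases eq_or_ne t 0 with rfl | h
  · simp
  · exact Real.rpow_le_rpow_of_nonpos (mul_pos hpos (abs_pos.2 h))
      (le_dist_exp_one (abs_le.2 ⟨ht.1.le, ht.2⟩)) hs0

/-- The point of the circle with the same argument as `z`. -/
def circleProj (z : ℂ) : Circle := Circle.exp z.arg

theorem circleProj_mul_norm (z : ℂ) : (circleProj z : ℂ) * ‖z‖ = z := by
  rw [circleProj, Circle.coe_exp, mul_comm, Complex.norm_mul_exp_arg_mul_I]

theorem coe_circleProj {z : ℂ} (h : z ≠ 0) : (circleProj z : ℂ) = z / ‖z‖ :=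
  eq_div_of_mul_eq (Complex.ofReal_ne_zero.2 (norm_ne_zero_iff.2 h)) (circleProj_mul_norm z)

theorem tendsto_circleProj (ζ₀ : Circle) : Tendsto circleProj (𝓝 (ζ₀ : ℂ)) (𝓝 ζ₀) := by
  refine tendsto_subtype_rng.2 ?_
  have h : Tendsto (fun z : ℂ => z / ‖z‖) (𝓝 (ζ₀ : ℂ)) (𝓝 ((ζ₀ : ℂ) / ‖(ζ₀ : ℂ)‖)) :=
    tendsto_id.div (Complex.continuous_ofReal.comp continuous_norm).continuousAt (by simp)
  rw [Circle.norm_coe, Complex.ofReal_one, div_one] at h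
  refine h.congr' ?_
  filter_upwards [isOpen_ne.mem_nhds (Circle.coe_ne_zero ζ₀)] with z hz
  exact (coe_circleProj hz).symm

theorem cauchyKernel_mul (u η : Circle) (z : ℂ) :
    cauchyKernel (u * z) (u * η) = cauchyKernel z η := by
  have : conj (u : ℂ) * u = 1 := by
    rw [← Complex.normSq_eq_conj_mul_self, Circle.normSq_coe, Complex.ofReal_one]
  rw [cauchyKernel, cauchyKernel, Circle.coe_mul, map_mul]
  congr 2
  linear_combination (conj (η : ℂ) * z) * this

/-- A rotation brings `z` to the positive axis, so the singularity of the kernel is always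
approached at `η = 1`; subtracting the value of `f` at the projection of `z` compensates it there.
-/
theorem integral_cauchyKernel_mul {f : Circle → ℂ} (hf : Continuous f) {z : ℂ}
    (hz : ‖z‖ ≠ 1) :
    ∫ ζ, cauchyKernel z ζ * f ζ ∂m =
      ∫ η, cauchyKernel ‖z‖ η * (f (circleProj z * η) - f (circleProj z)) ∂m +
        f (circleProj z) * ∫ η, cauchyKernel z η ∂m := by
  have hz' : ‖((‖z‖ : ℝ) : ℂ)‖ ≠ 1 := by rwa [Complex.norm_real, norm_norm]
  have hc : Continuous (cauchyKernel ((‖z‖ : ℝ) : ℂ)) := continuous_cauchyKernel hz'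
  have hrot : ∀ g : Circle → ℂ, Continuous g → ∫ ζ, cauchyKernel z ζ * g ζ ∂m =
      ∫ η, cauchyKernel ‖z‖ η * g (circleProj z * η) ∂m := fun g hg => by
    have hm : AEStronglyMeasurable (fun ζ => cauchyKernel z ζ * g ζ)
        (Measure.map (fun η => circleProj z * η) m) :=
      ((continuous_cauchyKernel hz).mul hg).aestronglyMeasurable
    have h := integral_map (measurePreserving_mul_left (circleProj z)).measurable.aemeasurable hm
    rw [map_mul_left_m] at h
    rw [h]
    refine integral_congr_ae (Eventually.of_forall fun η => ?_)
    have := cauchyKernel_mul (circleProj z) η ‖z‖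
    rw [circleProj_mul_norm] at this
    simp only [this]
  have h1 := hrot f hf
  have h2 := hrot (fun _ => 1) continuous_const
  simp only [mul_one] at h2
  rw [h1, h2, ← integral_const_mul, ← integral_add]
  · refine integral_congr_ae (Eventually.of_forall fun η => ?_)
    simp only
    ring
  · exact integrable_of_continuous m (hc.mul ((hf.comp (continuous_const_mul _)).sub
      continuous_const))
  · exact integrable_of_continuous m (continuous_const.mul hc)

theorem tendsto_integral_cauchyKernel_holder {f : Circle → ℂ} {C α : ℝ≥0} (hα : 0 < α)
    (hα1 : α ≤ 1) (hf : HolderWith C α f) {l : Filter ℂ} [l.IsCountablyGenerated] {ζ₀ : Circle}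
    (hl : ApproachesCircle l ζ₀) :
    Tendsto (fun z => ∫ η, cauchyKernel ‖z‖ η * (f (circleProj z * η) - f (circleProj z)) ∂m) l
      (𝓝 (∫ η, cauchyKernel 1 η * (f (ζ₀ * η) - f ζ₀) ∂m)) := by
  have hfc : Continuous f := hf.continuous hα
  have hproj : Tendsto circleProj l (𝓝 ζ₀) := (tendsto_circleProj ζ₀).mono_left hl.le_nhds
  refine tendsto_integral_filter_of_dominated_convergence
    -- The kernel is at most `2 / dist η 1` and the Hölder difference at most `C (dist η 1)^α`; the
    -- exponent `α - 1 > -1` is integrable.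
    (fun η => (2 * C) * dist η 1 ^ ((α : ℝ) - 1)) ?_ ?_
    ((integrable_dist_rpow (by simpa using hα) (by simpa using hα1)).const_mul _) ?_
  · filter_upwards [hl.eventually_ne] with z hz
    exact ((continuous_cauchyKernel (by rwa [Complex.norm_real, norm_norm])).mul
      ((hfc.comp (continuous_const_mul _)).sub continuous_const)).aestronglyMeasurable
  · filter_upwards [hl.eventually_ne] with z hz
    refine Eventually.of_forall fun η => ?_
    have hdist : dist (circleProj z * η) (circleProj z) = dist η 1 := by
      rw [circle_dist_eq, circle_dist_eq, Circle.coe_mul, Circle.coe_one, ← mul_sub_one, norm_mul,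
        Circle.norm_coe, one_mul]
    have h1 : ‖f (circleProj z * η) - f (circleProj z)‖ ≤ C * dist η 1 ^ (α : ℝ) := by
      rw [← hdist, ← dist_eq_norm]
      exact hf.dist_le _ _
    rcases eq_or_ne η 1 with rfl | hη
    · rw [mul_one, sub_self, mul_zero, norm_zero]
      positivity
    have hpos : 0 < dist η 1 := dist_pos.2 hη
    -- `|η - 1| ≤ |η - |z|| + |1 - |z||`, and the last term is itself at most `|η - |z||`.
    have h2 : dist η 1 / 2 ≤ ‖1 - conj (η : ℂ) * (‖z‖ : ℝ)‖ := by
      have ha := abs_one_sub_norm_le ((‖z‖ : ℝ) : ℂ) η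
      rw [norm_one_sub_conj_mul] at ha ⊢
      rw [Complex.norm_real, norm_norm] at ha
      have hb : ‖(η : ℂ) - 1‖ ≤ ‖(η : ℂ) - (‖z‖ : ℝ)‖ + ‖((‖z‖ : ℝ) : ℂ) - 1‖ :=
        norm_sub_le_norm_sub_add_norm_sub _ _ _
      have hd : ‖((‖z‖ : ℝ) : ℂ) - 1‖ = |1 - ‖z‖| := by
        rw [← Complex.ofReal_one, ← Complex.ofReal_sub, Complex.norm_real, Real.norm_eq_abs,
          abs_sub_comm]
      rw [circle_dist_eq, Circle.coe_one]
      linarith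
    rw [norm_mul, cauchyKernel, norm_inv]
    calc ‖1 - conj (η : ℂ) * (‖z‖ : ℝ)‖⁻¹ * ‖f (circleProj z * η) - f (circleProj z)‖
        ≤ (dist η 1 / 2)⁻¹ * (C * dist η 1 ^ (α : ℝ)) :=
          mul_le_mul (inv_anti₀ (by positivity) h2) h1 (norm_nonneg _) (by positivity)
      _ = 2 * C * dist η 1 ^ ((α : ℝ) - 1) := by
          rw [Real.rpow_sub_one hpos.ne']
          field_simp
  · refine Eventually.of_forall fun η => ?_
    -- At `η = 1` the difference of values of `f` is zero, so the default value of the inverse in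
    -- `cauchyKernel 1 1` is harmless.
    rcases eq_or_ne η 1 with rfl | hη
    · simp [tendsto_const_nhds]
    have hne : 1 - conj (η : ℂ) * 1 ≠ 0 := by
      rw [← norm_ne_zero_iff, norm_one_sub_conj_mul, ← Circle.coe_one, ← circle_dist_eq]
      exact dist_ne_zero.2 hη
    have hnorm : Tendsto (fun z : ℂ => ((‖z‖ : ℝ) : ℂ)) l (𝓝 1) := by
      have := (Complex.continuous_ofReal.comp continuous_norm).tendsto (ζ₀ : ℂ)
      rw [Function.comp_apply, Circle.norm_coe, Complex.ofReal_one] at this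
      exact this.mono_left hl.le_nhds
    exact ((tendsto_const_nhds.sub (hnorm.const_mul _)).inv₀ hne).mul
      (((hfc.tendsto _).comp (hproj.mul_const η)).sub ((hfc.tendsto _).comp hproj))

theorem approachesCircle_inner (ζ₀ : Circle) :
    ApproachesCircle (𝓝[{z : ℂ | ‖z‖ < 1}] (ζ₀ : ℂ)) ζ₀ :=
  ⟨nhdsWithin_le_nhds, eventually_mem_nhdsWithin.mono fun _ h => ne_of_lt h⟩

theorem approachesCircle_outer (ζ₀ : Circle) :
    ApproachesCircle (𝓝[{z : ℂ | 1 < ‖z‖}] (ζ₀ : ℂ)) ζ₀ :=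
  ⟨nhdsWithin_le_nhds, eventually_mem_nhdsWithin.mono fun _ h => ne_of_gt h⟩

theorem hasJump_cauchyInt_holder {f : Circle → ℂ} {C α : ℝ≥0} (hα : 0 < α) (hα1 : α ≤ 1)
    (hf : HolderWith C α f) (ζ₀ : Circle) :
    HasJump (cauchyInt (m.withDensityᵥ f) 0) (𝓝[{z : ℂ | ‖z‖ < 1}] (ζ₀ : ℂ))
      (𝓝[{z : ℂ | 1 < ‖z‖}] (ζ₀ : ℂ)) (f ζ₀) := by
  have hfc : Continuous f := hf.continuous hα
  obtain ⟨B, hB⟩ := isCompact_univ.exists_bound_of_continuousOn hfc.continuousOn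
  have heq : ∀ z : ℂ, ‖z‖ ≠ 1 → cauchyInt (m.withDensityᵥ f) 0 z =
      ∫ ζ, cauchyKernel z ζ * f ζ ∂m := fun z hz => by
    rw [cauchyInt, integral_withDensity_of_bounded m (integrable_of_continuous m hfc)
      (C := B.toNNReal) (fun x => (hB x trivial).trans (Real.le_coe_toNNReal B))
      (integrable_of_continuous m (continuous_circleMonomial_mul_cauchyKernel 0 hz))]
    simp only [circleMonomial_zero, one_mul]
  have hin := approachesCircle_inner ζ₀
  have hout := approachesCircle_outer ζ₀
  refine ⟨_, _, ((tendsto_integral_cauchyKernel_holder hα hα1 hf hin).add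
    ((hfc.tendsto ζ₀).comp ((tendsto_circleProj ζ₀).mono_left hin.le_nhds))).congr' ?_,
    (tendsto_integral_cauchyKernel_holder hα hα1 hf hout).congr' ?_, rfl⟩
  · filter_upwards [eventually_mem_nhdsWithin] with z hz
    have hz' : ‖z‖ < 1 := hz
    rw [heq z hz'.ne, integral_cauchyKernel_mul hfc hz'.ne, integral_cauchyKernel_inner hz',
      mul_one, Function.comp_apply]
  · filter_upwards [eventually_mem_nhdsWithin] with z hz
    have hz' : 1 < ‖z‖ := hz
    rw [heq z hz'.ne', integral_cauchyKernel_mul hfc hz'.ne', integral_cauchyKernel_outer hz',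
      mul_zero, add_zero]

/-! ### The strong Riemann–Hilbert problem -/

theorem solvesStrongRHP_Y {w : Circle → Mat N} (hw : IsHolderWeight w)
    (h : QuasiDefinite (densityMeasure w)) (n : ℕ) :
    SolvesStrongRHP w n (Y (densityMeasure w) n) := by
  refine ⟨analyticOffCircle_Y h n, fun ζ => ?_, hasAsymptotics_Y h n⟩
  refine jump_Y h (approachesCircle_inner ζ) (approachesCircle_outer ζ) (fun i j => ?_) n
  obtain ⟨C, α, hα, hα1, hf⟩ := hw i j
  exact hasJump_cauchyInt_holder hα hα1 hf ζ

/-! ### Liouville's theorem across the circle, and uniqueness. -/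

theorem dense_norm_ne_one : Dense {z : ℂ | ‖z‖ ≠ 1} := by
  have h : {z : ℂ | ‖z‖ ≠ 1} = (Metric.sphere (0 : ℂ) 1)ᶜ := by
    ext z
    simp
  rw [h, ← interior_eq_empty_iff_dense_compl]
  exact interior_sphere 0 one_ne_zero

/-- Cauchy's theorem needs only continuity on the boundary, so it is applied separately on the
annulus and on the unit disk; the point `z` is a countable exceptional set. -/
theorem circleIntegral_dslope_eq_zero {F : ℂ → ℂ} (hc : Continuous F)
    (hd : ∀ z, ‖z‖ ≠ 1 → DifferentiableAt ℂ F z) {z : ℂ} (hz : ‖z‖ ≠ 1) {R : ℝ} (hR : 1 ≤ R) :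
    (∮ x in C(0, R), dslope F z x) = 0 := by
  have hgc : Continuous (dslope F z) := by
    rw [← continuousOn_univ]
    exact (continuousOn_dslope univ_mem).2 ⟨hc.continuousOn, hd z hz⟩
  have hgd : ∀ x, ‖x‖ ≠ 1 → x ≠ z → DifferentiableAt ℂ (dslope F z) x := fun x hx hxz =>
    (differentiableAt_dslope_of_ne hxz).2 (hd x hx)
  rw [Complex.circleIntegral_eq_of_differentiable_on_annulus_off_countable one_pos hR
    (Set.countable_singleton z) hgc.continuousOn]
  · refine Complex.circleIntegral_eq_zero_of_differentiable_on_off_countable zero_le_one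
      (Set.countable_singleton z) hgc.continuousOn ?_
    rintro x ⟨hx, hxz⟩
    exact hgd x (mem_ball_zero_iff.1 hx).ne hxz
  · rintro x ⟨⟨-, hx⟩, hxz⟩
    rw [mem_closedBall_zero_iff, not_le] at hx
    exact hgd x hx.ne' hxz

/-- A continuous function on the plane, holomorphic off the unit circle, with a limit at infinity,
is constant. -/
theorem eq_of_differentiable_off_circle {F : ℂ → ℂ} (hc : Continuous F)
    (hd : ∀ z, ‖z‖ ≠ 1 → DifferentiableAt ℂ F z) {L : ℂ}
    (hL : Tendsto F (Bornology.cobounded ℂ) (𝓝 L)) {z : ℂ} (hz : ‖z‖ ≠ 1) : F z = L := by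
  rw [← sub_eq_zero, ← norm_le_zero_iff]
  refine le_of_forall_pos_le_add fun ε hε => ?_
  rw [zero_add]
  have hev : ∀ᶠ x in Bornology.cobounded ℂ, ‖F x - L‖ ≤ ε / 2 := by
    have := (tendsto_iff_norm_sub_tendsto_zero.1 hL).eventually (gt_mem_nhds (half_pos hε))
    exact this.mono fun _ h => h.le
  rw [← comap_norm_atTop, eventually_comap] at hev
  obtain ⟨R, hR, hR1, hR2⟩ := (hev.and ((eventually_ge_atTop 1).and
    (eventually_ge_atTop (2 * ‖z‖ + 1)))).exists
  have hR0 : 0 < R := by linarith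
  have hzR : ‖z‖ < R := by linarith [norm_nonneg z]
  have hne : ∀ x ∈ Metric.sphere (0 : ℂ) R, x - z ≠ 0 := fun x hx h => by
    rw [mem_sphere_zero_iff_norm, sub_eq_zero.1 h] at hx
    exact hzR.ne hx
  have hcinv : ContinuousOn (fun x => (x - z)⁻¹) (Metric.sphere (0 : ℂ) R) :=
    ContinuousOn.inv₀ (by fun_prop) hne
  have hi : CircleIntegrable (fun x => (x - z)⁻¹ * (F x - L)) 0 R :=
    (hcinv.mul (hc.sub continuous_const).continuousOn).circleIntegrable hR0.le
  have hi' : CircleIntegrable (fun x => (F z - L) * (x - z)⁻¹) 0 R :=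
    (continuousOn_const.mul hcinv).circleIntegrable hR0.le
  have hzero := circleIntegral_dslope_eq_zero hc hd hz hR1
  -- Splitting the difference quotient gives `∮ (F x - L) / (x - z) dx = 2πi (F z - L)`, whose left
  -- side is at most `2πε` in norm since `|x - z| ≥ R / 2`.
  rw [circleIntegral.integral_congr hR0.le (g := fun x =>
    (x - z)⁻¹ * (F x - L) - (F z - L) * (x - z)⁻¹) (fun x hx => by
      rw [dslope_of_ne _ (sub_ne_zero.1 (hne x hx)), slope_def_field]
      ring), circleIntegral.integral_sub hi hi', sub_eq_zero,
    circleIntegral.integral_const_mul,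
    circleIntegral.integral_sub_inv_of_mem_ball (mem_ball_zero_iff.2 hzR)] at hzero
  have hbound := circleIntegral.norm_integral_le_of_norm_le_const (c := 0) hR0.le
    (f := fun x => (x - z)⁻¹ * (F x - L)) (C := (R / 2)⁻¹ * (ε / 2)) fun x hx => by
      have hx' : ‖x‖ = R := mem_sphere_zero_iff_norm.1 hx
      rw [norm_mul, norm_inv]
      refine mul_le_mul (inv_anti₀ (half_pos hR0) ?_) (hR x hx') (norm_nonneg _) (by positivity)
      have := norm_sub_norm_le x z
      linarith
  rw [hzero, norm_mul, norm_mul, norm_mul, Complex.norm_I, mul_one, Complex.norm_real,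
    Real.norm_of_nonneg Real.pi_pos.le, Complex.norm_ofNat, mul_comm] at hbound
  have hsimp : 2 * Real.pi * R * ((R / 2)⁻¹ * (ε / 2)) = 2 * Real.pi * ε := by
    field_simp
  rw [hsimp] at hbound
  exact le_of_mul_le_mul_left hbound Real.two_pi_pos

/-- The limits of `f` at each point of the unit circle from the inside and from the outside exist
and agree. -/
def MatchesOnCircle {E : Type*} [TopologicalSpace E] (f : ℂ → E) : Prop :=
  ∀ ζ : Circle, ∃ a, Tendsto f (𝓝[{z : ℂ | ‖z‖ < 1}] (ζ : ℂ)) (𝓝 a) ∧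
    Tendsto f (𝓝[{z : ℂ | 1 < ‖z‖}] (ζ : ℂ)) (𝓝 a)

/-- The values of `f` on the circle carry no information, so they are replaced by the common limits
from the two sides before the Liouville argument is applied. -/
theorem eq_of_matchesOnCircle {f : ℂ → ℂ} (ha : AnalyticOnNhd ℂ f {z | ‖z‖ ≠ 1})
    (hm : MatchesOnCircle f) {L : ℂ} (hL : Tendsto f (Bornology.cobounded ℂ) (𝓝 L)) {z : ℂ}
    (hz : ‖z‖ ≠ 1) : f z = L := by
  have hext : ∀ x, ‖x‖ ≠ 1 → extendFrom {z : ℂ | ‖z‖ ≠ 1} f x = f x :=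
    extendFrom_extends ha.continuousOn
  have hcont : Continuous (extendFrom {z : ℂ | ‖z‖ ≠ 1} f) := by
    refine continuous_extendFrom dense_norm_ne_one fun x => ?_
    by_cases hx : ‖x‖ = 1
    · obtain ⟨a, h1, h2⟩ := hm ⟨x, mem_sphere_zero_iff_norm.2 hx⟩
      refine ⟨a, ?_⟩
      have hset : {z : ℂ | ‖z‖ ≠ 1} = {z | ‖z‖ < 1} ∪ {z | 1 < ‖z‖} := by
        ext y
        exact ne_iff_lt_or_gt
      rw [hset, nhdsWithin_union]
      exact h1.sup h2
    · exact ⟨f x, ha.continuousOn x hx⟩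
  have hlarge : ∀ᶠ x : ℂ in Bornology.cobounded ℂ, ‖x‖ ≠ 1 :=
    eventually_one_lt_norm.mono fun x hx => ne_of_gt hx
  rw [← hext z hz]
  refine eq_of_differentiable_off_circle hcont (fun x hx => ?_)
    (hL.congr' (hlarge.mono fun x hx => (hext x hx).symm)) hz
  refine (ha x hx).differentiableAt.congr_of_eventuallyEq ?_
  filter_upwards [isOpen_norm_ne_one.mem_nhds hx] with y hy
  exact hext y hy

theorem analyticOnNhd_det {ι : Type*} [Fintype ι] [DecidableEq ι] {M : ℂ → Matrix ι ι ℂ} {s : Set ℂ}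
    (h : ∀ i j, AnalyticOnNhd ℂ (fun z => M z i j) s) : AnalyticOnNhd ℂ (fun z => (M z).det) s := by
  simp only [Matrix.det_apply']
  exact Finset.analyticOnNhd_fun_sum _ fun σ _ =>
    analyticOnNhd_const.mul (Finset.analyticOnNhd_fun_prod _ fun i _ => h _ _)

theorem analyticOnNhd_adjugate {ι : Type*} [Fintype ι] [DecidableEq ι] {M : ℂ → Matrix ι ι ℂ}
    {s : Set ℂ} (h : ∀ i j, AnalyticOnNhd ℂ (fun z => M z i j) s) (i j : ι) :
    AnalyticOnNhd ℂ (fun z => (M z).adjugate i j) s := by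
  simp only [Matrix.adjugate_apply]
  refine analyticOnNhd_det fun k l => ?_
  simp only [Matrix.updateRow_apply]
  split_ifs
  · exact analyticOnNhd_const
  · exact h k l

theorem det_jumpMatrix (w : Circle → Mat N) (n : ℕ) (ζ : Circle) : (jumpMatrix w n ζ).det = 1 := by
  rw [jumpMatrix, Matrix.det_fromBlocks_zero₂₁, Matrix.det_one, mul_one]

theorem det_diag_pow {z : ℂ} (hz : z ≠ 0) (n : ℕ) :
    (Matrix.fromBlocks (z ^ n • 1) 0 0 ((z ^ n)⁻¹ • 1) : BlockMat N).det = 1 := by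
  rw [Matrix.det_fromBlocks_zero₂₁, ← Matrix.det_mul, Matrix.smul_mul, Matrix.mul_smul, smul_smul,
    mul_inv_cancel₀ (pow_ne_zero n hz), one_smul, mul_one, Matrix.det_one]

theorem HasAsymptotics.exists_tendsto {n : ℕ} {Z : ℂ → BlockMat N} (h : HasAsymptotics n Z) :
    ∃ E : ℂ → BlockMat N, Tendsto E (Bornology.cobounded ℂ) (𝓝 1) ∧
      ∀ᶠ z in Bornology.cobounded ℂ,
        Z z = E z * Matrix.fromBlocks (z ^ n • 1) 0 0 ((z ^ n)⁻¹ • 1) := by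
  obtain ⟨E, hE, hZ⟩ := h
  refine ⟨fun z => 1 + E z, ?_, hZ⟩
  have : Tendsto E (Bornology.cobounded ℂ) (𝓝 0) :=
    tendsto_pi_nhds.2 fun i => tendsto_pi_nhds.2 fun j =>
      (hE i j).trans_tendsto tendsto_inv₀_cobounded
  simpa using this.const_add 1

theorem SolvesStrongRHP.det_eq_one {w : Circle → Mat N} {n : ℕ} {Z : ℂ → BlockMat N}
    (h : SolvesStrongRHP w n Z) {z : ℂ} (hz : ‖z‖ ≠ 1) : (Z z).det = 1 := by
  have hdet : Continuous fun M : BlockMat N => M.det := continuous_id.matrix_det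
  refine eq_of_matchesOnCircle (analyticOnNhd_det h.analytic) (fun ζ => ?_) ?_ hz
  · obtain ⟨Zp, Zm, hp, hm, hj⟩ := h.jump ζ
    refine ⟨Zp.det, (hdet.tendsto _).comp hp, ?_⟩
    rw [hj, Matrix.det_mul, det_jumpMatrix, mul_one]
    exact (hdet.tendsto _).comp hm
  · obtain ⟨E, hE, hZ⟩ := h.asymptotics.exists_tendsto
    have hE' := (hdet.tendsto _).comp hE
    rw [Matrix.det_one] at hE'
    refine hE'.congr' ?_
    filter_upwards [hZ, eventually_one_lt_norm] with x hx hx1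
    rw [hx, Matrix.det_mul, det_diag_pow (norm_pos_iff.1 (one_pos.trans hx1)), mul_one,
      Function.comp_apply]

/-- The adjugate replaces the inverse because it is polynomial in the entries, hence analytic and
continuous. The jumps cancel, `J · adj J = 1`, as do the diagonal factors at infinity. -/
theorem SolvesStrongRHP.mul_adjugate_eq_one {w : Circle → Mat N} {n : ℕ} {Z W : ℂ → BlockMat N}
    (hZ : SolvesStrongRHP w n Z) (hW : SolvesStrongRHP w n W) {z : ℂ} (hz : ‖z‖ ≠ 1) :
    Z z * (W z).adjugate = 1 := by
  have hadj : Continuous fun M : BlockMat N => M.adjugate := continuous_id.matrix_adjugate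
  have happly : ∀ (i j : Fin N ⊕ Fin N) {l : Filter ℂ} {G : ℂ → BlockMat N} {M : BlockMat N},
      Tendsto G l (𝓝 M) → Tendsto (fun z => G z i j) l (𝓝 (M i j)) := fun i j _ _ _ h =>
    tendsto_pi_nhds.1 (tendsto_pi_nhds.1 h i) j
  ext i j
  refine eq_of_matchesOnCircle (f := fun z => (Z z * (W z).adjugate) i j) ?_ (fun ζ => ?_)
    (happly i j (M := 1) ?_) hz
  · simp only [Matrix.mul_apply]
    exact Finset.analyticOnNhd_fun_sum _ fun k _ =>
      (hZ.analytic i k).mul (analyticOnNhd_adjugate hW.analytic k j)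
  · obtain ⟨Zp, Zm, hp, hm, hj⟩ := hZ.jump ζ
    obtain ⟨Wp, Wm, hp', hm', hj'⟩ := hW.jump ζ
    refine ⟨(Zp * Wp.adjugate) i j, happly i j (hp.mul ((hadj.tendsto _).comp hp')), ?_⟩
    have : Zp * Wp.adjugate = Zm * Wm.adjugate := by
      rw [hj, hj', Matrix.adjugate_mul_distrib, mul_assoc, ← mul_assoc (jumpMatrix w n ζ),
        Matrix.mul_adjugate, det_jumpMatrix, one_smul, one_mul]
    rw [this]
    exact happly i j (hm.mul ((hadj.tendsto _).comp hm'))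
  · obtain ⟨E, hE, hEZ⟩ := hZ.asymptotics.exists_tendsto
    obtain ⟨E', hE', hEW⟩ := hW.asymptotics.exists_tendsto
    have hlim := hE.mul ((hadj.tendsto _).comp hE')
    rw [Matrix.adjugate_one, mul_one] at hlim
    refine hlim.congr' ?_
    filter_upwards [hEZ, hEW, eventually_one_lt_norm] with x hx hx' hx1
    rw [hx, hx', Matrix.adjugate_mul_distrib, mul_assoc (E x), ← mul_assoc _ _ (E' x).adjugate,
      Matrix.mul_adjugate, det_diag_pow (norm_pos_iff.1 (one_pos.trans hx1)), one_smul, one_mul,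
      Function.comp_apply]

theorem SolvesStrongRHP.unique {w : Circle → Mat N} {n : ℕ} {Z W : ℂ → BlockMat N}
    (hZ : SolvesStrongRHP w n Z) (hW : SolvesStrongRHP w n W) {z : ℂ} (hz : ‖z‖ ≠ 1) :
    Z z = W z := by
  have h := congrArg (· * W z) (hZ.mul_adjugate_eq_one hW hz)
  simpa [mul_assoc, Matrix.adjugate_mul, hW.det_eq_one hz] using h

end

end SzegoRHP

theorem mainTheorem1 (N : ℕ) :
    -- the ingredients of `Y` are well defined
    (∀ μ : SzegoRHP.MatMeasure N, SzegoRHP.QuasiDefinite μ → ∀ n : ℕ,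
      (∃! P, SzegoRHP.IsSzego1L μ n P) ∧ (∃! P, SzegoRHP.IsSzego1R μ n P) ∧
      (∃! P, SzegoRHP.IsSzego2R μ n P) ∧ IsUnit (SzegoRHP.quasiTauR μ n)) ∧
    -- the weak problem
    (∀ (μ : SzegoRHP.MatMeasure N) (w : Circle → SzegoRHP.Mat N),
      SzegoRHP.QuasiDefinite μ → SzegoRHP.IsDerivativeOf w μ →
      ∀ n : ℕ, SzegoRHP.SolvesWeakRHP w n (SzegoRHP.Y μ n)) ∧
    -- the strong problem
    (∀ w : Circle → SzegoRHP.Mat N,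
      SzegoRHP.IsHolderWeight w → SzegoRHP.QuasiDefinite (SzegoRHP.densityMeasure w) →
      ∀ n : ℕ,
        SzegoRHP.SolvesStrongRHP w n (SzegoRHP.Y (SzegoRHP.densityMeasure w) n) ∧
        (∀ Z : ℂ → SzegoRHP.BlockMat N, SzegoRHP.SolvesStrongRHP w n Z →
          ∀ z : ℂ, ‖z‖ ≠ 1 → Z z = SzegoRHP.Y (SzegoRHP.densityMeasure w) n z) ∧
        (∀ z : ℂ, ‖z‖ ≠ 1 → (SzegoRHP.Y (SzegoRHP.densityMeasure w) n z).det = 1)) := by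
  refine ⟨fun μ h n => ⟨SzegoRHP.existsUnique_szego1L h n, SzegoRHP.existsUnique_szego1R h n,
    SzegoRHP.existsUnique_szego2R h n, SzegoRHP.isUnit_quasiTauR h n⟩,
    fun μ w h hw n => SzegoRHP.solvesWeakRHP_Y h hw n, fun w hw h n => ?_⟩
  have hY := SzegoRHP.solvesStrongRHP_Y hw h n
  exact ⟨hY, fun Z hZ z hz => hZ.unique hY hz, fun z hz => hY.det_eq_one hz⟩
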